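/- For an integer $q\ge 2$ and a metric space $(X,d_X)$, the $q$-extent of $X$ is $$\mathrm{xt}_q(X)=\binom{q}{2}^{-1}\sup_{(x_1,\dots,x_q)\in X^q}\ \sum_{1\le i<j\le q}d_X(x_i,x_j).$$ Let $(M,g)$ be a smooth Riemannian manifold of dimension $n\ge 1$, possibly with boundary, let $d_g$ be its Riemannian distance, and let $x$ be an interior point of $M$. For $\varepsilon>0$ let $\bar B^M_\varepsilon(x)=\{y\in M : d_g(x,y)\le\varepsilon\}$ and $\bar B^{\mathbb{R}^n}_\varepsilon=\{y\in\mathbb{R}^n : |y|\le\varepsilon\}$, with the distances $d_g$ and $|\cdot-\cdot|$ restricted to them. Then the limit below exists and $$\mathrm{Scal}_g(x)=\lim_{\varepsilon\to 0^+}\frac{12n^2}{\varepsilon^2}\left(1-\frac{\mathrm{xt}_{n+1}\big(\bar B^M_\varepsilon(x)\big)}{\mathrm{xt}_{n+1}\big(\bar B^{\mathbb{R}^n}_\varepsilon\big)}\right),$$ where $\mathrm{Scal}_g(x)$ is the scalar curvature of $g$ at $x$, i.e. the trace with respect to $g$ of the Ricci tensor (normalized so that the unit sphere $\mathbb{S}^n$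 has scalar curvature $n(n-1)$). -/

import Mathlib

open scoped Manifold ContDiff Bundle ENNReal

noncomputable section

/-- The `q`-extent of a metric space `X`: the maximal (supremal) average of the pairwise distances
of `q` points of `X`. It takes values in `[0, ∞]`, as do the distances of `X`. -/
def extent (q : ℕ) (X : Type*) [PseudoEMetricSpace X] : ℝ≥0∞ :=
  (q.choose 2 : ℝ≥0∞)⁻¹ * ⨆ p : Fin q → X, ∑ i, ∑ j ∈ Finset.Ioi i, edist (p i) (p j)

namespace RiemannianCoord

variable {n : ℕ} {H : Type*} [TopologicalSpace H]
  (I : ModelWithCorners ℝ (EuclideanSpace ℝ (Fin n)) H)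
  {M : Type*} [TopologicalSpace M] [ChartedSpace H M]

/-- The partial derivative `∂ᵢ f` of a function of the coordinates. The coordinates range over
`Set.range I`, which is a neighbourhood of the coordinates of every interior point. -/
def partialDeriv (i : Fin n) (f : EuclideanSpace ℝ (Fin n) → ℝ)
    (y : EuclideanSpace ℝ (Fin n)) : ℝ :=
  fderivWithin ℝ f (Set.range I) y (EuclideanSpace.single i 1)

/-- The coordinate vector field `∂ᵢ` of the preferred chart at `x`, at the point with
coordinates `y`. -/
def coordVector (x : M) (i : Fin n) (y : EuclideanSpace ℝ (Fin n)) :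
    TangentSpace I ((extChartAt I x).symm y) :=
  mfderivWithin 𝓘(ℝ, EuclideanSpace ℝ (Fin n)) I (extChartAt I x).symm (Set.range I) y
    (EuclideanSpace.single i (1 : ℝ) : EuclideanSpace ℝ (Fin n))

variable [Bundle.RiemannianBundle (fun x : M ↦ TangentSpace I x)]

/-- The matrix `g_{ij} = g(∂ᵢ, ∂ⱼ)` of the Riemannian metric in the preferred chart at `x`. -/
def metricMatrix (x : M) (y : EuclideanSpace ℝ (Fin n)) : Matrix (Fin n) (Fin n) ℝ :=
  Matrix.of fun i j ↦ inner ℝ (coordVector I x i y) (coordVector I x j y)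

/-- The Christoffel symbol
`Γᵏᵢⱼ = ½ ∑ₗ gᵏˡ (∂ᵢ g_{jl} + ∂ⱼ g_{il} - ∂ₗ g_{ij})` of the Levi-Civita connection. -/
def christoffel (x : M) (k i j : Fin n) (y : EuclideanSpace ℝ (Fin n)) : ℝ :=
  (1 / 2) * ∑ l, (metricMatrix I x y)⁻¹ k l *
    (partialDeriv I i (fun z ↦ metricMatrix I x z j l) y
      + partialDeriv I j (fun z ↦ metricMatrix I x z i l) y
      - partialDeriv I l (fun z ↦ metricMatrix I x z i j) y)

/-- The components `Rˡᵢⱼₖ` of the Riemann tensor, `R(∂ᵢ, ∂ⱼ) ∂ₖ = ∑ₗ Rˡᵢⱼₖ ∂ₗ`, where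
`R(X, Y) Z = ∇_X ∇_Y Z - ∇_Y ∇_X Z - ∇_{[X, Y]} Z`. -/
def riemann (x : M) (l i j k : Fin n) (y : EuclideanSpace ℝ (Fin n)) : ℝ :=
  partialDeriv I i (christoffel I x l j k) y - partialDeriv I j (christoffel I x l i k) y
    + ∑ p, (christoffel I x l i p y * christoffel I x p j k y
      - christoffel I x l j p y * christoffel I x p i k y)

/-- The Ricci tensor `Ric(∂ⱼ, ∂ₖ)`, the trace of `X ↦ R(X, ∂ⱼ) ∂ₖ`. -/
def ricci (x : M) (j k : Fin n) (y : EuclideanSpace ℝ (Fin n)) : ℝ :=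
  ∑ i, riemann I x i i j k y

end RiemannianCoord

/-- The scalar curvature at `x`, that is the trace `∑ⱼₖ gʲᵏ Ric(∂ⱼ, ∂ₖ)` of the Ricci tensor with
respect to the metric, computed in the preferred chart at `x`. -/
def scalarCurvature {n : ℕ} {H : Type*} [TopologicalSpace H]
    (I : ModelWithCorners ℝ (EuclideanSpace ℝ (Fin n)) H)
    {M : Type*} [TopologicalSpace M] [ChartedSpace H M]
    [Bundle.RiemannianBundle (fun x : M ↦ TangentSpace I x)] (x : M) : ℝ :=
  ∑ j, ∑ k, (RiemannianCoord.metricMatrix I x (extChartAt I x x))⁻¹ j k *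
    RiemannianCoord.ricci I x j k (extChartAt I x x)

end

/-! Write `K(a, z) = ⟨R(a, z) z, a⟩` for the curvature at `x`. The proof has two halves: a second
order expansion of the distance near `x`, and a first order perturbation argument for an extremal
problem in the Euclidean unit ball.

Distance. Compose a chart with an affine map that makes the metric at `x` the inner product, and
then with the cubic polynomial `MetricJet.normalMap` whose value at `z` is the 3-jet of the geodesic
with initial velocity `z`. The metric becomes `|a|² - K(a, z)/3 + o(|z|²)|a|²`
(`MetricJet.normalMap_expansion`); this Taylor expansion is all that is used of normal coordinates,
so neither the exponential map nor minimizing geodesics are needed. For coordinates `u, v` of norm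
at most `ρ` and `w = v - u`, it follows that `d = |w| - K(w, u)/(6|w|) + o(ρ²)|w|`
(`NormalChart.abs_edist_sub_le`). The upper bound is the length of the coordinate segment, along
which `K(w, ·)` is constant because `R` is antisymmetric. The lower bound comes from an approximate
calibration: an explicit function with metric gradient at most `1 + o(ρ²)` whose increment from `u`
to `v` is exactly the main term.

Extremal problem. For `n + 1` points of the unit ball of `ℝⁿ` the sum of pairwise distances is at
most `Λ = simplexSum n`, with equality only for regular simplices inscribed in the sphere; an
identity writes the deficit as a sum of squares (`simplexSum_sub_sumDist`). The vertices of such a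
simplex form a tight frame with constant `(n + 1)/n`, so summing the curvature correction over its
edges takes two traces of `R` and gives `Λ Scal/(12 n²)` for every maximizer
(`MetricJet.sumCurv_eq`). A compactness argument shows that, to first order, only the maximizers of
the unperturbed problem matter (`MetricJet.eventually_sumDist_sub_le`). After rescaling, the maximal
sum in the ball of radius `ε` is `ε(Λ - ε² Λ Scal/(12 n²) + o(ε²))`
(`NormalChart.abs_supSum_sub_le`); division by the Euclidean value `εΛ` gives the limit.

That the jet curvature really computes `scalarCurvature` is a separate coordinate calculation,
concluded in `RiemannianCoord.exists_frame`. -/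

noncomputable section

open Set Filter Topology

set_option linter.unusedSectionVars false

namespace RiemannianCoord

variable {n : ℕ} {H : Type*} [TopologicalSpace H]
  (I : ModelWithCorners ℝ (EuclideanSpace ℝ (Fin n)) H)

/-! ### The metric in a chart -/

section Form

variable {M : Type*} [TopologicalSpace M] [ChartedSpace H M]
  [Bundle.RiemannianBundle (fun x : M ↦ TangentSpace I x)]

/-- The metric in the preferred chart at `x`, as a bilinear form depending on the coordinates. -/
def metricForm (x : M) (y : EuclideanSpace ℝ (Fin n)) :
    EuclideanSpace ℝ (Fin n) →L[ℝ] EuclideanSpace ℝ (Fin n) →L[ℝ] ℝ :=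
  ∑ i, ∑ j, metricMatrix I x y i j •
    (EuclideanSpace.proj i : EuclideanSpace ℝ (Fin n) →L[ℝ] ℝ).smulRight
      (EuclideanSpace.proj j : EuclideanSpace ℝ (Fin n) →L[ℝ] ℝ)

lemma metricForm_apply (x : M) (y a b : EuclideanSpace ℝ (Fin n)) :
    metricForm I x y a b = ∑ i, ∑ j, metricMatrix I x y i j * (a i * b j) := by
  simp [metricForm]

/-- The derivative of the inverse chart. -/
def chartDeriv (x : M) (y a : EuclideanSpace ℝ (Fin n)) :
    TangentSpace I ((extChartAt I x).symm y) :=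
  mfderivWithin 𝓘(ℝ, EuclideanSpace ℝ (Fin n)) I (extChartAt I x).symm (Set.range I) y a

lemma chartDeriv_eq_sum (x : M) (y a : EuclideanSpace ℝ (Fin n)) :
    chartDeriv I x y a = ∑ i, a i • coordVector I x i y := by
  have ha : a = ∑ i, a i • (EuclideanSpace.single i (1 : ℝ)) := by
    ext j
    simp [Finset.sum_apply, Pi.single_apply]
  let L : EuclideanSpace ℝ (Fin n) →L[ℝ] TangentSpace I ((extChartAt I x).symm y) :=
    mfderivWithin 𝓘(ℝ, EuclideanSpace ℝ (Fin n)) I (extChartAt I x).symm (Set.range I) y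
  change L a = ∑ i, a i • L (EuclideanSpace.single i (1 : ℝ))
  conv_lhs => rw [ha]
  rw [map_sum]
  simp only [map_smul]

lemma inner_chartDeriv (x : M) (y a b : EuclideanSpace ℝ (Fin n)) :
    inner ℝ (chartDeriv I x y a) (chartDeriv I x y b) = metricForm I x y a b := by
  rw [chartDeriv_eq_sum, chartDeriv_eq_sum, metricForm_apply, sum_inner]
  refine Finset.sum_congr rfl fun i _ ↦ ?_
  rw [inner_sum]
  refine Finset.sum_congr rfl fun j _ ↦ ?_
  rw [real_inner_smul_left, real_inner_smul_right]
  simp only [metricMatrix, Matrix.of_apply]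
  ring

lemma metricForm_symm (x : M) (y a b : EuclideanSpace ℝ (Fin n)) :
    metricForm I x y a b = metricForm I x y b a := by
  rw [← inner_chartDeriv, ← inner_chartDeriv, real_inner_comm]

lemma norm_chartDeriv (x : M) (y a : EuclideanSpace ℝ (Fin n)) :
    ‖chartDeriv I x y a‖ = √(metricForm I x y a a) := by
  rw [norm_eq_sqrt_real_inner, inner_chartDeriv]

variable [IsManifold I ∞ M]

lemma chartDeriv_eq_symmL (x : M) {y : EuclideanSpace ℝ (Fin n)}
    (hy : y ∈ (extChartAt I x).target) (a : EuclideanSpace ℝ (Fin n)) :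
    chartDeriv I x y a = (trivializationAt (EuclideanSpace ℝ (Fin n)) (TangentSpace I) x).symmL ℝ
      ((extChartAt I x).symm y) a := by
  have h := TangentBundle.symmL_trivializationAt (I := I) (x₀ := x)
    (x := (extChartAt I x).symm y) (by
      have := (extChartAt I x).map_target hy
      rwa [extChartAt_source] at this)
  have h2 : extChartAt I x ((extChartAt I x).symm y) = y := (extChartAt I x).right_inv hy
  -- The two derivatives live over different base points, so they are compared after identifying all
  -- tangent spaces with the model space.
  have key : ∀ y' : EuclideanSpace ℝ (Fin n), y' = y →
      (show EuclideanSpace ℝ (Fin n) →L[ℝ] EuclideanSpace ℝ (Fin n) from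
        mfderivWithin 𝓘(ℝ, EuclideanSpace ℝ (Fin n)) I (extChartAt I x).symm (Set.range I) y') =
      (show EuclideanSpace ℝ (Fin n) →L[ℝ] EuclideanSpace ℝ (Fin n) from
        mfderivWithin 𝓘(ℝ, EuclideanSpace ℝ (Fin n)) I (extChartAt I x).symm (Set.range I) y) := by
    rintro _ rfl; rfl
  exact (congrArg (fun L : EuclideanSpace ℝ (Fin n) →L[ℝ] EuclideanSpace ℝ (Fin n) ↦ L a)
    (h.trans (key _ h2))).symm

lemma metricForm_self_pos (x : M) {y : EuclideanSpace ℝ (Fin n)}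
    (hy : y ∈ (extChartAt I x).target) {a : EuclideanSpace ℝ (Fin n)} (ha : a ≠ 0) :
    0 < metricForm I x y a a := by
  rw [← inner_chartDeriv, real_inner_self_pos, chartDeriv_eq_symmL I x hy]
  have hb : (extChartAt I x).symm y ∈
      (trivializationAt (EuclideanSpace ℝ (Fin n)) (TangentSpace I) x).baseSet := by
    have := (extChartAt I x).map_target hy
    rwa [extChartAt_source] at this
  intro h0
  apply ha
  have := (trivializationAt (EuclideanSpace ℝ (Fin n))
    (TangentSpace I) x).continuousLinearMapAt_symmL (R := ℝ) hb a
  rw [← this, h0, map_zero]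

variable [IsContMDiffRiemannianBundle I ∞ (EuclideanSpace ℝ (Fin n))
  (fun x : M ↦ TangentSpace I x)]

/-- Near `x` the coordinate fields form the local frame of the tangent trivialization, and inner
products of smooth sections are smooth. Interiority makes `range I` a neighbourhood, so that
smoothness within it is smoothness at the point. -/
lemma contDiffAt_metricMatrix (x : M) (hx : I.IsInteriorPoint x) (i j : Fin n) :
    ContDiffAt ℝ ∞ (fun y ↦ metricMatrix I x y i j) (extChartAt I x x) := by
  let e := trivializationAt (EuclideanSpace ℝ (Fin n)) (TangentSpace I : M → Type _) x
  let b := (EuclideanSpace.basisFun (Fin n) ℝ).toBasis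
  have hxe : x ∈ e.baseSet := FiberBundle.mem_baseSet_trivializationAt' x
  have hs (k : Fin n) : CMDiffAt ∞ (T% (e.localFrame b k)) x :=
    contMDiffAt_localFrame_of_mem ∞ e b k hxe
  have hinner : CMDiffAt ∞ (fun p : M ↦ inner ℝ (e.localFrame b i p) (e.localFrame b j p)) x :=
    (hs i).inner_bundle (hs j)
  have hnhds : range I ∈ 𝓝 (extChartAt I x x) := mem_interior_iff_mem_nhds.1 hx
  have hsymm : CMDiffAt ∞ (extChartAt I x).symm (extChartAt I x x) := by
    have := contMDiffWithinAt_extChartAt_symm_range (n := ∞) (I := I) x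
      (mem_extChartAt_target (I := I) x)
    exact this.contMDiffAt hnhds
  have hcomp : CMDiffAt ∞ ((fun p : M ↦ inner ℝ (e.localFrame b i p) (e.localFrame b j p)) ∘
      (extChartAt I x).symm) (extChartAt I x x) := by
    apply ContMDiffAt.comp (I' := I) _ _ hsymm
    rw [extChartAt_to_inv]
    exact hinner
  rw [contMDiffAt_iff_contDiffAt] at hcomp
  refine hcomp.congr_of_eventuallyEq ?_
  have htarget : (extChartAt I x).target ∈ 𝓝 (extChartAt I x x) := by
    have := extChartAt_target_mem_nhdsWithin (I := I) x
    rwa [nhdsWithin_eq_nhds.2 hnhds] at this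
  filter_upwards [htarget] with y hy
  have hb : (extChartAt I x).symm y ∈ e.baseSet := by
    have := (extChartAt I x).map_target hy
    rwa [extChartAt_source] at this
  have hframe (k : Fin n) : coordVector I x k y = e.localFrame b k ((extChartAt I x).symm y) := by
    rw [e.localFrame_apply_of_mem_baseSet b hb]
    have := chartDeriv_eq_symmL I x hy (EuclideanSpace.single k 1)
    refine this.trans ?_
    rw [Bundle.Trivialization.basisAt, Module.Basis.map_apply]
    simp only [b, OrthonormalBasis.coe_toBasis, EuclideanSpace.basisFun_apply]
    rw [Bundle.Trivialization.linearEquivAt_symm_apply]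
    exact e.symmL_apply (R := ℝ) hb _
  simp only [metricMatrix, Matrix.of_apply, hframe, Function.comp]

end Form

/-! ### Riemannian distance against curves and functions in a chart -/

section Distance

open MeasureTheory Manifold

variable {M : Type*} [EMetricSpace M] [ChartedSpace H M] [IsManifold I ∞ M]
  [Bundle.RiemannianBundle (fun x : M ↦ TangentSpace I x)]

lemma mfderivWithin_symm_comp (x : M) {c : ℝ → EuclideanSpace ℝ (Fin n)} {s : Set ℝ} {t : ℝ}
    (hc : DifferentiableWithinAt ℝ c s t) (ht : c t ∈ (extChartAt I x).target)
    (hs : s ⊆ c ⁻¹' range I) (hu : UniqueDiffWithinAt ℝ s t) :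
    mfderivWithin 𝓘(ℝ, ℝ) I ((extChartAt I x).symm ∘ c) s t (1 : ℝ) =
      chartDeriv I x (c t) (derivWithin c s t) := by
  have h : mfderivWithin 𝓘(ℝ, ℝ) I ((extChartAt I x).symm ∘ c) s t =
      (mfderivWithin 𝓘(ℝ, EuclideanSpace ℝ (Fin n)) I (extChartAt I x).symm (range I) (c t)) ∘L
        (mfderivWithin 𝓘(ℝ, ℝ) 𝓘(ℝ, EuclideanSpace ℝ (Fin n)) c s t) := by
    apply mfderivWithin_comp
    · exact mdifferentiableWithinAt_extChartAt_symm ht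
    · rwa [mdifferentiableWithinAt_iff_differentiableWithinAt]
    · exact hs
    · rwa [uniqueMDiffWithinAt_iff_uniqueDiffWithinAt]
  rw [h, mfderivWithin_eq_fderivWithin]
  rfl

lemma enorm_chartDeriv (x : M) (y a : EuclideanSpace ℝ (Fin n)) :
    ‖chartDeriv I x y a‖ₑ = ENNReal.ofReal √(metricForm I x y a a) := by
  rw [← norm_chartDeriv, ofReal_norm]

variable [IsRiemannianManifold I M]

/-- The Riemannian distance of two points joined by a curve in the chart is at most any bound for
the speed of the curve. -/
lemma edist_symm_le (x : M) {c : ℝ → EuclideanSpace ℝ (Fin n)} {B : ℝ}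
    (hc : ContDiffOn ℝ 1 c (Icc 0 1)) (ht : ∀ t ∈ Icc (0 : ℝ) 1, c t ∈ (extChartAt I x).target)
    (hB : ∀ t ∈ Icc (0 : ℝ) 1, √(metricForm I x (c t) (derivWithin c (Icc 0 1) t)
      (derivWithin c (Icc 0 1) t)) ≤ B) :
    edist ((extChartAt I x).symm (c 0)) ((extChartAt I x).symm (c 1)) ≤ ENNReal.ofReal B := by
  rw [IsRiemannianManifold.out (I := I)]
  have hγ : CMDiff[Icc 0 1] 1 ((extChartAt I x).symm ∘ c) :=
    (contMDiffOn_extChartAt_symm x).comp (contMDiffOn_iff_contDiffOn.2 hc) ht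
  refine (riemannianEDist_le_pathELength hγ rfl rfl zero_le_one).trans ?_
  rw [pathELength_eq_lintegral_mfderivWithin_Icc]
  calc ∫⁻ t in Icc (0 : ℝ) 1, ‖mfderivWithin 𝓘(ℝ, ℝ) I ((extChartAt I x).symm ∘ c)
          (Icc 0 1) t (1 : ℝ)‖ₑ
      ≤ ∫⁻ t in Icc (0 : ℝ) 1, ENNReal.ofReal B := by
        apply setLIntegral_mono' measurableSet_Icc (fun t h ↦ ?_)
        rw [mfderivWithin_symm_comp I x (hc.differentiableOn one_ne_zero t h) (ht t h)
          (fun t h ↦ extChartAt_target_subset_range x (ht t h))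
          (uniqueDiffOn_Icc zero_lt_one t h)]
        have := enorm_chartDeriv I x (c t) (derivWithin c (Icc 0 1) t)
        refine this.trans_le (ENNReal.ofReal_le_ofReal (hB t h))
    _ = ENNReal.ofReal B := by simp

/-- A function of the coordinates whose derivative is bounded by `B` with respect to the metric is
`B`-Lipschitz with respect to the Riemannian distance. -/
lemma ofReal_abs_sub_le (x p q : M) {f : EuclideanSpace ℝ (Fin n) → ℝ} {B : ℝ} {R : ℝ≥0∞}
    (hB : 0 ≤ B) (hsource : Metric.eball p R ⊆ (extChartAt I x).source)
    (hf : ∀ z ∈ Metric.eball p R, ContDiffAt ℝ 1 f (extChartAt I x z))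
    (hfB : ∀ z ∈ Metric.eball p R, ∀ a, |fderiv ℝ f (extChartAt I x z) a| ≤
      B * √(metricForm I x (extChartAt I x z) a a))
    (hpq : edist p q < R) :
    ENNReal.ofReal |f (extChartAt I x q) - f (extChartAt I x p)| ≤
      ENNReal.ofReal B * edist p q := by
  -- The distance is an infimum that need not be attained, so the bound is proved for every `r`
  -- above it and then `r` decreases to it.
  have main : ∀ r, edist p q < r → r ≤ R →
      ENNReal.ofReal |f (extChartAt I x q) - f (extChartAt I x p)| ≤ ENNReal.ofReal B * r := by
    intro r hr hrR
    rw [IsRiemannianManifold.out (I := I)] at hr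
    obtain ⟨γ, hγp, hγq, hγ, hlen, -⟩ :=
      exists_lt_locally_constant_of_riemannianEDist_lt hr zero_lt_one
    -- A curve from `p` of length less than `R` cannot leave the ball: each of its initial arcs is
    -- at most as long as the whole curve.
    have hball : ∀ t ∈ Icc (0 : ℝ) 1, γ t ∈ Metric.eball p R := by
      intro t ht
      rw [Metric.mem_eball, edist_comm, IsRiemannianManifold.out (I := I)]
      have h1 := riemannianEDist_le_pathELength (I := I) hγ.contMDiffOn hγp rfl ht.1
      have h2 : pathELength I γ 0 t ≤ pathELength I γ 0 1 := pathELength_mono le_rfl ht.2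
      exact (h1.trans h2).trans_lt (hlen.trans_le hrR)
    set c : ℝ → EuclideanSpace ℝ (Fin n) := extChartAt I x ∘ γ with hc
    have hcd : ContDiffOn ℝ 1 c (Icc 0 1) := by
      rw [← contMDiffOn_iff_contDiffOn]
      refine contMDiffOn_extChartAt.comp (I' := I) (t := (chartAt H x).source)
        hγ.contMDiffOn (fun t ht ↦ ?_)
      have := hsource (hball t ht)
      rwa [extChartAt_source] at this
    have hfc : ContDiffOn ℝ 1 (f ∘ c) (Icc 0 1) := fun t ht ↦
      (hf _ (hball t ht)).comp_contDiffWithinAt t (hcd t ht)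
    have hγc : EqOn γ ((extChartAt I x).symm ∘ c) (Icc 0 1) := fun t ht ↦
      ((extChartAt I x).left_inv (hsource (hball t ht))).symm
    have htar : ∀ t ∈ Icc (0 : ℝ) 1, c t ∈ (extChartAt I x).target := fun t ht ↦
      (extChartAt I x).map_source (hsource (hball t ht))
    have hud := uniqueDiffOn_Icc (zero_lt_one (α := ℝ))
    have hstep : ENNReal.ofReal |f (c 1) - f (c 0)| ≤
        ∫⁻ t in Icc (0 : ℝ) 1, ‖derivWithin (f ∘ c) (Icc 0 1) t‖ₑ := by
      have := enorm_sub_le_lintegral_derivWithin_Icc_of_contDiffOn_Icc hfc zero_le_one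
      rwa [Real.enorm_eq_ofReal_abs] at this
    calc ENNReal.ofReal |f (extChartAt I x q) - f (extChartAt I x p)|
        = ENNReal.ofReal |f (c 1) - f (c 0)| := by simp only [hc, Function.comp, hγp, hγq]
      _ ≤ ∫⁻ t in Icc (0 : ℝ) 1, ‖derivWithin (f ∘ c) (Icc 0 1) t‖ₑ := hstep
      _ ≤ ∫⁻ t in Icc (0 : ℝ) 1, ENNReal.ofReal B *
            ‖mfderivWithin 𝓘(ℝ, ℝ) I ((extChartAt I x).symm ∘ c) (Icc 0 1) t (1 : ℝ)‖ₑ := by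
        apply setLIntegral_mono' measurableSet_Icc (fun t h ↦ ?_)
        rw [mfderivWithin_symm_comp I x (hcd.differentiableOn one_ne_zero t h) (htar t h)
          (fun t h ↦ extChartAt_target_subset_range x (htar t h)) (hud t h)]
        have h1 := enorm_chartDeriv I x (c t) (derivWithin c (Icc 0 1) t)
        have h2 : derivWithin (f ∘ c) (Icc 0 1) t =
            fderiv ℝ f (c t) (derivWithin c (Icc 0 1) t) :=
          (((hf _ (hball t h)).differentiableAt one_ne_zero).hasFDerivAt.comp_hasDerivWithinAt t
            (hcd.differentiableOn one_ne_zero t h).hasDerivWithinAt).derivWithin (hud t h)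
        rw [h2, Real.enorm_eq_ofReal_abs]
        refine (ENNReal.ofReal_le_ofReal (hfB _ (hball t h) _)).trans_eq ?_
        rw [ENNReal.ofReal_mul hB]
        exact congrArg _ h1.symm
      _ = ENNReal.ofReal B * pathELength I γ 0 1 := by
        rw [lintegral_const_mul' _ _ ENNReal.ofReal_ne_top, pathELength_congr hγc,
          pathELength_eq_lintegral_mfderivWithin_Icc]
        rfl
      _ ≤ ENNReal.ofReal B * r := by gcongr
  have hne : Filter.NeBot (𝓝[>] (edist p q)) := nhdsGT_neBot_of_exists_gt ⟨R, hpq⟩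
  have hlim : Tendsto (fun r ↦ ENNReal.ofReal B * r) (𝓝[>] (edist p q))
      (𝓝 (ENNReal.ofReal B * edist p q)) :=
    (ENNReal.Tendsto.const_mul tendsto_id (Or.inr ENNReal.ofReal_ne_top)).mono_left
      nhdsWithin_le_nhds
  refine ge_of_tendsto hlim ?_
  filter_upwards [Ioc_mem_nhdsGT hpq] with r hr using main r hr.1 hr.2

end Distance

end RiemannianCoord

end

noncomputable section

open Set Filter Topology Asymptotics

/-! ### Second order Taylor expansion -/

section Taylor

variable {E F : Type*} [NormedAddCommGroup E] [NormedSpace ℝ E] [NormedAddCommGroup F]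
  [NormedSpace ℝ F]

/-- Second order Taylor expansion at `0` with Peano remainder. -/
lemma ContDiffAt.taylor_two {f : E → F} (hf : ContDiffAt ℝ 2 f 0) {δ : ℝ} (hδ : 0 < δ) :
    ∀ᶠ z in 𝓝 (0 : E), ‖f z - f 0 - fderiv ℝ f 0 z
      - (1 / 2 : ℝ) • fderiv ℝ (fderiv ℝ f) 0 z z‖ ≤ δ * ‖z‖ ^ 2 := by
  have hd : ∀ᶠ z in 𝓝 (0 : E), DifferentiableAt ℝ f z := by
    filter_upwards [hf.eventually (by simp)] with z hz using hz.differentiableAt (by simp)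
  have hf' : DifferentiableAt ℝ (fderiv ℝ f) 0 :=
    (hf.fderiv_right (m := 1) (by norm_num)).differentiableAt (by simp)
  have hsymm : IsSymmSndFDerivAt ℝ f 0 := hf.isSymmSndFDerivAt (by simp)
  set D2 := fderiv ℝ (fderiv ℝ f) 0 with hD2
  have hlo := hf'.hasFDerivAt.isLittleO
  rw [isLittleO_iff] at hlo
  have hlo' := hlo hδ
  obtain ⟨r, hr, hball⟩ := Metric.eventually_nhds_iff_ball.1 (hd.and hlo')
  filter_upwards [Metric.ball_mem_nhds (0 : E) hr] with z hz
  -- By symmetry of the second derivative, the derivative of the remainder `ρ` at `y` is the first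
  -- order remainder of `fderiv ℝ f`, of norm at most `δ‖y‖`. The mean value inequality on the
  -- segment from `0` to `z` supplies the second factor `‖z‖`.
  let ρ : E → F := fun y ↦ f y - f 0 - fderiv ℝ f 0 y - (1 / 2 : ℝ) • D2 y y
  have hρ : ∀ y ∈ Metric.ball (0 : E) r,
      HasFDerivAt ρ (fderiv ℝ f y - fderiv ℝ f 0 - D2 y) y := by
    intro y hy
    have h1 := (hball y hy).1.hasFDerivAt
    have h2 : HasFDerivAt (fun y ↦ D2 y y) (D2.precompR E y (ContinuousLinearMap.id ℝ E) +
        D2.precompL E (ContinuousLinearMap.id ℝ E) y) y :=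
      D2.hasFDerivAt_of_bilinear (hasFDerivAt_id y) (hasFDerivAt_id y)
    have h3 := ((h1.sub_const (f 0)).sub (fderiv ℝ f 0).hasFDerivAt).sub (h2.const_smul (1 / 2 : ℝ))
    refine h3.congr_fderiv ?_
    ext v
    have hs : D2 v y = D2 y v := hsymm v y
    simp only [sub_apply, smul_apply, add_apply, ContinuousLinearMap.precompR_apply,
      ContinuousLinearMap.compL_apply, ContinuousLinearMap.comp_apply,
      ContinuousLinearMap.precompL_apply, ContinuousLinearMap.id_apply, hs]
    rw [← two_smul ℝ, smul_smul]
    norm_num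
  have hseg : ∀ y ∈ segment ℝ (0 : E) z, ‖y‖ ≤ ‖z‖ := by
    rintro y hy
    rw [segment_eq_image] at hy
    obtain ⟨t, ht, rfl⟩ := hy
    simp only [smul_zero, zero_add, norm_smul, Real.norm_eq_abs, abs_of_nonneg ht.1]
    exact mul_le_of_le_one_left (norm_nonneg _) ht.2
  have hz' : ‖z‖ < r := by simpa using hz
  have hin : ∀ y ∈ segment ℝ (0 : E) z, y ∈ Metric.ball (0 : E) r := fun y hy ↦ by
    simpa using (hseg y hy).trans_lt hz'
  have hmv := (convex_segment (0 : E) z).norm_image_sub_le_of_norm_hasFDerivWithin_le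
    (f := ρ) (C := δ * ‖z‖) (fun y hy ↦ (hρ y (hin y hy)).hasFDerivWithinAt)
    (fun y hy ↦ by
      have := (hball y (hin y hy)).2
      simp only [sub_zero] at this
      exact this.trans (by gcongr; exact hseg y hy))
    (left_mem_segment ℝ 0 z) (right_mem_segment ℝ 0 z)
  have h0 : ρ 0 = 0 := by simp [ρ]
  rw [h0, sub_zero, sub_zero] at hmv
  calc _ = ‖ρ z‖ := rfl
    _ ≤ _ := hmv
    _ = _ := by ring

/-- The second derivative along a ray. -/
lemma ContDiffAt.hasDerivAt_ray {f : E → F} (hf : ContDiffAt ℝ 2 f 0) (z : E) :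
    (∀ᶠ t in 𝓝 (0 : ℝ), HasDerivAt (fun t : ℝ ↦ f (t • z)) (fderiv ℝ f (t • z) z) t) ∧
    HasDerivAt (fun t : ℝ ↦ fderiv ℝ f (t • z) z) (fderiv ℝ (fderiv ℝ f) 0 z z) 0 := by
  have hray (t : ℝ) : HasDerivAt (fun t : ℝ ↦ t • z) z t := by
    simpa using (hasDerivAt_id t).smul_const z
  have hcont : Tendsto (fun t : ℝ ↦ t • z) (𝓝 0) (𝓝 0) := by
    have := (hray 0).continuousAt.tendsto
    simpa using this
  have hd : ∀ᶠ z in 𝓝 (0 : E), DifferentiableAt ℝ f z := by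
    filter_upwards [hf.eventually (by simp)] with z hz using hz.differentiableAt (by simp)
  have hf' : DifferentiableAt ℝ (fderiv ℝ f) 0 :=
    (hf.fderiv_right (m := 1) (by norm_num)).differentiableAt (by simp)
  refine ⟨?_, ?_⟩
  · filter_upwards [hcont.eventually hd] with t ht
    exact ht.hasFDerivAt.comp_hasDerivAt t (hray t)
  · have hf'' : HasFDerivAt (fderiv ℝ f) (fderiv ℝ (fderiv ℝ f) 0) ((0 : ℝ) • z) := by
      rw [zero_smul]; exact hf'.hasFDerivAt
    have := hf''.comp_hasDerivAt 0 (hray 0)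
    exact this.clm_apply (hasDerivAt_const 0 z) |>.congr_deriv (by simp)

end Taylor

end

noncomputable section

open Set Filter Topology Asymptotics

set_option linter.unusedSectionVars false

open scoped RealInnerProductSpace

/-! ### Metric jets: connection, cubic term of geodesics, curvature -/

section Shortcuts

variable (E : Type*) [NormedAddCommGroup E] [NormedSpace ℝ E]

instance bilinNormedAddCommGroup : NormedAddCommGroup (E →L[ℝ] E →L[ℝ] ℝ) := inferInstance

instance bilinNormedSpace : NormedSpace ℝ (E →L[ℝ] E →L[ℝ] ℝ) := inferInstance

instance trilinNormedAddCommGroup : NormedAddCommGroup (E →L[ℝ] E →L[ℝ] E →L[ℝ] ℝ) :=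
  inferInstance

instance trilinNormedSpace : NormedSpace ℝ (E →L[ℝ] E →L[ℝ] E →L[ℝ] ℝ) := inferInstance

end Shortcuts

set_option synthInstance.maxHeartbeats 200000

/-- The second order jet at a point of a field of symmetric bilinear forms that is the inner product
at that point: `d1 z a b` and `d2 z w a b` are the first and second derivatives of the form
`(a, b)` in the directions `z` and `z, w`. -/
structure MetricJet (E : Type*) [NormedAddCommGroup E] [InnerProductSpace ℝ E] where
  /-- the first derivative -/
  d1 : E →L[ℝ] E →L[ℝ] E →L[ℝ] ℝ
  /-- the second derivative -/
  d2 : E →L[ℝ] E →L[ℝ] E →L[ℝ] E →L[ℝ] ℝ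
  d1_symm : ∀ z a b, d1 z a b = d1 z b a
  d2_symm : ∀ z w a b, d2 z w a b = d2 z w b a
  d2_comm : ∀ z w a b, d2 z w a b = d2 w z a b

namespace MetricJet

variable {E : Type*} [NormedAddCommGroup E] [InnerProductSpace ℝ E] [FiniteDimensional ℝ E]

variable (E) in
/-- The vector dual to a linear form. -/
def raise : (E →L[ℝ] ℝ) →L[ℝ] E :=
  ∑ i, (ContinuousLinearMap.apply ℝ ℝ (stdOrthonormalBasis ℝ E i)).smulRight
    (stdOrthonormalBasis ℝ E i)

lemma inner_raise (l : E →L[ℝ] ℝ) (c : E) : ⟪raise E l, c⟫ = l c := by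
  have h := (stdOrthonormalBasis ℝ E).sum_repr' c
  conv_rhs => rw [← h]
  simp only [raise, sum_apply, ContinuousLinearMap.smulRight_apply,
    ContinuousLinearMap.apply_apply, sum_inner, real_inner_smul_left, map_sum, map_smul,
    smul_eq_mul]
  exact Finset.sum_congr rfl fun i _ ↦ mul_comm _ _

variable (J : MetricJet E)

/-- The negative of the Christoffel symbols, as a linear form. -/
def connForm : E →L[ℝ] E →L[ℝ] E →L[ℝ] ℝ :=
  (-(1 / 2) : ℝ) • (J.d1 + J.d1.flip -
    ((ContinuousLinearMap.flipₗᵢ ℝ E E ℝ : (E →L[ℝ] E →L[ℝ] ℝ) →L[ℝ] (E →L[ℝ] E →L[ℝ] ℝ)) ∘L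
      J.d1.flip))

lemma connForm_apply (a b c : E) :
    J.connForm a b c = -(1 / 2) * (J.d1 a b c + J.d1 b a c - J.d1 c a b) := by
  simp [connForm]

/-- The negative of the Christoffel symbols. -/
def conn : E →L[ℝ] E →L[ℝ] E :=
  (ContinuousLinearMap.compL ℝ E (E →L[ℝ] ℝ) E (raise E)) ∘L J.connForm

lemma inner_conn (a b c : E) :
    ⟪J.conn a b, c⟫ = -(1 / 2) * (J.d1 a b c + J.d1 b a c - J.d1 c a b) := by
  rw [← connForm_apply, ← inner_raise]
  rfl

lemma conn_symm (a b : E) : J.conn a b = J.conn b a := by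
  refine ext_inner_right ℝ fun c ↦ ?_
  rw [inner_conn, inner_conn, J.d1_symm c a b]
  ring

/-- Compatibility of the connection with the metric at the origin; `conn` is minus the Christoffel
symbol, hence the signs. -/
lemma d1_eq (z a b : E) : J.d1 z a b = -⟪J.conn z a, b⟫ - ⟪J.conn z b, a⟫ := by
  have h1 := J.d1_symm b z a
  have h2 := J.d1_symm a b z
  rw [inner_conn, inner_conn, J.d1_symm z b a]
  linarith

/-- The cubic term of the coordinate change to normal coordinates, as a linear form. -/
def cubicForm (z : E) : E →L[ℝ] ℝ :=
  -J.d2 z z z + (1 / 2 : ℝ) • ((J.d2 z).flip z).flip z + (3 : ℝ) • innerSL ℝ (J.conn (J.conn z z) z)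
    + (innerSL ℝ (J.conn z z)).comp (J.conn z)

lemma cubicForm_apply (z c : E) : J.cubicForm z c = -J.d2 z z z c + 1 / 2 * J.d2 z c z z
    + 3 * ⟪J.conn (J.conn z z) z, c⟫ + ⟪J.conn z z, J.conn z c⟫ := by
  simp [cubicForm]

/-- The cubic term of the coordinate change to normal coordinates. -/
def cubic (z : E) : E := raise E (J.cubicForm z)

/-- The right side is `⟨γ'''(0), c⟩` for the geodesic `γ` with velocity `z`. It results from
differentiating the geodesic equation `(g(γ', c))' = ½ ∂_c g(γ', γ')` once at time `0`, with `γ''(0)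
= conn z z`, and then eliminating `d1` through `inner_conn` and `d1_eq`. -/
lemma inner_cubic (z c : E) : ⟪J.cubic z, c⟫ = -J.d2 z z z c + 1 / 2 * J.d2 z c z z
    + 3 * ⟪J.conn (J.conn z z) z, c⟫ + ⟪J.conn z z, J.conn z c⟫ := by
  rw [cubic, inner_raise, cubicForm_apply]

lemma contDiff_cubic : ContDiff ℝ ∞ J.cubic := by
  have h1 : ContDiff ℝ ∞ fun z ↦ ((J.d2 z).flip z).flip z := by
    have ha : ContDiff ℝ ∞ fun z ↦ (J.d2 z).flip :=
      ((ContinuousLinearMap.flipₗᵢ ℝ E E (E →L[ℝ] ℝ)).toContinuousLinearEquiv.contDiff).comp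
        J.d2.contDiff
    have hb : ContDiff ℝ ∞ fun z ↦ ((J.d2 z).flip z).flip :=
      ((ContinuousLinearMap.flipₗᵢ ℝ E E ℝ).toContinuousLinearEquiv.contDiff).comp
        (ha.clm_apply contDiff_id)
    exact hb.clm_apply contDiff_id
  have hi : ContDiff ℝ ∞ fun z : E ↦ innerSL ℝ z :=
    (innerSL ℝ : E →L[ℝ] E →L[ℝ] ℝ).contDiff
  have h2 : ContDiff ℝ ∞ fun z ↦ innerSL ℝ (J.conn (J.conn z z) z) := hi.comp (by fun_prop)
  have h3 : ContDiff ℝ ∞ fun z ↦ (innerSL ℝ (J.conn z z)).comp (J.conn z) :=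
    ContDiff.clm_comp (hi.comp (by fun_prop)) (by fun_prop)
  have h4 : ContDiff ℝ ∞ J.cubicForm := by
    unfold cubicForm
    exact ((ContDiff.neg (by fun_prop)).add (h1.const_smul _)).add (h2.const_smul _) |>.add h3
  exact (raise E).contDiff.comp h4

lemma cubic_smul (t : ℝ) (z : E) : J.cubic (t • z) = t ^ 3 • J.cubic z := by
  refine ext_inner_right ℝ fun c ↦ ?_
  rw [real_inner_smul_left, inner_cubic, inner_cubic]
  simp only [map_smul, smul_apply, real_inner_smul_left, real_inner_smul_right, smul_eq_mul]
  ring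

/-- Since `cubic` is a homogeneous cubic, `⟪J.cubic (z + s • a), a⟫` is a polynomial in `s`; the
derivative is its linear coefficient. -/
lemma inner_fderiv_cubic (z a : E) : ⟪fderiv ℝ J.cubic z a, a⟫ =
    -J.d2 z z a a - J.d2 z a z a + 1 / 2 * J.d2 a a z z
      + 3 * ⟪J.conn (J.conn z z) a, a⟫ + 6 * ⟪J.conn (J.conn z a) z, a⟫
      + ⟪J.conn z z, J.conn a a⟫ + 2 * ⟪J.conn z a, J.conn z a⟫ := by
  have h1 : HasDerivAt (fun s : ℝ ↦ ⟪J.cubic (z + s • a), a⟫) ⟪fderiv ℝ J.cubic z a, a⟫ 0 := by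
    have hl : HasDerivAt (fun s : ℝ ↦ z + s • a) a 0 := by
      simpa using ((hasDerivAt_id (0 : ℝ)).smul_const a).const_add z
    have hc : HasFDerivAt J.cubic (fderiv ℝ J.cubic z) (z + (0 : ℝ) • a) := by
      rw [zero_smul, add_zero]
      exact (J.contDiff_cubic.differentiable (by simp) z).hasFDerivAt
    have := (hc.comp_hasDerivAt 0 hl).inner ℝ (hasDerivAt_const 0 a)
    simpa using this
  refine h1.unique ?_
  have hpoly (A0 A1 A2 A3 : ℝ) :
      HasDerivAt (fun s : ℝ ↦ A0 + s * A1 + s ^ 2 * A2 + s ^ 3 * A3) A1 0 := by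
    have h1 := ((hasDerivAt_id (0 : ℝ)).mul_const A1).const_add A0
    have h2 := ((hasDerivAt_pow 2 (0 : ℝ)).mul_const A2)
    have h3 := ((hasDerivAt_pow 3 (0 : ℝ)).mul_const A3)
    exact ((h1.add h2).add h3).congr_deriv (by simp)
  have h5 : J.conn a z = J.conn z a := J.conn_symm a z
  have h6 := J.d2_comm a z z a
  have h7 := J.d2_symm z a a z
  refine (hpoly ⟪J.cubic z, a⟫ _ (-J.d2 z a a a - J.d2 a z a a - J.d2 a a z a
      + 1 / 2 * (J.d2 z a a a + J.d2 a a z a + J.d2 a a a z) + 3 * (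
       ⟪J.conn (J.conn a a) z, a⟫ + 2 * ⟪J.conn (J.conn z a) a, a⟫)
      + ⟪J.conn a a, J.conn z a⟫ + 2 * ⟪J.conn z a, J.conn a a⟫)
      ⟪J.cubic a, a⟫).congr_of_eventuallyEq (.of_forall fun s ↦ ?_)
  simp only [inner_cubic, map_add, map_smul, smul_apply, add_apply, inner_add_left,
    inner_add_right, real_inner_smul_left, real_inner_smul_right, smul_eq_mul, h5, h6, h7]
  ring

/-- The sectional curvature form `⟨R(a, u) u, a⟩` of the jet. -/
def curv (a u : E) : ℝ :=
  J.d2 a u u a - 1 / 2 * J.d2 a a u u - 1 / 2 * J.d2 u u a a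
    + ⟪J.conn a u, J.conn a u⟫ - ⟪J.conn a a, J.conn u u⟫

lemma curv_symm (a u : E) : J.curv a u = J.curv u a := by
  simp only [curv, J.d2_comm a u u a, J.d2_symm u a u a, J.conn_symm a u,
    real_inner_comm (J.conn u u)]
  ring

lemma curv_self (a : E) : J.curv a a = 0 := by
  simp only [curv]
  ring

/-- Antisymmetry of the curvature tensor. It makes `J.curv a` constant along lines of direction `a`,
which is why a single value of the curvature governs a whole segment, in the upper as in the lower
bound for the distance. -/
lemma curv_add_smul (a u : E) (t : ℝ) : J.curv a (u + t • a) = J.curv a u := by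
  have h1 := J.d2_comm u a a a
  have h2 := J.d2_symm a a u a
  have h3 := J.conn_symm u a
  have h4 := real_inner_comm (J.conn a u) (J.conn a a)
  simp only [curv, map_add, map_smul, smul_apply, add_apply, inner_add_left,
    inner_add_right, real_inner_smul_left, real_inner_smul_right, smul_eq_mul, h1, h2, h3, h4]
  ring

lemma continuous_curv : Continuous fun p : E × E ↦ J.curv p.1 p.2 := by
  unfold curv
  fun_prop

/-- The curvature form is a quadratic form in its first variable. -/
lemma exists_curv_eq (u : E) : ∃ B : E →ₗ[ℝ] E →ₗ[ℝ] ℝ, ∀ a, J.curv a u = B a a := by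
  refine ⟨LinearMap.mk₂ ℝ (fun a b ↦ J.d2 a u u b - 1 / 2 * J.d2 a b u u - 1 / 2 * J.d2 u u a b
    + ⟪J.conn a u, J.conn b u⟫ - ⟪J.conn a b, J.conn u u⟫) ?_ ?_ ?_ ?_, fun a ↦ rfl⟩ <;> intros <;>
  simp only [map_add, map_smul, smul_apply, add_apply, inner_add_left,
    inner_add_right, real_inner_smul_left, real_inner_smul_right, smul_eq_mul] <;> ring

end MetricJet

end

noncomputable section

open Set Filter Topology Asymptotics

open scoped RealInnerProductSpace

set_option linter.unusedSectionVars false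
set_option synthInstance.maxHeartbeats 200000

namespace MetricJet

variable {E : Type*} [NormedAddCommGroup E] [InnerProductSpace ℝ E] [FiniteDimensional ℝ E]

/-! ### Coordinates normal to third order and the expansion of the metric -/

section NormalMap

variable (J : MetricJet E)

/-- The change to coordinates that are normal to third order. -/
def normalMap (z : E) : E := z + (1 / 2 : ℝ) • J.conn z z + (1 / 6 : ℝ) • J.cubic z

lemma contDiff_normalMap : ContDiff ℝ ∞ J.normalMap := by
  have := J.contDiff_cubic
  unfold normalMap
  fun_prop

@[simp] lemma cubic_zero : J.cubic 0 = 0 := by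
  simpa using J.cubic_smul 0 0

@[simp] lemma normalMap_zero : J.normalMap 0 = 0 := by
  simp [normalMap]

lemma fderiv_cubic_smul (t : ℝ) (z a : E) :
    fderiv ℝ J.cubic (t • z) a = t ^ 2 • fderiv ℝ J.cubic z a := by
  have hd (y : E) : HasFDerivAt J.cubic (fderiv ℝ J.cubic y) y :=
    (J.contDiff_cubic.differentiable (by simp) y).hasFDerivAt
  rcases eq_or_ne t 0 with rfl | ht
  · have h1 : HasDerivAt (fun s : ℝ ↦ J.cubic (s • a)) (fderiv ℝ J.cubic 0 a) 0 := by
      have hl : HasDerivAt (fun s : ℝ ↦ s • a) a 0 := by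
        simpa using (hasDerivAt_id (0 : ℝ)).smul_const a
      have := (hd ((0 : ℝ) • a)).comp_hasDerivAt 0 hl
      rw [zero_smul] at this
      exact this
    have h2 : HasDerivAt (fun s : ℝ ↦ J.cubic (s • a)) 0 0 := by
      simp only [cubic_smul]
      simpa using (hasDerivAt_pow 3 (0 : ℝ)).smul_const (J.cubic a)
    simpa using h1.unique h2
  · have h1 : HasFDerivAt (fun y : E ↦ J.cubic (t • y)) (t ^ 3 • fderiv ℝ J.cubic z) z := by
      simp only [cubic_smul]
      exact (hd z).const_smul (t ^ 3)
    have h2 : HasFDerivAt (fun y : E ↦ J.cubic (t • y))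
        ((fderiv ℝ J.cubic (t • z)).comp (t • ContinuousLinearMap.id ℝ E)) z :=
      (hd (t • z)).comp z ((hasFDerivAt_id z).const_smul t)
    have h3 := congrArg (fun L : E →L[ℝ] E ↦ t⁻¹ • L a) (h1.unique h2)
    simp only [smul_apply, ContinuousLinearMap.comp_apply, ContinuousLinearMap.id_apply, map_smul,
      smul_smul] at h3
    rw [inv_mul_cancel₀ ht, one_smul] at h3
    rw [← h3]
    congr 1
    field_simp

lemma fderiv_normalMap (z a : E) : fderiv ℝ J.normalMap z a =
    a + J.conn z a + (1 / 6 : ℝ) • fderiv ℝ J.cubic z a := by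
  have h2 : HasFDerivAt (fun y ↦ J.conn y y) (J.conn.precompR E z (ContinuousLinearMap.id ℝ E) +
      J.conn.precompL E (ContinuousLinearMap.id ℝ E) z) z :=
    J.conn.hasFDerivAt_of_bilinear (hasFDerivAt_id z) (hasFDerivAt_id z)
  have h3 := (((hasFDerivAt_id z).add (h2.const_smul (1 / 2 : ℝ))).add
    ((J.contDiff_cubic.differentiable (by simp) z).hasFDerivAt.const_smul (1 / 6 : ℝ)))
  have h4 : HasFDerivAt J.normalMap _ z := h3
  rw [h4.fderiv]
  simp only [smul_apply, add_apply, ContinuousLinearMap.precompR_apply,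
    ContinuousLinearMap.compL_apply, ContinuousLinearMap.comp_apply,
    ContinuousLinearMap.precompL_apply, ContinuousLinearMap.id_apply, J.conn_symm a z]
  rw [← two_smul ℝ, smul_smul]
  norm_num

lemma fderiv_normalMap_zero : fderiv ℝ J.normalMap 0 = ContinuousLinearMap.id ℝ E := by
  ext1 a
  have := J.fderiv_cubic_smul 0 0 a
  simp only [smul_zero, ne_eq, OfNat.ofNat_ne_zero, not_false_eq_true, zero_pow, zero_smul] at this
  simp [fderiv_normalMap, this]

lemma normalMap_smul (t : ℝ) (z : E) : J.normalMap (t • z) =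
    t • z + (t ^ 2 / 2) • J.conn z z + (t ^ 3 / 6) • J.cubic z := by
  simp only [normalMap, map_smul, smul_apply, cubic_smul, smul_smul]
  congr 2 <;> ring_nf

lemma fderiv_normalMap_smul (t : ℝ) (z a : E) : fderiv ℝ J.normalMap (t • z) a =
    a + t • J.conn z a + (t ^ 2 / 6) • fderiv ℝ J.cubic z a := by
  simp only [fderiv_normalMap, map_smul, smul_apply, fderiv_cubic_smul, smul_smul]
  congr 2; ring_nf

end NormalMap

section Field

variable {G : E → E →L[ℝ] E →L[ℝ] ℝ}

lemma fderiv_symm_of_symm (hsymm : ∀ z a b, G z a b = G z b a) (y w a b : E) :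
    fderiv ℝ G y w a b = fderiv ℝ G y w b a := by
  have h : (ContinuousLinearMap.flipₗᵢ ℝ E E ℝ).toContinuousLinearEquiv ∘ G = G := by
    ext z a b
    exact hsymm z b a
  have h2 := (ContinuousLinearMap.flipₗᵢ ℝ E E ℝ).toContinuousLinearEquiv.comp_fderiv (f := G)
    (x := y)
  rw [h] at h2
  have h3 := congrArg (fun L : E →L[ℝ] E →L[ℝ] E →L[ℝ] ℝ ↦ L w a b) h2
  exact h3

/-- The second order jet at `0` of a field of symmetric bilinear forms. -/
def ofField (G : E → E →L[ℝ] E →L[ℝ] ℝ) (hG : ContDiffAt ℝ 2 G 0)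
    (hsymm : ∀ z a b, G z a b = G z b a) : MetricJet E where
  d1 := fderiv ℝ G 0
  d2 := fderiv ℝ (fderiv ℝ G) 0
  d1_symm := fderiv_symm_of_symm hsymm 0
  d2_symm z w a b := by
    have hf' : DifferentiableAt ℝ (fderiv ℝ G) 0 :=
      (hG.fderiv_right (m := 1) (by norm_num)).differentiableAt (by simp)
    have key (a b : E) : HasDerivAt (fun t : ℝ ↦ fderiv ℝ G (t • z) w a b)
        (fderiv ℝ (fderiv ℝ G) 0 z w a b) 0 := by
      have hl : HasDerivAt (fun s : ℝ ↦ s • z) z 0 := by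
        simpa using (hasDerivAt_id (0 : ℝ)).smul_const z
      have hf'' : HasFDerivAt (fderiv ℝ G) (fderiv ℝ (fderiv ℝ G) 0) ((0 : ℝ) • z) := by
        rw [zero_smul]; exact hf'.hasFDerivAt
      have h1 := (hf''.comp_hasDerivAt 0 hl).clm_apply (hasDerivAt_const 0 w)
      have h2 := (h1.clm_apply (hasDerivAt_const 0 a)).clm_apply (hasDerivAt_const 0 b)
      exact h2.congr_deriv (by simp)
    refine (key a b).unique ((key b a).congr_of_eventuallyEq (.of_forall fun t ↦ ?_))
    exact fderiv_symm_of_symm hsymm _ _ _ _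
  d2_comm z w a b := by
    have := hG.isSymmSndFDerivAt (by simp) z w
    rw [this]

/-- The second derivative along a ray of the pullback of a field of bilinear forms by the
normal coordinate map. -/
lemma pullback_ray (hG : ContDiffAt ℝ 2 G 0) (hsymm : ∀ z a b, G z a b = G z b a)
    (h0 : ∀ a b, G 0 a b = ⟪a, b⟫) (z a : E) :
    ∃ η' : ℝ → ℝ, (∀ᶠ t in 𝓝 (0 : ℝ), HasDerivAt (fun t : ℝ ↦
        G ((ofField G hG hsymm).normalMap (t • z))
          (fderiv ℝ (ofField G hG hsymm).normalMap (t • z) a)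
          (fderiv ℝ (ofField G hG hsymm).normalMap (t • z) a)) (η' t) t) ∧
      η' 0 = 0 ∧ HasDerivAt η' (-(2 / 3) * (ofField G hG hsymm).curv a z) 0 := by
  set J := ofField G hG hsymm with hJ
  -- `c` is the image of the ray `t • z` and `d` the image of `a` under the differential along it;
  -- primes denote their derivatives.
  let c : ℝ → E := fun t ↦ t • z + (t ^ 2 / 2) • J.conn z z + (t ^ 3 / 6) • J.cubic z
  let c' : ℝ → E := fun t ↦ z + t • J.conn z z + (t ^ 2 / 2) • J.cubic z
  let d : ℝ → E := fun t ↦ a + t • J.conn z a + (t ^ 2 / 6) • fderiv ℝ J.cubic z a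
  let d' : ℝ → E := fun t ↦ J.conn z a + (t / 3) • fderiv ℝ J.cubic z a
  have hc (t : ℝ) : HasDerivAt c (c' t) t := by
    have h1 := (hasDerivAt_id t).smul_const z
    have h2 := ((hasDerivAt_pow 2 t).div_const 2).smul_const (J.conn z z)
    have h3 := ((hasDerivAt_pow 3 t).div_const 6).smul_const (J.cubic z)
    refine ((h1.add h2).add h3).congr_deriv ?_
    have e1 : ((2 : ℕ) : ℝ) * t ^ (2 - 1) / 2 = t := by norm_num
    have e2 : ((3 : ℕ) : ℝ) * t ^ (3 - 1) / 6 = t ^ 2 / 2 := by norm_num; ring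
    rw [e1, e2, one_smul]
  have hc' : HasDerivAt c' (J.conn z z) 0 := by
    have h2 := (hasDerivAt_id (0 : ℝ)).smul_const (J.conn z z)
    have h3 := ((hasDerivAt_pow 2 (0 : ℝ)).div_const 2).smul_const (J.cubic z)
    refine ((h2.const_add z).add h3).congr_deriv ?_
    simp
  have hd (t : ℝ) : HasDerivAt d (d' t) t := by
    have h2 := (hasDerivAt_id t).smul_const (J.conn z a)
    have h3 := ((hasDerivAt_pow 2 t).div_const 6).smul_const (fderiv ℝ J.cubic z a)
    refine ((h2.const_add a).add h3).congr_deriv ?_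
    simp only [d', one_smul]
    congr 2; simp; ring
  have hd' : HasDerivAt d' ((1 / 3 : ℝ) • fderiv ℝ J.cubic z a) 0 := by
    exact ((hasDerivAt_id (0 : ℝ)).div_const 3).smul_const (fderiv ℝ J.cubic z a)
      |>.const_add _
  have hc0 : c 0 = 0 := by simp [c]
  have hct : Tendsto c (𝓝 0) (𝓝 0) := by
    have := (hc 0).continuousAt.tendsto
    rwa [hc0] at this
  have hGd : ∀ᶠ y in 𝓝 (0 : E), DifferentiableAt ℝ G y := by
    filter_upwards [hG.eventually (by simp)] with z hz using hz.differentiableAt (by simp)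
  have hG' : HasFDerivAt (fderiv ℝ G) J.d2 (c 0) := by
    rw [hc0]
    exact ((hG.fderiv_right (m := 1) (by norm_num)).differentiableAt (by simp)).hasFDerivAt
  have hG0 : HasFDerivAt G J.d1 (c 0) := by
    rw [hc0]
    exact (hG.differentiableAt (by simp)).hasFDerivAt
  refine ⟨fun t ↦ fderiv ℝ G (c t) (c' t) (d t) (d t) + G (c t) (d' t) (d t)
    + G (c t) (d t) (d' t), ?_, ?_, ?_⟩
  · filter_upwards [hct.eventually hGd] with t ht
    simp only [normalMap_smul, fderiv_normalMap_smul]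
    have h1 := ((ht.hasFDerivAt.comp_hasDerivAt t (hc t)).clm_apply (hd t)).clm_apply (hd t)
    refine h1.congr_deriv ?_
    simp only [add_apply]
    rfl
  · have e1 : d 0 = a := by simp [d]
    have e2 : d' 0 = J.conn z a := by simp [d']
    have e3 : c' 0 = z := by simp [c']
    simp only [hc0, e1, e2, e3, h0]
    -- The first derivative is `d1 z a a + 2⟨conn z a, a⟩`, which vanishes by metric compatibility.
    have := J.d1_eq z a a
    have hh : fderiv ℝ G 0 z a a = J.d1 z a a := rfl
    rw [hh, this, real_inner_comm a]
    ring
  · have e1 : d 0 = a := by simp [d]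
    have e2 : d' 0 = J.conn z a := by simp [d']
    have e3 : c' 0 = z := by simp [c']
    have h1 := (((hG'.comp_hasDerivAt 0 (hc 0)).clm_apply hc').clm_apply (hd 0)).clm_apply (hd 0)
    have h2 := ((hG0.comp_hasDerivAt 0 (hc 0)).clm_apply hd').clm_apply (hd 0)
    have h3 := ((hG0.comp_hasDerivAt 0 (hc 0)).clm_apply (hd 0)).clm_apply hd'
    refine ((h1.add h2).add h3).congr_deriv ?_
    have hh : fderiv ℝ G 0 = J.d1 := rfl
    simp only [Function.comp, add_apply, hc0, e1, e2, e3, h0, hh, map_smul, smul_apply,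
      real_inner_smul_right, smul_eq_mul]
    rw [real_inner_comm (fderiv ℝ J.cubic z a) a, J.inner_fderiv_cubic z a,
      J.d1_symm z a (J.conn z a), J.d1_eq (J.conn z z) a a, J.d1_eq z (J.conn z a) a,
      J.curv_symm a z, curv,
      J.conn_symm z (J.conn z a), J.d2_symm z a a z]
    ring

end Field

end MetricJet

namespace MetricJet

variable {E : Type*} [NormedAddCommGroup E] [InnerProductSpace ℝ E] [FiniteDimensional ℝ E]

variable {G : E → E →L[ℝ] E →L[ℝ] ℝ}

/-- In normal coordinates the metric is the inner product up to a curvature term of second order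
and a remainder of smaller order. -/
lemma normalMap_expansion (hG : ContDiffAt ℝ 2 G 0) (hsymm : ∀ z a b, G z a b = G z b a)
    (h0 : ∀ a b, G 0 a b = ⟪a, b⟫) {δ : ℝ} (hδ : 0 < δ) :
    ∀ᶠ z in 𝓝 (0 : E), ∀ a, |G ((ofField G hG hsymm).normalMap z)
        (fderiv ℝ (ofField G hG hsymm).normalMap z a)
        (fderiv ℝ (ofField G hG hsymm).normalMap z a)
      - (‖a‖ ^ 2 - 1 / 3 * (ofField G hG hsymm).curv a z)| ≤ δ * ‖z‖ ^ 2 * ‖a‖ ^ 2 := by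
  set J := ofField G hG hsymm with hJ
  let fl := (ContinuousLinearMap.flipₗᵢ ℝ E E ℝ).toContinuousLinearEquiv
  -- The pulled back metric as a field of bilinear forms; each flip exposes one argument so that it
  -- can be composed with the differential.
  let h : E → E →L[ℝ] E →L[ℝ] ℝ := fun z ↦
    fl ((fl ((G (J.normalMap z)).comp (fderiv ℝ J.normalMap z))).comp (fderiv ℝ J.normalMap z))
  have hh (z a : E) : h z a a =
      G (J.normalMap z) (fderiv ℝ J.normalMap z a) (fderiv ℝ J.normalMap z a) := rfl
  have hψ : ContDiff ℝ 2 (fderiv ℝ J.normalMap) :=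
    J.contDiff_normalMap.fderiv_right (m := 2) (by norm_cast)
  have hGψ : ContDiffAt ℝ 2 (fun z ↦ G (J.normalMap z)) 0 := by
    refine ContDiffAt.comp (g := G) 0 ?_ (J.contDiff_normalMap.contDiffAt.of_le (by norm_cast))
    rwa [normalMap_zero]
  have hcd : ContDiffAt ℝ 2 h 0 := by
    have h1 : ContDiffAt ℝ 2 (fun z ↦ (G (J.normalMap z)).comp (fderiv ℝ J.normalMap z)) 0 :=
      hGψ.clm_comp hψ.contDiffAt
    have h2 := (fl.contDiff (n := 2)).contDiffAt.comp (0 : E) h1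
    have h3 := h2.clm_comp (hψ.contDiffAt (x := 0))
    exact (fl.contDiff (n := 2)).contDiffAt.comp (0 : E) h3
  have hzero (a : E) : h 0 a a = ‖a‖ ^ 2 := by
    rw [hh, normalMap_zero, fderiv_normalMap_zero, h0, ContinuousLinearMap.id_apply,
      real_inner_self_eq_norm_sq]
  -- Both `h` and `pullback_ray` describe the same function along the ray, so uniqueness of
  -- derivatives identifies the Taylor coefficients of `h`.
  have hcoef (z a : E) : fderiv ℝ h 0 z a a = 0 ∧
      fderiv ℝ (fderiv ℝ h) 0 z z a a = -(2 / 3) * J.curv a z := by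
    obtain ⟨η', h1, h2, h3⟩ := pullback_ray hG hsymm h0 z a
    obtain ⟨r1, r2⟩ := hcd.hasDerivAt_ray z
    have r1' : ∀ᶠ t in 𝓝 (0 : ℝ), HasDerivAt (fun t : ℝ ↦ h (t • z) a a)
        (fderiv ℝ h (t • z) z a a) t := by
      filter_upwards [r1] with t ht
      have := (ht.clm_apply (hasDerivAt_const t a)).clm_apply (hasDerivAt_const t a)
      exact this.congr_deriv (by simp)
    have r2' : HasDerivAt (fun t : ℝ ↦ fderiv ℝ h (t • z) z a a)
        (fderiv ℝ (fderiv ℝ h) 0 z z a a) 0 := by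
      have := (r2.clm_apply (hasDerivAt_const 0 a)).clm_apply (hasDerivAt_const 0 a)
      exact this.congr_deriv (by simp)
    have heq : ∀ᶠ t in 𝓝 (0 : ℝ), fderiv ℝ h (t • z) z a a = η' t := by
      filter_upwards [r1', h1] with t ht1 ht2 using ht1.unique ht2
    refine ⟨?_, r2'.unique (h3.congr_of_eventuallyEq heq)⟩
    have := heq.self_of_nhds
    rwa [zero_smul, h2] at this
  filter_upwards [hcd.taylor_two hδ] with z hz a
  have key : G (J.normalMap z) (fderiv ℝ J.normalMap z a) (fderiv ℝ J.normalMap z a)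
      - (‖a‖ ^ 2 - 1 / 3 * J.curv a z) =
      (h z - h 0 - fderiv ℝ h 0 z - (1 / 2 : ℝ) • fderiv ℝ (fderiv ℝ h) 0 z z) a a := by
    simp only [sub_apply, smul_apply, hzero, (hcoef z a).1, (hcoef z a).2, smul_eq_mul, ← hh]
    ring
  rw [key, ← Real.norm_eq_abs]
  refine (ContinuousLinearMap.le_opNorm₂ _ _ _).trans ?_
  rw [mul_assoc, ← sq]
  gcongr

end MetricJet

end

noncomputable section

open Set Filter Topology

/-! ### Derivative of the inverse matrix -/

section MatrixCalculus

variable {n : ℕ} {F : Type*} [NormedAddCommGroup F] [NormedSpace ℝ F]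

lemma DifferentiableAt.matrix_det {m : F → Matrix (Fin n) (Fin n) ℝ} {y : F}
    (hm : ∀ i j, DifferentiableAt ℝ (fun z ↦ m z i j) y) :
    DifferentiableAt ℝ (fun z ↦ (m z).det) y := by
  simp only [Matrix.det_apply]
  refine DifferentiableAt.fun_sum fun σ _ ↦ ?_
  have h := HasFDerivAt.finsetProd (u := Finset.univ) (x := y)
    (g := fun i z ↦ m z (σ i) i) fun i _ ↦ (hm (σ i) i).hasFDerivAt
  exact h.differentiableAt.const_smul _

lemma DifferentiableAt.matrix_inv {m : F → Matrix (Fin n) (Fin n) ℝ} {y : F}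
    (hm : ∀ i j, DifferentiableAt ℝ (fun z ↦ m z i j) y) (hdet : (m y).det ≠ 0) (k l : Fin n) :
    DifferentiableAt ℝ (fun z ↦ (m z)⁻¹ k l) y := by
  simp only [Matrix.inv_def, Matrix.smul_apply, Matrix.adjugate_apply, Ring.inverse_eq_inv',
    smul_eq_mul]
  refine (DifferentiableAt.matrix_det hm).fun_inv hdet |>.fun_mul
    (DifferentiableAt.matrix_det fun i j ↦ ?_)
  by_cases h : i = l
  · subst h
    simp only [Matrix.updateRow_self]
    fun_prop
  · simp only [Matrix.updateRow_ne h]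
    exact hm i j

/-- The derivative of the inverse of a matrix. -/
lemma fderiv_matrix_inv {m : F → Matrix (Fin n) (Fin n) ℝ} {y : F}
    (hm : ∀ i j, DifferentiableAt ℝ (fun z ↦ m z i j) y) (hdet : (m y).det ≠ 0)
    (k l : Fin n) (v : F) :
    fderiv ℝ (fun z ↦ (m z)⁻¹ k l) y v =
      -∑ p, (m y)⁻¹ k p * ∑ q, fderiv ℝ (fun z ↦ m z p q) y v * (m y)⁻¹ q l := by
  have hdet' : ∀ᶠ z in 𝓝 y, (m z).det ≠ 0 :=
    (DifferentiableAt.matrix_det hm).continuousAt.eventually_ne hdet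
  have hinv := DifferentiableAt.matrix_inv hm hdet
  have hprod (q : Fin n) : ∑ p, (fderiv ℝ (fun z ↦ (m z)⁻¹ k p) y v * m y p q +
      (m y)⁻¹ k p * fderiv ℝ (fun z ↦ m z p q) y v) = 0 := by
    have h1 : HasFDerivAt (fun z ↦ ∑ p, (m z)⁻¹ k p * m z p q)
        (∑ p, ((m y)⁻¹ k p • fderiv ℝ (fun z ↦ m z p q) y +
          m y p q • fderiv ℝ (fun z ↦ (m z)⁻¹ k p) y)) y :=
      HasFDerivAt.fun_sum fun p _ ↦ (hinv k p).hasFDerivAt.mul (hm p q).hasFDerivAt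
    have h2 : HasFDerivAt (fun z ↦ ∑ p, (m z)⁻¹ k p * m z p q) (0 : F →L[ℝ] ℝ) y := by
      refine (hasFDerivAt_const ((1 : Matrix (Fin n) (Fin n) ℝ) k q) y).congr_of_eventuallyEq ?_
      filter_upwards [hdet'] with z hz
      rw [← Matrix.mul_apply, Matrix.nonsing_inv_mul _ (isUnit_iff_ne_zero.2 hz)]
    have h3 := congrArg (fun L : F →L[ℝ] ℝ ↦ L v) (h1.unique h2)
    simp only [sum_apply, add_apply, smul_apply, smul_eq_mul, zero_apply] at h3
    rw [← h3]
    exact Finset.sum_congr rfl fun p _ ↦ by ring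
  let D : Matrix (Fin n) (Fin n) ℝ := .of fun k p ↦ fderiv ℝ (fun z ↦ (m z)⁻¹ k p) y v
  have h4 : ∑ q, (∑ p, (fderiv ℝ (fun z ↦ (m z)⁻¹ k p) y v * m y p q +
      (m y)⁻¹ k p * fderiv ℝ (fun z ↦ m z p q) y v)) * (m y)⁻¹ q l = 0 := by
    simp [hprod]
  have h5 : ∑ q, (∑ p, fderiv ℝ (fun z ↦ (m z)⁻¹ k p) y v * m y p q) * (m y)⁻¹ q l =
      fderiv ℝ (fun z ↦ (m z)⁻¹ k l) y v := by
    have : (D * m y * (m y)⁻¹) k l = D k l := by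
      rw [Matrix.mul_assoc, Matrix.mul_nonsing_inv _ (isUnit_iff_ne_zero.2 hdet), Matrix.mul_one]
    simpa [Matrix.mul_apply, D] using this
  have h6 : ∑ q, (∑ p, (m y)⁻¹ k p * fderiv ℝ (fun z ↦ m z p q) y v) * (m y)⁻¹ q l =
      ∑ p, (m y)⁻¹ k p * ∑ q, fderiv ℝ (fun z ↦ m z p q) y v * (m y)⁻¹ q l := by
    simp only [Finset.sum_mul, Finset.mul_sum]
    rw [Finset.sum_comm]
    exact Finset.sum_congr rfl fun p _ ↦ Finset.sum_congr rfl fun q _ ↦ by ring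
  simp only [Finset.sum_add_distrib, add_mul] at h4
  linarith

end MatrixCalculus

namespace RiemannianCoord

variable {n : ℕ} {H : Type*} [TopologicalSpace H]
  (I : ModelWithCorners ℝ (EuclideanSpace ℝ (Fin n)) H)

lemma partialDeriv_eventuallyEq {y₀ : EuclideanSpace ℝ (Fin n)} (hy : range I ∈ 𝓝 y₀) (i : Fin n)
    {f f' : EuclideanSpace ℝ (Fin n) → ℝ} (hf : f =ᶠ[𝓝 y₀] f') :
    partialDeriv I i f =ᶠ[𝓝 y₀] fun y ↦ fderiv ℝ f' y (EuclideanSpace.single i 1) := by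
  filter_upwards [eventually_mem_nhds_iff.2 hy, hf.eventuallyEq_nhds] with y hy hf
  rw [partialDeriv, fderivWithin_of_mem_nhds hy, hf.fderiv_eq]

/-! ### Scalar curvature in terms of the derivatives of the metric -/

section Curvature

variable {M : Type*} [TopologicalSpace M] [ChartedSpace H M]
  [Bundle.RiemannianBundle (fun x : M ↦ TangentSpace I x)]

/-- The first partial derivatives of the metric. -/
def dMetric (x : M) (k i j : Fin n) (y : EuclideanSpace ℝ (Fin n)) : ℝ :=
  fderiv ℝ (fun z ↦ metricMatrix I x z i j) y (EuclideanSpace.single k 1)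

/-- The second partial derivatives of the metric. -/
def ddMetric (x : M) (k l i j : Fin n) (y : EuclideanSpace ℝ (Fin n)) : ℝ :=
  fderiv ℝ (dMetric I x l i j) y (EuclideanSpace.single k 1)

/-- The Christoffel symbols of the first kind. -/
def christoffelFirst (x : M) (l i j : Fin n) (y : EuclideanSpace ℝ (Fin n)) : ℝ :=
  (1 / 2) * (dMetric I x i j l y + dMetric I x j i l y - dMetric I x l i j y)

/-- The Riemann tensor with all indices lowered. -/
def riemannLow (x : M) (l i j k : Fin n) (y : EuclideanSpace ℝ (Fin n)) : ℝ :=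
  1 / 2 * (ddMetric I x i k j l y - ddMetric I x i l j k y - ddMetric I x j k i l y
      + ddMetric I x j l i k y)
    - ∑ q, (christoffelFirst I x q i l y * ∑ p, (metricMatrix I x y)⁻¹ q p *
        christoffelFirst I x p j k y
      - christoffelFirst I x q j l y * ∑ p, (metricMatrix I x y)⁻¹ q p *
        christoffelFirst I x p i k y)

lemma metricMatrix_symm (x : M) (y : EuclideanSpace ℝ (Fin n)) (i j : Fin n) :
    metricMatrix I x y i j = metricMatrix I x y j i := by
  simp only [metricMatrix, Matrix.of_apply, real_inner_comm]

lemma dMetric_symm (x : M) (k i j : Fin n) : dMetric I x k i j = dMetric I x k j i := by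
  ext y
  simp only [dMetric, metricMatrix_symm I x _ i j]

lemma dMetric_eq (x : M) (k i j : Fin n) (y : EuclideanSpace ℝ (Fin n)) :
    dMetric I x k i j y = christoffelFirst I x i k j y + christoffelFirst I x j k i y := by
  rw [christoffelFirst, christoffelFirst, dMetric_symm I x k j i]
  ring

variable (x : M) {y₀ : EuclideanSpace ℝ (Fin n)}

lemma contDiffAt_dMetric
    (hm : ∀ i j, ContDiffAt ℝ ∞ (fun z ↦ metricMatrix I x z i j) y₀)
    (k i j : Fin n) : ContDiffAt ℝ ∞ (dMetric I x k i j) y₀ :=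
  ((hm i j).fderiv_right (m := ∞) (by simp)).clm_apply contDiffAt_const

lemma christoffel_eventuallyEq (hy : range I ∈ 𝓝 y₀) (k i j : Fin n) :
    christoffel I x k i j =ᶠ[𝓝 y₀] fun y ↦
      ∑ l, (metricMatrix I x y)⁻¹ k l * christoffelFirst I x l i j y := by
  have h (k i j : Fin n) : partialDeriv I k (fun z ↦ metricMatrix I x z i j) =ᶠ[𝓝 y₀]
      dMetric I x k i j := partialDeriv_eventuallyEq I hy k EventuallyEq.rfl
  have h1 := eventually_all.2 fun k ↦ eventually_all.2 fun i ↦ eventually_all.2 fun j ↦ h k i j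
  filter_upwards [h1] with y hy
  simp only [christoffel, hy, Finset.mul_sum, christoffelFirst]
  exact Finset.sum_congr rfl fun l _ ↦ by ring

lemma fderiv_christoffelFirst
    (hm : ∀ i j, ContDiffAt ℝ ∞ (fun z ↦ metricMatrix I x z i j) y₀)
    (p l i j : Fin n) :
    DifferentiableAt ℝ (christoffelFirst I x l i j) y₀ ∧
    fderiv ℝ (christoffelFirst I x l i j) y₀ (EuclideanSpace.single p 1) =
      1 / 2 * (ddMetric I x p i j l y₀ + ddMetric I x p j i l y₀ - ddMetric I x p l i j y₀) := by
  have hd (k i j : Fin n) : HasFDerivAt (dMetric I x k i j) (fderiv ℝ (dMetric I x k i j) y₀) y₀ :=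
    ((contDiffAt_dMetric I x hm k i j).differentiableAt (by simp)).hasFDerivAt
  have h := (((hd i j l).add (hd j i l)).sub (hd l i j)).const_mul (1 / 2)
  refine ⟨h.differentiableAt, ?_⟩
  have h' : HasFDerivAt (christoffelFirst I x l i j) _ y₀ := h
  rw [h'.fderiv]
  rfl

lemma partialDeriv_christoffel (hy : range I ∈ 𝓝 y₀)
    (hm : ∀ i j, ContDiffAt ℝ ∞ (fun z ↦ metricMatrix I x z i j) y₀)
    (hdet : (metricMatrix I x y₀).det ≠ 0) (i r j k : Fin n) :
    partialDeriv I i (christoffel I x r j k) y₀ =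
      ∑ l, (metricMatrix I x y₀)⁻¹ r l * (1 / 2 * (ddMetric I x i j k l y₀ + ddMetric I x i k j l y₀
        - ddMetric I x i l j k y₀) - ∑ q, dMetric I x i l q y₀ *
          ∑ p, (metricMatrix I x y₀)⁻¹ q p * christoffelFirst I x p j k y₀) := by
  rw [(partialDeriv_eventuallyEq I hy i (christoffel_eventuallyEq I x hy r j k)).self_of_nhds]
  have hmd (i j : Fin n) : DifferentiableAt ℝ (fun z ↦ metricMatrix I x z i j) y₀ :=
    (hm i j).differentiableAt (by simp)
  have h : HasFDerivAt (fun y ↦ ∑ l, (metricMatrix I x y)⁻¹ r l * christoffelFirst I x l j k y)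
      (∑ l, ((metricMatrix I x y₀)⁻¹ r l • fderiv ℝ (christoffelFirst I x l j k) y₀ +
        christoffelFirst I x l j k y₀ • fderiv ℝ (fun z ↦ (metricMatrix I x z)⁻¹ r l) y₀)) y₀ :=
    HasFDerivAt.fun_sum fun l _ ↦
      (DifferentiableAt.matrix_inv hmd hdet r l).hasFDerivAt.mul
        (fderiv_christoffelFirst I x hm i l j k).1.hasFDerivAt
  beta_reduce
  rw [h.fderiv]
  simp only [sum_apply, add_apply, smul_apply, smul_eq_mul,
    (fderiv_christoffelFirst I x hm i _ _ _).2, fderiv_matrix_inv hmd hdet, mul_sub,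
    Finset.sum_add_distrib, Finset.sum_sub_distrib]
  rw [sub_eq_add_neg]
  congr 1
  simp only [mul_neg, Finset.sum_neg_distrib, neg_inj, Finset.mul_sum]
  rw [Finset.sum_comm]
  refine Finset.sum_congr rfl fun l _ ↦ ?_
  rw [Finset.sum_comm]
  refine Finset.sum_congr rfl fun q _ ↦ Finset.sum_congr rfl fun p _ ↦ ?_
  simp only [dMetric]
  ring

lemma ddMetric_comm
    (hm : ∀ i j, ContDiffAt ℝ ∞ (fun z ↦ metricMatrix I x z i j) y₀) (k l i j : Fin n) :
    ddMetric I x k l i j y₀ = ddMetric I x l k i j y₀ := by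
  have hd : DifferentiableAt ℝ (fderiv ℝ fun z ↦ metricMatrix I x z i j) y₀ :=
    ((hm i j).fderiv_right (m := ∞) (by simp)).differentiableAt (by simp)
  have h (k l : Fin n) : ddMetric I x k l i j y₀ =
      fderiv ℝ (fderiv ℝ fun z ↦ metricMatrix I x z i j) y₀ (EuclideanSpace.single k 1)
        (EuclideanSpace.single l 1) := by
    have h1 := hd.hasFDerivAt.clm_apply (hasFDerivAt_const (EuclideanSpace.single l (1 : ℝ)) y₀)
    have h2 : HasFDerivAt (dMetric I x l i j) _ y₀ := h1
    rw [ddMetric, h2.fderiv]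
    simp
  rw [h, h, ((hm i j).isSymmSndFDerivAt (by
    rw [minSmoothness_of_isRCLikeNormedField]; norm_cast)).eq]

lemma sum_mul_sum_assoc (W C : Fin n → ℝ) (Γ : Fin n → Fin n → ℝ) :
    ∑ p, (∑ l, W l * Γ l p) * C p = ∑ l, W l * ∑ q, Γ l q * C q := by
  simp only [Finset.mul_sum, Finset.sum_mul]
  rw [Finset.sum_comm]
  exact Finset.sum_congr rfl fun p _ ↦ Finset.sum_congr rfl fun q _ ↦ by ring

/-- Differentiating `gʳˡ` in the Christoffel symbols produces `-∂ᵢ g_{lq} Γ^q_{jk}`. By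
`dMetric_eq`, `∂ᵢ g_{lq} = Γ_{l,iq} + Γ_{q,il}`: the first part cancels the quadratic term in the
definition of `riemann`, the second is the quadratic term of `riemannLow`. -/
lemma riemann_eq (hy : range I ∈ 𝓝 y₀)
    (hm : ∀ i j, ContDiffAt ℝ ∞ (fun z ↦ metricMatrix I x z i j) y₀)
    (hdet : (metricMatrix I x y₀).det ≠ 0) (r i j k : Fin n) : riemann I x r i j k y₀ =
    ∑ l, (metricMatrix I x y₀)⁻¹ r l * riemannLow I x l i j k y₀ := by
  have hc (a b c : Fin n) := (christoffel_eventuallyEq I x hy a b c).self_of_nhds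
  simp only [riemann, partialDeriv_christoffel I x hy hm hdet]
  have hsw (i j k : Fin n) : ∑ p, christoffel I x r i p y₀ * christoffel I x p j k y₀ =
      ∑ l, (metricMatrix I x y₀)⁻¹ r l * ∑ q, christoffelFirst I x l i q y₀ *
        ∑ p, (metricMatrix I x y₀)⁻¹ q p * christoffelFirst I x p j k y₀ := by
    simp only [hc]
    exact sum_mul_sum_assoc _ _ _
  rw [Finset.sum_sub_distrib, hsw, hsw, ← Finset.sum_sub_distrib, ← Finset.sum_sub_distrib,
    ← Finset.sum_add_distrib]
  refine Finset.sum_congr rfl fun l _ ↦ ?_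
  simp only [riemannLow, dMetric_eq I x i l, dMetric_eq I x j l, add_mul, Finset.sum_add_distrib,
    Finset.sum_sub_distrib, ddMetric_comm I x hm j i]
  ring

lemma scalarCurvature_eq (hy : range I ∈ 𝓝 (extChartAt I x x))
    (hm : ∀ i j, ContDiffAt ℝ ∞ (fun z ↦ metricMatrix I x z i j) (extChartAt I x x))
    (hdet : (metricMatrix I x (extChartAt I x x)).det ≠ 0) : scalarCurvature I x =
    ∑ j, ∑ k, (metricMatrix I x (extChartAt I x x))⁻¹ j k * ∑ i, ∑ l,
      (metricMatrix I x (extChartAt I x x))⁻¹ i l * riemannLow I x l i j k (extChartAt I x x) := by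
  simp only [scalarCurvature, ricci, riemann_eq I x hy hm hdet]

end Curvature

end RiemannianCoord

end

noncomputable section

open Set Filter Topology

open scoped RealInnerProductSpace

set_option linter.unusedSectionVars false
set_option synthInstance.maxHeartbeats 200000

lemma HasDerivAt.clm_apply_const {E F : Type*} [NormedAddCommGroup E] [NormedSpace ℝ E]
    [NormedAddCommGroup F] [NormedSpace ℝ F] {c : ℝ → E →L[ℝ] F} {c' : E →L[ℝ] F} {t : ℝ}
    (h : HasDerivAt c c' t) (w : E) : HasDerivAt (fun s ↦ c s w) (c' w) t :=
  (h.clm_apply (hasDerivAt_const t w)).congr_deriv (by simp)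

/-! ### Linear pullback of jets and traces over frames -/

section Pullback

variable {E : Type*} [NormedAddCommGroup E] [InnerProductSpace ℝ E] [FiniteDimensional ℝ E]

/-- The pullback of bilinear forms by a linear map, as a continuous linear map. -/
def pullbackForm (L : E →L[ℝ] E) : (E →L[ℝ] E →L[ℝ] ℝ) →L[ℝ] (E →L[ℝ] E →L[ℝ] ℝ) :=
  (ContinuousLinearMap.compL ℝ E (E →L[ℝ] ℝ) (E →L[ℝ] ℝ)
    ((ContinuousLinearMap.compL ℝ E E ℝ).flip L)) ∘L
    ((ContinuousLinearMap.compL ℝ E E (E →L[ℝ] ℝ)).flip L)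

@[simp] lemma pullbackForm_apply (L : E →L[ℝ] E) (B : E →L[ℝ] E →L[ℝ] ℝ) (a b : E) :
    pullbackForm L B a b = B (L a) (L b) := rfl

variable {g : E → E →L[ℝ] E →L[ℝ] ℝ} {y₀ : E}

lemma contDiffAt_pullbackForm (hg : ContDiffAt ℝ 2 g y₀) (L : E →L[ℝ] E) :
    ContDiffAt ℝ 2 (fun z ↦ pullbackForm L (g (y₀ + L z))) 0 := by
  refine (pullbackForm L).contDiff.contDiffAt.comp (0 : E) (ContDiffAt.comp (g := g) 0 ?_ ?_)
  · simpa using hg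
  · fun_prop

lemma fderiv_pullbackForm (hg : ContDiffAt ℝ 2 g y₀) (L : E →L[ℝ] E) :
    ∀ᶠ z in 𝓝 (0 : E), ∀ w a b, fderiv ℝ (fun z ↦ pullbackForm L (g (y₀ + L z))) z w a b =
      fderiv ℝ g (y₀ + L z) (L w) (L a) (L b) := by
  have hd : ∀ᶠ y in 𝓝 y₀, DifferentiableAt ℝ g y := by
    filter_upwards [hg.eventually (by simp)] with z hz using hz.differentiableAt (by simp)
  have hc : Tendsto (fun z ↦ y₀ + L z) (𝓝 0) (𝓝 y₀) := by
    have : Continuous fun z ↦ y₀ + L z := by fun_prop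
    simpa using this.tendsto 0
  filter_upwards [hc.eventually hd] with z hz w a b
  have h1 : HasFDerivAt (fun z ↦ y₀ + L z) L z := L.hasFDerivAt.const_add y₀
  have h2 := (pullbackForm L).hasFDerivAt.comp z (hz.hasFDerivAt.comp z h1)
  have h3 : HasFDerivAt (fun z ↦ pullbackForm L (g (y₀ + L z))) _ z := h2
  rw [h3.fderiv]
  rfl

set_option maxHeartbeats 1000000 in
lemma fderiv_fderiv_eq_of_pullback {G : E → E →L[ℝ] E →L[ℝ] ℝ} (hG : ContDiffAt ℝ 2 G 0)
    (hg : ContDiffAt ℝ 2 g y₀) (L : E →L[ℝ] E)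
    (h : ∀ᶠ z in 𝓝 (0 : E), ∀ w a b, fderiv ℝ G z w a b =
      fderiv ℝ g (y₀ + L z) (L w) (L a) (L b)) (v w a b : E) :
    fderiv ℝ (fderiv ℝ G) 0 v w a b = fderiv ℝ (fderiv ℝ g) y₀ (L v) (L w) (L a) (L b) := by
  have hl : HasDerivAt (fun s : ℝ ↦ s • v) v 0 := by
    simpa using (hasDerivAt_id (0 : ℝ)).smul_const v
  have h1 : HasFDerivAt (fderiv ℝ G) (fderiv ℝ (fderiv ℝ G) 0) ((0 : ℝ) • v) := by
    rw [zero_smul]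
    exact ((hG.fderiv_right (m := 1) (by norm_num)).differentiableAt (by simp)).hasFDerivAt
  have h2 : HasFDerivAt (fderiv ℝ g) (fderiv ℝ (fderiv ℝ g) y₀) (y₀ + L ((0 : ℝ) • v)) := by
    rw [zero_smul, map_zero, add_zero]
    exact ((hg.fderiv_right (m := 1) (by norm_num)).differentiableAt (by simp)).hasFDerivAt
  have hl2 : HasDerivAt (fun s : ℝ ↦ y₀ + L (s • v)) (L v) 0 :=
    (L.hasFDerivAt.comp_hasDerivAt 0 hl).const_add y₀
  have hc : Tendsto (fun s : ℝ ↦ s • v) (𝓝 0) (𝓝 0) := by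
    simpa using hl.continuousAt.tendsto
  have h3 := (((h1.comp_hasDerivAt 0 hl).clm_apply_const w).clm_apply_const a).clm_apply_const b
  have h4 := (((h2.comp_hasDerivAt 0 hl2).clm_apply_const (L w)).clm_apply_const
    (L a)).clm_apply_const (L b)
  refine h3.unique (h4.congr_of_eventuallyEq ?_)
  filter_upwards [hc.eventually h] with t ht
  exact ht w a b

end Pullback

section Trace

variable {n : ℕ}

local notation "𝔼" => EuclideanSpace ℝ (Fin n)

lemma EuclideanSpace.eq_sum_single (v : 𝔼) :
    v = ∑ i, v i • (EuclideanSpace.single i (1 : ℝ) : 𝔼) := by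
  ext j
  simp [Finset.sum_apply, Pi.single_apply]

/-- The trace of a bilinear form in terms of a frame. -/
lemma sum_frame_eq {ι : Type*} [Fintype ι] (W : Fin n → Fin n → ℝ) (f : ι → 𝔼)
    (hW : ∀ i j, W i j = ∑ a, f a i * f a j) (B : 𝔼 →ₗ[ℝ] 𝔼 →ₗ[ℝ] ℝ) :
    ∑ i, ∑ j, W i j * B (EuclideanSpace.single i 1) (EuclideanSpace.single j 1) =
      ∑ a, B (f a) (f a) := by
  have h (a : ι) : B (f a) (f a) = ∑ i, ∑ j, f a i * f a j *
      B (EuclideanSpace.single i 1) (EuclideanSpace.single j 1) := by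
    conv_lhs => rw [EuclideanSpace.eq_sum_single (f a)]
    simp only [map_sum, map_smul, LinearMap.sum_apply, LinearMap.smul_apply, smul_eq_mul,
      Finset.mul_sum]
    rw [Finset.sum_comm]
    exact Finset.sum_congr rfl fun i _ ↦ Finset.sum_congr rfl fun j _ ↦ by ring
  simp only [h, hW, Finset.sum_mul]
  calc _ = ∑ i, ∑ a, ∑ j, f a i * f a j *
        B (EuclideanSpace.single i 1) (EuclideanSpace.single j 1) :=
      Finset.sum_congr rfl fun i _ ↦ Finset.sum_comm
    _ = _ := Finset.sum_comm

/-- The Christoffel form of the first kind `Γ(c; a, b)` of the first derivative of a metric. -/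
def christoffelForm (D1 : 𝔼 →L[ℝ] 𝔼 →L[ℝ] 𝔼 →L[ℝ] ℝ) (c a b : 𝔼) : ℝ :=
  1 / 2 * (D1 a b c + D1 b a c - D1 c a b)

/-- The Riemann tensor with lowered indices in terms of the derivatives of the metric and of an
orthonormal frame. -/
def riemannForm {ι : Type*} [Fintype ι] (f : ι → 𝔼) (D1 : 𝔼 →L[ℝ] 𝔼 →L[ℝ] 𝔼 →L[ℝ] ℝ)
    (D2 : 𝔼 →L[ℝ] 𝔼 →L[ℝ] 𝔼 →L[ℝ] 𝔼 →L[ℝ] ℝ) (l i j k : 𝔼) : ℝ :=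
  1 / 2 * (D2 i k j l - D2 i l j k - D2 j k i l + D2 j l i k)
    - ∑ c, (christoffelForm D1 (f c) i l * christoffelForm D1 (f c) j k
      - christoffelForm D1 (f c) j l * christoffelForm D1 (f c) i k)

/-- `riemannForm` is bilinear in `(i, l)` and in `(j, k)`, so each of the two contractions is an
instance of `sum_frame_eq`. -/
lemma sum_riemannForm_eq {ι : Type*} [Fintype ι] (W : Fin n → Fin n → ℝ) (f : ι → 𝔼)
    (hW : ∀ i j, W i j = ∑ a, f a i * f a j) (D1 : 𝔼 →L[ℝ] 𝔼 →L[ℝ] 𝔼 →L[ℝ] ℝ)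
    (D2 : 𝔼 →L[ℝ] 𝔼 →L[ℝ] 𝔼 →L[ℝ] 𝔼 →L[ℝ] ℝ) :
    ∑ j, ∑ k, W j k * ∑ i, ∑ l, W i l * riemannForm f D1 D2 (EuclideanSpace.single l 1)
        (EuclideanSpace.single i 1) (EuclideanSpace.single j 1) (EuclideanSpace.single k 1) =
      ∑ b, ∑ a, riemannForm f D1 D2 (f a) (f a) (f b) (f b) := by
  have h1 (j k : 𝔼) : ∑ i, ∑ l, W i l * riemannForm f D1 D2 (EuclideanSpace.single l 1)
      (EuclideanSpace.single i 1) j k = ∑ a, riemannForm f D1 D2 (f a) (f a) j k := by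
    let B0 : 𝔼 →ₗ[ℝ] 𝔼 →ₗ[ℝ] ℝ := LinearMap.mk₂ ℝ
      (fun i l ↦ 1 / 2 * (D2 i k j l - D2 i l j k - D2 j k i l + D2 j l i k))
      (by intros; simp only [map_add, add_apply]; ring)
      (by intros; simp only [map_smul, smul_apply, smul_eq_mul]; ring)
      (by intros; simp only [map_add, add_apply]; ring)
      (by intros; simp only [map_smul, smul_apply, smul_eq_mul]; ring)
    let B1 (c : ι) : 𝔼 →ₗ[ℝ] 𝔼 →ₗ[ℝ] ℝ := LinearMap.mk₂ ℝ
      (fun i l ↦ christoffelForm D1 (f c) i l * christoffelForm D1 (f c) j k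
        - christoffelForm D1 (f c) j l * christoffelForm D1 (f c) i k)
      (by intros; simp only [christoffelForm, map_add, add_apply]; ring)
      (by intros; simp only [christoffelForm, map_smul, smul_apply, smul_eq_mul]; ring)
      (by intros; simp only [christoffelForm, map_add, add_apply]; ring)
      (by intros; simp only [christoffelForm, map_smul, smul_apply, smul_eq_mul]; ring)
    have h (i l : 𝔼) : riemannForm f D1 D2 l i j k = (B0 - ∑ c, B1 c) i l := by
      simp [riemannForm, B0, B1, LinearMap.sum_apply]
    simp only [h]
    exact sum_frame_eq W f hW _
  have h2 (a : ι) : ∑ j, ∑ k, W j k * riemannForm f D1 D2 (f a) (f a)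
      (EuclideanSpace.single j 1) (EuclideanSpace.single k 1) =
        ∑ b, riemannForm f D1 D2 (f a) (f a) (f b) (f b) := by
    let B0 : 𝔼 →ₗ[ℝ] 𝔼 →ₗ[ℝ] ℝ := LinearMap.mk₂ ℝ
      (fun j k ↦ 1 / 2 * (D2 (f a) k j (f a) - D2 (f a) (f a) j k - D2 j k (f a) (f a)
        + D2 j (f a) (f a) k))
      (by intros; simp only [map_add, add_apply]; ring)
      (by intros; simp only [map_smul, smul_apply, smul_eq_mul]; ring)
      (by intros; simp only [map_add, add_apply]; ring)
      (by intros; simp only [map_smul, smul_apply, smul_eq_mul]; ring)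
    let B1 (c : ι) : 𝔼 →ₗ[ℝ] 𝔼 →ₗ[ℝ] ℝ := LinearMap.mk₂ ℝ
      (fun j k ↦ christoffelForm D1 (f c) (f a) (f a) * christoffelForm D1 (f c) j k
        - christoffelForm D1 (f c) j (f a) * christoffelForm D1 (f c) (f a) k)
      (by intros; simp only [christoffelForm, map_add, add_apply]; ring)
      (by intros; simp only [christoffelForm, map_smul, smul_apply, smul_eq_mul]; ring)
      (by intros; simp only [christoffelForm, map_add, add_apply]; ring)
      (by intros; simp only [christoffelForm, map_smul, smul_apply, smul_eq_mul]; ring)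
    have h (j k : 𝔼) : riemannForm f D1 D2 (f a) (f a) j k = (B0 - ∑ c, B1 c) j k := by
      simp [riemannForm, B0, B1, LinearMap.sum_apply]
    simp only [h]
    exact sum_frame_eq W f hW _
  simp only [h1, Finset.mul_sum]
  calc _ = ∑ j, ∑ a, ∑ k, W j k * riemannForm f D1 D2 (f a) (f a)
        (EuclideanSpace.single j 1) (EuclideanSpace.single k 1) :=
      Finset.sum_congr rfl fun j _ ↦ Finset.sum_comm
    _ = ∑ a, ∑ b, riemannForm f D1 D2 (f a) (f a) (f b) (f b) := by
      rw [Finset.sum_comm]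
      exact Finset.sum_congr rfl fun a _ ↦ h2 a
    _ = _ := Finset.sum_comm

end Trace

section Frame

open scoped MatrixOrder Matrix.Norms.L2Operator in
-- The columns of `A` are an `S`-orthonormal frame: take `A = B⁻¹` for a factorization `S = Bᵀ B`.
lemma Matrix.PosDef.exists_frame {n : ℕ} {S : Matrix (Fin n) (Fin n) ℝ} (hS : S.PosDef) :
    ∃ A : Matrix (Fin n) (Fin n) ℝ, A.transpose * S * A = 1 ∧ S⁻¹ = A * A.transpose := by
  obtain ⟨B, hB⟩ := CStarAlgebra.nonneg_iff_eq_star_mul_self.mp hS.posSemidef.nonneg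
  have hB' : S = B.transpose * B := by
    rw [hB, Matrix.star_eq_conjTranspose, Matrix.conjTranspose_eq_transpose_of_trivial]
  have hdet : IsUnit B.det := by
    rw [isUnit_iff_ne_zero]
    intro h
    have := hS.det_pos
    rw [hB', Matrix.det_mul, h, mul_zero] at this
    exact this.false
  refine ⟨B⁻¹, ?_, ?_⟩
  · have h1 : (B⁻¹).transpose * B.transpose = 1 := by
      rw [← Matrix.transpose_mul, Matrix.mul_nonsing_inv _ hdet, Matrix.transpose_one]
    rw [hB', ← Matrix.mul_assoc, h1, Matrix.one_mul, Matrix.mul_nonsing_inv _ hdet]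
  · rw [hB', Matrix.mul_inv_rev, Matrix.transpose_nonsing_inv]

end Frame

/-! ### Scalar curvature as a sum of sectional curvatures -/

namespace RiemannianCoord

variable {n : ℕ} {H : Type*} [TopologicalSpace H]
  (I : ModelWithCorners ℝ (EuclideanSpace ℝ (Fin n)) H)
  {M : Type*} [TopologicalSpace M] [ChartedSpace H M] [IsManifold I ∞ M]
  [Bundle.RiemannianBundle (fun x : M ↦ TangentSpace I x)]

local notation "𝔼" => EuclideanSpace ℝ (Fin n)

lemma posDef_metricMatrix (x : M) {y : 𝔼} (hy : y ∈ (extChartAt I x).target) :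
    (metricMatrix I x y).PosDef := by
  refine Matrix.PosDef.of_dotProduct_mulVec_pos ?_ fun v hv ↦ ?_
  · ext i j
    simpa using metricMatrix_symm I x y j i
  · have h := metricForm_self_pos I x hy (a := WithLp.toLp 2 v) (by
      intro h
      apply hv
      simpa using congrArg WithLp.ofLp h)
    rw [metricForm_apply] at h
    refine h.trans_eq ?_
    simp only [dotProduct, Matrix.mulVec, Finset.mul_sum]
    exact Finset.sum_congr rfl fun i _ ↦ Finset.sum_congr rfl fun j _ ↦ by
      simp; ring

variable [IsContMDiffRiemannianBundle I ∞ (EuclideanSpace ℝ (Fin n))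
  (fun x : M ↦ TangentSpace I x)]

lemma contDiffAt_metricForm (x : M) (hx : I.IsInteriorPoint x) :
    ContDiffAt ℝ ∞ (metricForm I x) (extChartAt I x x) := by
  unfold metricForm
  exact ContDiffAt.sum fun i _ ↦ ContDiffAt.sum fun j _ ↦
    (contDiffAt_metricMatrix I x hx i j).smul contDiffAt_const

lemma metricForm_single (x : M) (y : 𝔼) (i j : Fin n) :
    metricForm I x y (EuclideanSpace.single i 1) (EuclideanSpace.single j 1) =
      metricMatrix I x y i j := by
  simp [metricForm_apply]

lemma dMetric_eq_fderiv (x : M) (hx : I.IsInteriorPoint x) (k i j : Fin n) :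
    dMetric I x k i j =ᶠ[𝓝 (extChartAt I x x)] fun y ↦ fderiv ℝ (metricForm I x) y
      (EuclideanSpace.single k 1) (EuclideanSpace.single i 1) (EuclideanSpace.single j 1) := by
  filter_upwards [(contDiffAt_metricForm I x hx).of_le (m := 1)
    (by norm_cast) |>.eventually (by simp)] with y hy
  have h := ((hy.differentiableAt (by simp)).hasFDerivAt.clm_apply
    (hasFDerivAt_const (EuclideanSpace.single i (1 : ℝ)) y)).clm_apply
    (hasFDerivAt_const (EuclideanSpace.single j (1 : ℝ)) y)
  simp only [metricForm_single] at h
  rw [dMetric, h.fderiv]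
  simp

lemma ddMetric_eq_fderiv (x : M) (hx : I.IsInteriorPoint x) (k l i j : Fin n) :
    ddMetric I x k l i j (extChartAt I x x) =
      fderiv ℝ (fderiv ℝ (metricForm I x)) (extChartAt I x x) (EuclideanSpace.single k 1)
      (EuclideanSpace.single l 1) (EuclideanSpace.single i 1) (EuclideanSpace.single j 1) := by
  have hd : DifferentiableAt ℝ (fderiv ℝ (metricForm I x)) (extChartAt I x x) :=
    ((contDiffAt_metricForm I x hx).fderiv_right (m := 1) (by norm_cast)).differentiableAt
      (by simp)
  have h := ((hd.hasFDerivAt.clm_apply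
    (hasFDerivAt_const (EuclideanSpace.single l (1 : ℝ)) _)).clm_apply
    (hasFDerivAt_const (EuclideanSpace.single i (1 : ℝ)) _)).clm_apply
    (hasFDerivAt_const (EuclideanSpace.single j (1 : ℝ)) _)
  rw [ddMetric, (dMetric_eq_fderiv I x hx l i j).fderiv_eq, h.fderiv]
  simp

end RiemannianCoord

namespace RiemannianCoord

variable {n : ℕ} {H : Type*} [TopologicalSpace H]
  (I : ModelWithCorners ℝ (EuclideanSpace ℝ (Fin n)) H)
  {M : Type*} [TopologicalSpace M] [ChartedSpace H M] [IsManifold I ∞ M]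
  [Bundle.RiemannianBundle (fun x : M ↦ TangentSpace I x)]
  [IsContMDiffRiemannianBundle I ∞ (EuclideanSpace ℝ (Fin n)) (fun x : M ↦ TangentSpace I x)]

local notation "𝔼" => EuclideanSpace ℝ (Fin n)

/-- The metric in affine coordinates adapted to a frame. -/
def frameMetric (x : M) (L : 𝔼 →L[ℝ] 𝔼) (z : 𝔼) : 𝔼 →L[ℝ] 𝔼 →L[ℝ] ℝ :=
  pullbackForm L (metricForm I x (extChartAt I x x + L z))

lemma contDiffAt_frameMetric (x : M) (hx : I.IsInteriorPoint x) (L : 𝔼 →L[ℝ] 𝔼) :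
    ContDiffAt ℝ 2 (frameMetric I x L) 0 :=
  contDiffAt_pullbackForm ((contDiffAt_metricForm I x hx).of_le (by norm_cast)) L

lemma frameMetric_symm (x : M) (L : 𝔼 →L[ℝ] 𝔼) (z a b : 𝔼) :
    frameMetric I x L z a b = frameMetric I x L z b a :=
  metricForm_symm I x _ _ _

/-- The jet of the metric in affine coordinates adapted to a frame. -/
def frameJet (x : M) (hx : I.IsInteriorPoint x) (L : 𝔼 →L[ℝ] 𝔼) : MetricJet 𝔼 :=
  MetricJet.ofField (frameMetric I x L) (contDiffAt_frameMetric I x hx L) (frameMetric_symm I x L)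

lemma frameJet_d1 (x : M) (hx : I.IsInteriorPoint x) (L : 𝔼 →L[ℝ] 𝔼) (w a b : 𝔼) :
    (frameJet I x hx L).d1 w a b =
      fderiv ℝ (metricForm I x) (extChartAt I x x) (L w) (L a) (L b) := by
  have := (fderiv_pullbackForm ((contDiffAt_metricForm I x hx).of_le (by norm_cast)) L).self_of_nhds
    w a b
  rwa [map_zero, add_zero] at this

lemma frameJet_d2 (x : M) (hx : I.IsInteriorPoint x) (L : 𝔼 →L[ℝ] 𝔼) (v w a b : 𝔼) :
    (frameJet I x hx L).d2 v w a b =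
      fderiv ℝ (fderiv ℝ (metricForm I x)) (extChartAt I x x) (L v) (L w) (L a) (L b) :=
  fderiv_fderiv_eq_of_pullback (contDiffAt_frameMetric I x hx L)
    ((contDiffAt_metricForm I x hx).of_le (by norm_cast)) L
    (fderiv_pullbackForm ((contDiffAt_metricForm I x hx).of_le (by norm_cast)) L) v w a b

/-- An affine change of coordinates has no second derivative, so derivatives of the metric pull back
like tensors. The frame turns the contraction with the inverse metric into a plain sum, by Parseval;
the sign of `conn` disappears because it enters quadratically. -/
lemma curv_frameJet (x : M) (hx : I.IsInteriorPoint x) (L : 𝔼 →L[ℝ] 𝔼) (a b : 𝔼) :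
    (frameJet I x hx L).curv a b =
      riemannForm (fun c : Fin n ↦ L (EuclideanSpace.single c 1))
        (fderiv ℝ (metricForm I x) (extChartAt I x x))
        (fderiv ℝ (fderiv ℝ (metricForm I x)) (extChartAt I x x)) (L a) (L a) (L b) (L b) := by
  set J := frameJet I x hx L with hJ
  have hin (p q r s : 𝔼) : ⟪J.conn p q, J.conn r s⟫ = ∑ c : Fin n,
      christoffelForm (fderiv ℝ (metricForm I x) (extChartAt I x x))
        (L (EuclideanSpace.single c 1)) (L p) (L q) *
      christoffelForm (fderiv ℝ (metricForm I x) (extChartAt I x x))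
        (L (EuclideanSpace.single c 1)) (L r) (L s) := by
    rw [← (EuclideanSpace.basisFun (Fin n) ℝ).sum_inner_mul_inner]
    refine Finset.sum_congr rfl fun c _ ↦ ?_
    rw [real_inner_comm (J.conn r s), EuclideanSpace.basisFun_apply, J.inner_conn, J.inner_conn]
    simp only [hJ, frameJet_d1, christoffelForm]
    ring
  have h4 := J.d2_comm a b b a
  have h5 := J.d2_symm b a b a
  have h6 : ⟪J.conn a b, J.conn a b⟫ = ⟪J.conn b a, J.conn a b⟫ := by rw [J.conn_symm b a]
  rw [hin, hin] at h6
  rw [hJ, frameJet_d2, frameJet_d2] at h4 h5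
  simp only [MetricJet.curv, riemannForm, hin, Finset.sum_sub_distrib]
  simp only [hJ, frameJet_d2]
  linarith

/-- Orthonormal coordinates at a point: there the scalar curvature is the sum of the sectional
curvatures. -/
lemma exists_frame (x : M) (hx : I.IsInteriorPoint x) : ∃ L : 𝔼 →L[ℝ] 𝔼,
    (∀ a b, frameMetric I x L 0 a b = ⟪a, b⟫) ∧
    ∑ b : Fin n, ∑ a : Fin n, (frameJet I x hx L).curv (EuclideanSpace.single a 1)
      (EuclideanSpace.single b 1) = scalarCurvature I x := by
  have hpd := posDef_metricMatrix I x (mem_extChartAt_target (I := I) x)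
  obtain ⟨A, hA1, hA2⟩ := hpd.exists_frame
  let L : 𝔼 →L[ℝ] 𝔼 := Matrix.toEuclideanCLM (𝕜 := ℝ) A
  have hL (v : 𝔼) (i : Fin n) : L v i = ∑ j, A i j * v j := rfl
  have hLs (a i : Fin n) : L (EuclideanSpace.single a 1) i = A i a := by
    simp [hL]
  have hW (i j : Fin n) : (metricMatrix I x (extChartAt I x x))⁻¹ i j =
      ∑ a, L (EuclideanSpace.single a 1) i * L (EuclideanSpace.single a 1) j := by
    simp only [hLs, hA2, Matrix.mul_apply, Matrix.transpose_apply]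
  refine ⟨L, fun a b ↦ ?_, ?_⟩
  · have h1 (i j : Fin n) : ∑ p, ∑ q, A p i * metricMatrix I x (extChartAt I x x) p q * A q j =
        (1 : Matrix (Fin n) (Fin n) ℝ) i j := by
      rw [← hA1, Matrix.mul_apply, Finset.sum_comm]
      refine Finset.sum_congr rfl fun q _ ↦ ?_
      rw [Matrix.mul_apply, Finset.sum_mul]
      rfl
    let B : 𝔼 →ₗ[ℝ] 𝔼 →ₗ[ℝ] ℝ := LinearMap.mk₂ ℝ (fun a b ↦ frameMetric I x L 0 a b)
      (by simp) (by simp) (by simp) (by simp)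
    have hB : B = innerₗ 𝔼 := by
      refine (EuclideanSpace.basisFun (Fin n) ℝ).toBasis.ext fun i ↦
        (EuclideanSpace.basisFun (Fin n) ℝ).toBasis.ext fun j ↦ ?_
      simp only [OrthonormalBasis.coe_toBasis, EuclideanSpace.basisFun_apply]
      change frameMetric I x L 0 _ _ =
        ⟪EuclideanSpace.single i (1 : ℝ), EuclideanSpace.single j (1 : ℝ)⟫
      rw [frameMetric, pullbackForm_apply, map_zero, add_zero, metricForm_apply]
      simp only [hLs]
      have := h1 i j
      rw [Matrix.one_apply] at this
      have h2 : ⟪EuclideanSpace.single i (1 : ℝ), EuclideanSpace.single j (1 : ℝ)⟫ =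
          if i = j then 1 else 0 := by
        rw [EuclideanSpace.inner_single_left]
        simp
      rw [h2, ← this]
      exact Finset.sum_congr rfl fun p _ ↦ Finset.sum_congr rfl fun q _ ↦ by ring
    exact congrArg (fun T : 𝔼 →ₗ[ℝ] 𝔼 →ₗ[ℝ] ℝ ↦ T a b) hB
  · have hnhds : range I ∈ 𝓝 (extChartAt I x x) := mem_interior_iff_mem_nhds.1 hx
    rw [scalarCurvature_eq I x hnhds (contDiffAt_metricMatrix I x hx) hpd.det_pos.ne']
    simp only [curv_frameJet]
    rw [← sum_riemannForm_eq _ _ hW]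
    set D1 := fderiv ℝ (metricForm I x) (extChartAt I x x) with hD1
    have hΓ (q i l : Fin n) : christoffelFirst I x q i l (extChartAt I x x) =
        christoffelForm D1 (EuclideanSpace.single q 1) (EuclideanSpace.single i 1)
          (EuclideanSpace.single l 1) := by
      simp only [christoffelFirst, christoffelForm, (dMetric_eq_fderiv I x hx _ _ _).self_of_nhds,
        hD1]
    -- Contraction with `g^{qp}` equals summation over the orthonormal frame given by the columns of
    -- `A`.
    have hsum (i l j k : 𝔼) :
        ∑ q, ∑ p, (metricMatrix I x (extChartAt I x x))⁻¹ q p *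
          (christoffelForm D1 (EuclideanSpace.single q 1) i l *
            christoffelForm D1 (EuclideanSpace.single p 1) j k) =
        ∑ c : Fin n, christoffelForm D1 (L (EuclideanSpace.single c 1)) i l *
          christoffelForm D1 (L (EuclideanSpace.single c 1)) j k := by
      let B : 𝔼 →ₗ[ℝ] 𝔼 →ₗ[ℝ] ℝ := LinearMap.mk₂ ℝ
        (fun c d ↦ christoffelForm D1 c i l * christoffelForm D1 d j k)
        (fun _ _ _ ↦ by simp only [christoffelForm, map_add, add_apply]; ring)
        (fun _ _ _ ↦ by simp only [christoffelForm, map_smul, smul_apply, smul_eq_mul]; ring)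
        (fun _ _ _ ↦ by simp only [christoffelForm, map_add, add_apply]; ring)
        (fun _ _ _ ↦ by simp only [christoffelForm, map_smul, smul_apply, smul_eq_mul]; ring)
      exact sum_frame_eq _ _ hW B
    refine (Finset.sum_congr rfl fun j _ ↦ Finset.sum_congr rfl fun k _ ↦ congrArg _ <|
      Finset.sum_congr rfl fun i _ ↦ Finset.sum_congr rfl fun l _ ↦ congrArg _ ?_).symm
    simp only [riemannLow, riemannForm, ddMetric_eq_fderiv I x hx, Finset.sum_sub_distrib, hΓ,
      ← hsum]
    simp only [Finset.mul_sum]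
    congr 2 <;> exact Finset.sum_congr rfl fun q _ ↦ Finset.sum_congr rfl fun p _ ↦ by ring

end RiemannianCoord

/-! ### Polarized curvature and approximate calibrations -/

namespace MetricJet

variable {E : Type*} [NormedAddCommGroup E] [InnerProductSpace ℝ E] [FiniteDimensional ℝ E]
  (J : MetricJet E)

/-- The symmetric bilinear form associated with the quadratic form `a ↦ J.curv a u`. -/
def curvForm (u a b : E) : ℝ :=
  1 / 2 * (J.d2 a u u b + J.d2 b u u a) - 1 / 2 * J.d2 a b u u - 1 / 2 * J.d2 u u a b
    + ⟪J.conn a u, J.conn b u⟫ - ⟪J.conn a b, J.conn u u⟫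

lemma curv_add (u a b : E) :
    J.curv (a + b) u = J.curv a u + 2 * J.curvForm u a b + J.curv b u := by
  have h1 := J.d2_comm a b u u
  have h2 := J.d2_symm u u a b
  have h3 := J.conn_symm a b
  have h4 := real_inner_comm (J.conn a u) (J.conn b u)
  simp only [curv, curvForm, map_add, add_apply, inner_add_left, inner_add_right, h1, h2, h3, h4]
  ring

lemma curvForm_smul_left (u a b : E) (t : ℝ) :
    J.curvForm u (t • a) b = t * J.curvForm u a b := by
  simp only [curvForm, map_smul, smul_apply, real_inner_smul_left, smul_eq_mul]
  ring

lemma curvForm_add_right (u a b c : E) :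
    J.curvForm u a (b + c) = J.curvForm u a b + J.curvForm u a c := by
  simp only [curvForm, map_add, add_apply, inner_add_left, inner_add_right]
  ring

lemma curvForm_smul_right (u a b : E) (t : ℝ) :
    J.curvForm u a (t • b) = t * J.curvForm u a b := by
  simp only [curvForm, map_smul, smul_apply, real_inner_smul_left, real_inner_smul_right,
    smul_eq_mul]
  ring

lemma curv_smul_left (t : ℝ) (a u : E) : J.curv (t • a) u = t ^ 2 * J.curv a u := by
  simp only [curv, map_smul, smul_apply, real_inner_smul_left, real_inner_smul_right,
    smul_eq_mul]
  ring

lemma curv_smul_right (t : ℝ) (a u : E) : J.curv a (t • u) = t ^ 2 * J.curv a u := by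
  rw [curv_symm, curv_smul_left, curv_symm]

/-- This is the derivative of the constancy of `J.curv e` in the direction `e`. In the differential
of a calibration it leaves only the part of the vector orthogonal to `e` in the polarized term. -/
lemma curvForm_self_right (e z : E) : J.curvForm e z e = 0 := by
  have h1 := J.curv_add e z e
  have h2 := J.curv_add_smul e z 1
  rw [one_smul, curv_symm, h1, curv_self, J.curv_symm e z] at h2
  linarith

lemma curvForm_self (u a : E) : J.curvForm u a a = J.curv a u := by
  simp only [curv, curvForm]
  ring

/-- A bound for the curvature form. -/
def curvBound : ℝ := 2 * ‖J.d2‖ + 2 * ‖J.conn‖ ^ 2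

lemma curvBound_nonneg : 0 ≤ J.curvBound := by
  unfold curvBound
  positivity

lemma abs_d2_le (a b c d : E) : |J.d2 a b c d| ≤ ‖J.d2‖ * (‖a‖ * ‖b‖ * ‖c‖ * ‖d‖) := by
  have h := (J.d2 a b c).le_opNorm d
  rw [Real.norm_eq_abs] at h
  refine h.trans ?_
  have h2 := (J.d2 a b).le_opNorm c
  have h3 := (J.d2 a).le_opNorm b
  have h4 := J.d2.le_opNorm a
  calc ‖J.d2 a b c‖ * ‖d‖ ≤ ‖J.d2‖ * ‖a‖ * ‖b‖ * ‖c‖ * ‖d‖ := by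
        gcongr
        refine h2.trans ?_
        gcongr
        refine h3.trans ?_
        gcongr
    _ = _ := by ring

lemma abs_inner_conn_le (a b c d : E) :
    |⟪J.conn a b, J.conn c d⟫| ≤ ‖J.conn‖ ^ 2 * (‖a‖ * ‖b‖ * ‖c‖ * ‖d‖) := by
  refine (abs_real_inner_le_norm _ _).trans ?_
  calc _ ≤ (‖J.conn‖ * ‖a‖ * ‖b‖) * (‖J.conn‖ * ‖c‖ * ‖d‖) := by
        gcongr
        · exact J.conn.le_opNorm₂ a b
        · exact J.conn.le_opNorm₂ c d
    _ = _ := by ring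

lemma abs_curvForm_le (u a b : E) :
    |J.curvForm u a b| ≤ J.curvBound * ‖u‖ ^ 2 * (‖a‖ * ‖b‖) := by
  have h1 := abs_le.1 (J.abs_d2_le a u u b)
  have h2 := abs_le.1 (J.abs_d2_le b u u a)
  have h3 := abs_le.1 (J.abs_d2_le a b u u)
  have h4 := abs_le.1 (J.abs_d2_le u u a b)
  have h5 := abs_le.1 (J.abs_inner_conn_le a u b u)
  have h6 := abs_le.1 (J.abs_inner_conn_le a b u u)
  unfold curvBound curvForm
  rw [abs_le]
  constructor <;> nlinarith only [h1, h2, h3, h4, h5, h6]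

lemma abs_curv_le (a u : E) : |J.curv a u| ≤ J.curvBound * ‖u‖ ^ 2 * ‖a‖ ^ 2 := by
  rw [← curvForm_self, sq ‖a‖]
  exact J.abs_curvForm_le u a a

lemma abs_curv_div_le (a u : E) :
    |J.curv a u / (6 * ‖a‖)| ≤ J.curvBound * ‖u‖ ^ 2 * ‖a‖ / 6 := by
  -- For coincident points the quotient is `0` by the convention for division by zero, the value
  -- wanted for their distance.
  rcases eq_or_ne a 0 with rfl | ha
  · simp
  have hpos := norm_pos_iff.2 ha
  rw [abs_div, abs_of_pos (by positivity : 0 < 6 * ‖a‖), div_le_div_iff₀ (by positivity) (by simp)]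
  have := J.abs_curv_le a u
  nlinarith

/-- The function whose increments along a segment in the direction `e` are the distances of its
points up to higher order terms. -/
def calibration (e z : E) : ℝ := ⟪e, z⟫ - 1 / 6 * (⟪e, z⟫ * J.curv e z)

lemma contDiff_calibration (e : E) : ContDiff ℝ 1 (J.calibration e) := by
  have h : ContDiff ℝ 1 fun z ↦ J.curv e z := by
    have hid : ContDiff ℝ 1 fun z : E ↦ z := contDiff_id
    have he : ContDiff ℝ 1 fun _ : E ↦ e := contDiff_const
    have h1 := (((J.d2 e).contDiff (n := 1)).clm_apply hid).clm_apply he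
    have h2 := ((J.d2 e e).contDiff (n := 1)).clm_apply hid
    have h3 := ((J.d2.contDiff (n := 1)).clm_apply hid).clm_apply he |>.clm_apply he
    have h4 := ((J.conn e).contDiff (n := 1)).inner ℝ ((J.conn e).contDiff (n := 1))
    have h5 := (contDiff_const (n := 1) (c := J.conn e e)).inner ℝ
      ((J.conn.contDiff (n := 1)).clm_apply hid)
    exact (((h1.sub (contDiff_const.mul h2)).sub (contDiff_const.mul h3)).add h4).sub h5
  have hi : ContDiff ℝ 1 fun z : E ↦ ⟪e, z⟫ := (innerSL ℝ e).contDiff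
  exact hi.sub (contDiff_const.mul (hi.mul h))

lemma fderiv_calibration (e z a : E) : fderiv ℝ (J.calibration e) z a =
    ⟪e, a⟫ - 1 / 6 * (⟪e, a⟫ * J.curv e z + ⟪e, z⟫ * (2 * J.curvForm e z a)) := by
  have hline : HasDerivAt (fun t : ℝ ↦ z + t • a) a 0 := by
    simpa using ((hasDerivAt_id (0 : ℝ)).smul_const a).const_add z
  have h1 : HasDerivAt (fun t : ℝ ↦ J.calibration e (z + t • a))
      (fderiv ℝ (J.calibration e) z a) 0 := by
    have hd : HasFDerivAt (J.calibration e) (fderiv ℝ (J.calibration e) z) (z + (0 : ℝ) • a) := by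
      rw [zero_smul, add_zero]
      exact ((J.contDiff_calibration e).differentiable one_ne_zero z).hasFDerivAt
    exact hd.comp_hasDerivAt 0 hline
  have h2 : (fun t : ℝ ↦ J.calibration e (z + t • a)) = fun t ↦ (⟪e, z⟫ + t * ⟪e, a⟫)
      - 1 / 6 * ((⟪e, z⟫ + t * ⟪e, a⟫) *
        (J.curv e z + 2 * (t * J.curvForm e z a) + t ^ 2 * J.curv e a)) := by
    funext t
    rw [calibration, inner_add_right, real_inner_smul_right, J.curv_symm e (z + t • a), curv_add,
      curvForm_smul_right, curv_smul_left, J.curv_symm z, J.curv_symm a]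
  rw [h2] at h1
  have hl : HasDerivAt (fun t : ℝ ↦ ⟪e, z⟫ + t * ⟪e, a⟫) ⟪e, a⟫ 0 := by
    simpa using ((hasDerivAt_id (0 : ℝ)).mul_const ⟪e, a⟫).const_add ⟪e, z⟫
  have hq : HasDerivAt (fun t : ℝ ↦ J.curv e z + 2 * (t * J.curvForm e z a) + t ^ 2 * J.curv e a)
      (2 * J.curvForm e z a) 0 := by
    have h3 := (((hasDerivAt_id (0 : ℝ)).mul_const (J.curvForm e z a)).const_mul 2).const_add
      (J.curv e z)
    have h4 := (hasDerivAt_pow 2 (0 : ℝ)).mul_const (J.curv e a)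
    exact (h3.add h4).congr_deriv (by simp)
  have h3 := hl.sub ((hl.mul hq).const_mul (1 / 6))
  rw [h1.unique h3]
  simp

lemma calibration_sub (e u : E) (he : ‖e‖ = 1) (t : ℝ) :
    J.calibration e (u + t • e) - J.calibration e u = t - 1 / 6 * (t * J.curv e u) := by
  rw [calibration, calibration, curv_add_smul, inner_add_right, real_inner_smul_right,
    real_inner_self_eq_norm_sq, he]
  ring

end MetricJet

/-- In the application `R = ‖z‖²`, while `s` and `b` measure the parts of a vector along and
orthogonal to `e`, and `H` is its squared metric length. The coefficients of `s²` agree to first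
order in `K`, since `(1 - K/6)² ≈ 1 - K/3`. The mixed terms are of size `C R |s| b`; they need not
match, because part of `b²` absorbs them at the price of `(C R)² s²`, which is at most `δ R s²/10`
for small `R`. -/
lemma sq_le_of_quadratic_bounds {s b K B Kb T R C δ H : ℝ} (hb : 0 ≤ b) (hR : 0 ≤ R) (hC : 0 ≤ C)
    (hδ : 0 < δ) (hK : |K| ≤ C * R) (hB : |B| ≤ C * R * b) (hKb : |Kb| ≤ C * R * b ^ 2)
    (hT : |T| ≤ C * R * b) (hCR : C * R ≤ 1 / 10) (hδR : δ * R ≤ 1 / 10)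
    (hCδ : 10 * C ^ 2 * R ≤ δ)
    (hH : s ^ 2 + b ^ 2 - 1 / 3 * (s ^ 2 * K + 2 * (s * B) + Kb) - δ * R * (s ^ 2 + b ^ 2) ≤ H) :
    (s * (1 - 1 / 6 * K) - 1 / 3 * T) ^ 2 ≤ (1 + 3 * δ * R) * H := by
  set y := C * R with hy
  have hy0 : 0 ≤ y := mul_nonneg hC hR
  have hyy : 10 * y ^ 2 ≤ δ * R := by
    have := mul_le_mul_of_nonneg_right hCδ hR
    rw [hy]
    nlinarith only [this]
  set d := δ * R with hd
  have hd0 : 0 ≤ d := mul_nonneg hδ.le hR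
  have hK1 : |K| ≤ 1 / 10 := hK.trans hCR
  have hsB : |s * B| ≤ y * (|s| * b) := by
    rw [abs_mul]
    nlinarith only [mul_le_mul_of_nonneg_left hB (abs_nonneg s)]
  have hsT : |s * T| ≤ y * (|s| * b) := by
    rw [abs_mul]
    nlinarith only [mul_le_mul_of_nonneg_left hT (abs_nonneg s)]
  have hsKT : |s * K * T| ≤ 1 / 10 * (y * (|s| * b)) := by
    have : s * K * T = K * (s * T) := by ring
    rw [this, abs_mul]
    exact mul_le_mul hK1 hsT (abs_nonneg _) (by norm_num)
  have hsK : |s ^ 2 * K| ≤ y * s ^ 2 := by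
    rw [abs_mul, abs_of_nonneg (sq_nonneg s), mul_comm]
    exact mul_le_mul_of_nonneg_right hK (sq_nonneg s)
  have hKsq : K ^ 2 ≤ y ^ 2 := sq_le_sq' (by linarith [abs_le.1 hK]) (abs_le.1 hK).2
  have hT2 : T ^ 2 ≤ 1 / 100 * b ^ 2 := by
    have h1 : |T| ≤ 1 / 10 * b := hT.trans (mul_le_mul_of_nonneg_right hCR hb)
    have := sq_le_sq' (by linarith [abs_le.1 h1]) (abs_le.1 h1).2
    nlinarith only [this]
  have hcross : y * (|s| * b) ≤ 1 / 8 * b ^ 2 + 2 * y ^ 2 * s ^ 2 := by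
    have := sq_nonneg (b - 4 * y * |s|)
    have h2 := sq_abs s
    nlinarith only [this, h2]
  have hys : y ^ 2 * s ^ 2 ≤ 1 / 10 * d * s ^ 2 := by
    nlinarith only [mul_le_mul_of_nonneg_right hyy (sq_nonneg s)]
  have hyb : y * b ^ 2 ≤ 1 / 10 * b ^ 2 := mul_le_mul_of_nonneg_right hCR (sq_nonneg b)
  have hys' : y * s ^ 2 ≤ 1 / 10 * s ^ 2 := mul_le_mul_of_nonneg_right hCR (sq_nonneg s)
  have hdb : d * b ^ 2 ≤ 1 / 10 * b ^ 2 := mul_le_mul_of_nonneg_right hδR (sq_nonneg b)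
  have hds' : d * s ^ 2 ≤ 1 / 10 * s ^ 2 := mul_le_mul_of_nonneg_right hδR (sq_nonneg s)
  have hb2 := sq_nonneg b
  have hs2 := sq_nonneg s
  have hds : 0 ≤ d * s ^ 2 := mul_nonneg hd0 hs2
  have hs2K : s ^ 2 * K ^ 2 ≤ y ^ 2 * s ^ 2 := by
    nlinarith only [mul_le_mul_of_nonneg_right hKsq hs2]
  rw [abs_le] at hsB hsT hsKT hsK hKb
  have hhalf : 1 / 2 * s ^ 2 ≤ H := by
    nlinarith only [hH, hsB, hsK, hKb, hcross, hys, hyb, hys', hdb, hds', hb2, hs2]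
  have hmain : (s * (1 - 1 / 6 * K) - 1 / 3 * T) ^ 2 ≤ H + 3 / 2 * (d * s ^ 2) := by
    have hexp : (s * (1 - 1 / 6 * K) - 1 / 3 * T) ^ 2 = s ^ 2 - 1 / 3 * (s ^ 2 * K)
        + 1 / 36 * (s ^ 2 * K ^ 2) - 2 / 3 * (s * T) + 1 / 9 * (s * K * T) + 1 / 9 * T ^ 2 := by
      ring
    rw [hexp]
    linarith
  have hfin := mul_le_mul_of_nonneg_left hhalf hd0
  calc _ ≤ H + 3 / 2 * (d * s ^ 2) := hmain
    _ ≤ H + 3 * (d * H) := by linarith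
    _ = _ := by rw [hd]; ring

namespace MetricJet

variable {E : Type*} [NormedAddCommGroup E] [InnerProductSpace ℝ E] [FiniteDimensional ℝ E]
  (J : MetricJet E)

/-- The approximate calibration property: the gradient of `calibration e` has metric norm at most `1
+ o(‖z‖²)`. Splitting `a` along `e` reduces it to `sq_le_of_quadratic_bounds`. -/
lemma abs_fderiv_calibration_le {δ h : ℝ} {e z a : E} (he : ‖e‖ = 1) (hδ : 0 < δ)
    (hz : J.curvBound * ‖z‖ ^ 2 ≤ 1 / 10) (hδz : δ * ‖z‖ ^ 2 ≤ 1 / 10)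
    (hCz : 10 * J.curvBound ^ 2 * ‖z‖ ^ 2 ≤ δ)
    (hh : |h - (‖a‖ ^ 2 - 1 / 3 * J.curv a z)| ≤ δ * ‖z‖ ^ 2 * ‖a‖ ^ 2) :
    |fderiv ℝ (J.calibration e) z a| ≤ (1 + 2 * δ * ‖z‖ ^ 2) * √h := by
  set s := ⟪e, a⟫ with hs
  set b := a - s • e with hb
  have hab : a = s • e + b := by rw [hb]; abel
  have heb : ⟪e, b⟫ = 0 := by
    rw [hb, inner_sub_right, real_inner_smul_right, real_inner_self_eq_norm_sq, he, ← hs]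
    ring
  have hnorm : ‖a‖ ^ 2 = s ^ 2 + ‖b‖ ^ 2 := by
    rw [hab, norm_add_sq_real, real_inner_smul_left, heb, norm_smul, he, mul_pow,
      Real.norm_eq_abs, sq_abs]
    ring
  have hcurv : J.curv a z = s ^ 2 * J.curv e z + 2 * (s * J.curvForm z e b) + J.curv b z := by
    conv_lhs => rw [hab]
    rw [curv_add, curv_smul_left, curvForm_smul_left]
  have hform : J.curvForm e z a = J.curvForm e z b := by
    conv_lhs => rw [hab]
    rw [curvForm_add_right, curvForm_smul_right, curvForm_self_right]
    ring
  have hder : fderiv ℝ (J.calibration e) z a =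
      s * (1 - 1 / 6 * J.curv e z) - 1 / 3 * (⟪e, z⟫ * J.curvForm e z b) := by
    rw [fderiv_calibration, hform]
    ring
  have hsq : (fderiv ℝ (J.calibration e) z a) ^ 2 ≤ (1 + 3 * δ * ‖z‖ ^ 2) * h := by
    rw [hder]
    refine sq_le_of_quadratic_bounds (B := J.curvForm z e b) (Kb := J.curv b z) (norm_nonneg b)
      (sq_nonneg ‖z‖) J.curvBound_nonneg hδ ?_ ?_ ?_ ?_ hz hδz hCz ?_
    · have := J.abs_curv_le e z
      rwa [he, one_pow, mul_one] at this
    · have := J.abs_curvForm_le z e b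
      rwa [he, one_mul] at this
    · exact J.abs_curv_le b z
    · rw [abs_mul]
      have h1 := J.abs_curvForm_le e z b
      have h2 := abs_real_inner_le_norm e z
      rw [he, one_mul] at h2
      rw [he, one_pow, mul_one] at h1
      calc _ ≤ ‖z‖ * (J.curvBound * (‖z‖ * ‖b‖)) :=
            mul_le_mul h2 h1 (abs_nonneg _) (norm_nonneg _)
        _ = _ := by ring
    · rw [← hcurv, ← hnorm]
      linarith [abs_le.1 hh]
  -- Needed for `√h` to square to `h`; it follows from `hsq`, whose left side is a square.
  have hh0 : 0 ≤ h := by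
    by_contra! hneg
    have hpos : 0 < 1 + 3 * δ * ‖z‖ ^ 2 := by positivity
    nlinarith [sq_nonneg (fderiv ℝ (J.calibration e) z a), mul_pos_of_neg_of_neg hneg
      (neg_lt_zero.2 hpos)]
  have hk : 0 ≤ 1 + 2 * δ * ‖z‖ ^ 2 := by positivity
  refine abs_le_of_sq_le_sq ?_ (mul_nonneg hk (Real.sqrt_nonneg h))
  rw [mul_pow, Real.sq_sqrt hh0]
  refine hsq.trans (mul_le_mul_of_nonneg_right ?_ hh0)
  have : 0 ≤ δ * ‖z‖ ^ 2 := by positivity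
  nlinarith only [this]

end MetricJet

/-! ### Normal charts and the expansion of the distance -/

section Small

lemma eventually_mul_sq_le (c : ℝ) {d : ℝ} (hd : 0 < d) :
    ∀ᶠ ρ in 𝓝[>] (0 : ℝ), c * ρ ^ 2 ≤ d := by
  have h : Tendsto (fun ρ : ℝ ↦ c * ρ ^ 2) (𝓝 0) (𝓝 0) := by
    have : Continuous fun ρ : ℝ ↦ c * ρ ^ 2 := by fun_prop
    simpa using this.tendsto 0
  exact nhdsWithin_le_nhds ((h.eventually (gt_mem_nhds hd)).mono fun _ h ↦ h.le)

lemma eventually_mul_lt (c : ℝ) {d : ℝ} (hd : 0 < d) : ∀ᶠ ρ in 𝓝[>] (0 : ℝ), c * ρ < d := by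
  have h : Tendsto (fun ρ : ℝ ↦ c * ρ) (𝓝 0) (𝓝 0) := by
    have : Continuous fun ρ : ℝ ↦ c * ρ := by fun_prop
    simpa using this.tendsto 0
  exact nhdsWithin_le_nhds (h.eventually (gt_mem_nhds hd))

lemma eventually_forall_norm_le {E : Type*} [NormedAddCommGroup E] {P : E → Prop}
    (hP : ∀ᶠ z in 𝓝 (0 : E), P z) (c : ℝ) :
    ∀ᶠ ρ in 𝓝[>] (0 : ℝ), ∀ z, ‖z‖ ≤ c * ρ → P z := by
  obtain ⟨r, hr, h⟩ := Metric.eventually_nhds_iff.1 hP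
  filter_upwards [eventually_mul_lt c hr] with ρ hρ z hz
  exact h (by rw [dist_zero_right]; exact hz.trans_lt hρ)

end Small

/-- Coordinates around `x` in which the metric, given by the quadratic forms `form`, is the inner
product up to a curvature term, together with the comparison of the metric with the distance. -/
structure NormalChart {M : Type*} [PseudoEMetricSpace M] (x : M) (E : Type*)
    [NormedAddCommGroup E] [InnerProductSpace ℝ E] [FiniteDimensional ℝ E] where
  /-- the jet of the metric -/
  jet : MetricJet E
  /-- the parametrization -/
  toFun : E → M
  /-- the coordinates -/
  inv : M → E
  /-- the metric in these coordinates -/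
  form : E → E → ℝ
  /-- the radius of the ball on which the parametrization is defined -/
  innerRadius : ℝ
  /-- the radius of the ball on which the coordinates are defined -/
  outerRadius : ℝ
  innerRadius_pos : 0 < innerRadius
  outerRadius_pos : 0 < outerRadius
  map_zero : toFun 0 = x
  norm_inv_lt : ∀ p ∈ Metric.eball x (ENNReal.ofReal outerRadius), ‖inv p‖ < innerRadius
  right_inv : ∀ p ∈ Metric.eball x (ENNReal.ofReal outerRadius), toFun (inv p) = p
  left_inv : ∀ u, ‖u‖ < innerRadius → inv (toFun u) = u
  expansion : ∀ δ > 0, ∀ᶠ z in 𝓝 (0 : E), ∀ a,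
    |form z a - (‖a‖ ^ 2 - 1 / 3 * jet.curv a z)| ≤ δ * ‖z‖ ^ 2 * ‖a‖ ^ 2
  half_le_form : ∀ z, ‖z‖ < innerRadius → ∀ a, 1 / 2 * ‖a‖ ^ 2 ≤ form z a
  edist_le : ∀ u v, ‖u‖ < innerRadius → ‖v‖ < innerRadius → ∀ B : ℝ, 0 ≤ B →
    (∀ t ∈ Icc (0 : ℝ) 1, form (u + t • (v - u)) (v - u) ≤ B ^ 2) →
      edist (toFun u) (toFun v) ≤ ENNReal.ofReal B
  le_edist : ∀ (p q : M) (S : ℝ≥0∞) (F : E → ℝ) (B : ℝ), 0 ≤ B → ContDiff ℝ 1 F →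
    Metric.eball p S ⊆ Metric.eball x (ENNReal.ofReal outerRadius) →
    (∀ z ∈ Metric.eball p S, ∀ a, |fderiv ℝ F (inv z) a| ≤ B * √(form (inv z) a)) →
    edist p q < S → ENNReal.ofReal |F (inv q) - F (inv p)| ≤ ENNReal.ofReal B * edist p q

namespace NormalChart

variable {M : Type*} [PseudoEMetricSpace M] {x : M} {E : Type*}
  [NormedAddCommGroup E] [InnerProductSpace ℝ E] [FiniteDimensional ℝ E] (N : NormalChart x E)

lemma inv_self : N.inv x = 0 := by
  have := N.left_inv 0 (by rw [norm_zero]; exact N.innerRadius_pos)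
  rwa [N.map_zero] at this

/-- The coordinates are Lipschitz at the centre. -/
lemma norm_inv_le {p : M} (hp : edist x p < ENNReal.ofReal N.outerRadius) :
    ‖N.inv p‖ ≤ 2 * (edist x p).toReal := by
  rcases eq_or_ne (N.inv p) 0 with h0 | h0
  · rw [h0, norm_zero]
    positivity
  -- The linear function `⟨inv p, ·⟩` grows by `‖inv p‖²` from `x` to `p`. Since the form is at
  -- least half the Euclidean one, its gradient is at most `√2 ‖inv p‖`, rounded up to `2 ‖inv p‖`.
  have h := N.le_edist x p (ENNReal.ofReal N.outerRadius) (innerSL ℝ (N.inv p))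
    (2 * ‖N.inv p‖) (by positivity) (innerSL ℝ (N.inv p)).contDiff subset_rfl ?_ hp
  · rw [N.inv_self, innerSL_apply_apply, innerSL_apply_apply, inner_zero_right, sub_zero,
      real_inner_self_eq_norm_sq, abs_of_nonneg (sq_nonneg _)] at h
    have h2 := ENNReal.toReal_mono
      (ENNReal.mul_ne_top ENNReal.ofReal_ne_top (hp.trans ENNReal.ofReal_lt_top).ne) h
    rw [ENNReal.toReal_ofReal (sq_nonneg _), ENNReal.toReal_mul,
      ENNReal.toReal_ofReal (by positivity)] at h2
    have hpos := norm_pos_iff.2 h0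
    refine le_of_mul_le_mul_left ?_ hpos
    linarith
  · intro z hz a
    rw [ContinuousLinearMap.fderiv, innerSL_apply_apply]
    refine (abs_real_inner_le_norm _ _).trans ?_
    have h1 := N.half_le_form _ (N.norm_inv_lt z hz) a
    have h2 : ‖a‖ ≤ 2 * √(N.form (N.inv z) a) := by
      have : ‖a‖ / 2 ≤ √(N.form (N.inv z) a) := by
        apply Real.le_sqrt_of_sq_le
        nlinarith [sq_nonneg ‖a‖]
      linarith
    calc ‖N.inv p‖ * ‖a‖ ≤ ‖N.inv p‖ * (2 * √(N.form (N.inv z) a)) := by gcongr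
      _ = _ := by ring

/-- The coordinate segment is used as competitor: by `curv_add_smul` the curvature term of its speed
does not vary along it. -/
lemma edist_le_add {δ : ℝ} (hδ : 0 < δ) : ∀ᶠ ρ in 𝓝[>] (0 : ℝ), ∀ u v, ‖u‖ ≤ ρ → ‖v‖ ≤ ρ →
    edist (N.toFun u) (N.toFun v) ≤ ENNReal.ofReal
      (‖v - u‖ - N.jet.curv (v - u) u / (6 * ‖v - u‖) + δ * ρ ^ 2 * ‖v - u‖) := by
  filter_upwards [eventually_forall_norm_le (N.expansion δ hδ) 1,
    eventually_mul_lt 1 N.innerRadius_pos, eventually_mul_sq_le N.jet.curvBound one_pos,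
    self_mem_nhdsWithin] with ρ hexp hr hC hρ u v hu hv
  rw [one_mul] at hr hexp
  have hρ : 0 < ρ := hρ
  set w := v - u with hw
  have hK := N.jet.abs_curv_div_le w u
  have hKρ : N.jet.curvBound * ‖u‖ ^ 2 ≤ 1 := by
    refine le_trans ?_ hC
    have := N.jet.curvBound_nonneg
    gcongr
  have hw0 := norm_nonneg w
  have hB : 0 ≤ ‖w‖ - N.jet.curv w u / (6 * ‖w‖) := by
    have := mul_le_mul_of_nonneg_right hKρ hw0
    linarith [abs_le.1 hK]
  refine N.edist_le u v (hu.trans_lt hr) (hv.trans_lt hr) _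
    (add_nonneg hB (by positivity)) fun t ht ↦ ?_
  have hz : ‖u + t • (v - u)‖ ≤ ρ := by
    have := (convex_closedBall (0 : E) ρ).add_smul_sub_mem (mem_closedBall_zero_iff.2 hu)
      (mem_closedBall_zero_iff.2 hv) ht
    exact mem_closedBall_zero_iff.1 this
  have h1 := (abs_le.1 (hexp _ hz (v - u))).2
  rw [← hw, N.jet.curv_add_smul] at h1
  have h2 : δ * ‖u + t • w‖ ^ 2 * ‖w‖ ^ 2 ≤ δ * ρ ^ 2 * ‖w‖ ^ 2 := by gcongr
  have h3 : ‖w‖ * (N.jet.curv w u / (6 * ‖w‖)) = N.jet.curv w u / 6 := by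
    rcases eq_or_ne w 0 with h | h
    · rw [h]
      have := N.jet.curv_smul_left 0 (0 : E) u
      simp at this
      simp [this]
    · have := norm_pos_iff.2 h
      field_simp
  set y := N.jet.curv w u / (6 * ‖w‖)
  have h4 : 0 ≤ δ * ρ ^ 2 * ‖w‖ ^ 2 := by positivity
  -- The squared speed bound exceeds the required expression by at least this square.
  have h5 := sq_nonneg (y - δ * ρ ^ 2 * ‖w‖)
  nlinarith only [h1, h2, h3, h4, h5]

lemma edist_le_two_mul : ∀ᶠ ρ in 𝓝[>] (0 : ℝ), ∀ u v, ‖u‖ ≤ ρ → ‖v‖ ≤ ρ →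
    edist (N.toFun u) (N.toFun v) ≤ ENNReal.ofReal (2 * ‖v - u‖) := by
  filter_upwards [N.edist_le_add one_pos, eventually_mul_sq_le N.jet.curvBound one_pos,
    eventually_mul_sq_le 1 (by norm_num : (0 : ℝ) < 1 / 2)] with ρ h1 h2 h3 u v hu hv
  refine (h1 u v hu hv).trans (ENNReal.ofReal_le_ofReal ?_)
  have hK := N.jet.abs_curv_div_le (v - u) u
  have hKρ : N.jet.curvBound * ‖u‖ ^ 2 ≤ 1 := by
    refine le_trans ?_ h2
    have := N.jet.curvBound_nonneg
    gcongr
  have hw0 := norm_nonneg (v - u)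
  have h4 := mul_le_mul_of_nonneg_right hKρ hw0
  have h5 := mul_le_mul_of_nonneg_right h3 hw0
  linarith [abs_le.1 hK]

/-- The distance of two points close to the centre. -/
theorem abs_edist_sub_le {δ : ℝ} (hδ : 0 < δ) :
    ∀ᶠ ρ in 𝓝[>] (0 : ℝ), ∀ u v, ‖u‖ ≤ ρ → ‖v‖ ≤ ρ →
      edist (N.toFun u) (N.toFun v) ≠ ⊤ ∧
      |(edist (N.toFun u) (N.toFun v)).toReal -
        (‖v - u‖ - N.jet.curv (v - u) u / (6 * ‖v - u‖))| ≤ δ * ρ ^ 2 * ‖v - u‖ := by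
  -- `784 = 4 · 14²`: the gradient bound at coordinates of norm `14 ρ` is then `1 + δ ρ²/2`, and the
  -- distance is at most `2 ‖w‖`, so the loss is at most `δ ρ² ‖w‖`.
  set δ' := δ / 784 with hδ'
  have hδ'0 : 0 < δ' := by positivity
  filter_upwards [N.edist_le_add hδ, N.edist_le_two_mul,
    eventually_forall_norm_le (N.expansion δ' hδ'0) 14, eventually_mul_lt 1 N.innerRadius_pos,
    eventually_mul_lt 7 N.outerRadius_pos,
    eventually_mul_sq_le (N.jet.curvBound * 14 ^ 2) (by norm_num : (0 : ℝ) < 1 / 10),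
    eventually_mul_sq_le (δ' * 14 ^ 2) (by norm_num : (0 : ℝ) < 1 / 10),
    eventually_mul_sq_le (10 * N.jet.curvBound ^ 2 * 14 ^ 2) hδ'0,
    eventually_mul_sq_le N.jet.curvBound one_pos,
    self_mem_nhdsWithin] with ρ hup hcoarse hexp hr hR hC hδρ hCδ hC1 hρ u v hu hv
  have hρ : 0 < ρ := hρ
  rw [one_mul] at hr
  have hne : edist (N.toFun u) (N.toFun v) ≠ ⊤ :=
    ((hup u v hu hv).trans_lt ENNReal.ofReal_lt_top).ne
  refine ⟨hne, ?_⟩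
  rcases eq_or_ne u v with rfl | huv
  · simp
  set w := v - u with hw
  have hw0 : 0 < ‖w‖ := norm_pos_iff.2 (sub_ne_zero.2 huv.symm)
  have hK := N.jet.abs_curv_div_le w u
  have hKρ : N.jet.curvBound * ‖u‖ ^ 2 ≤ 1 := by
    refine le_trans ?_ hC1
    have := N.jet.curvBound_nonneg
    gcongr
  have hX : 0 ≤ ‖w‖ - N.jet.curv w u / (6 * ‖w‖) := by
    have := mul_le_mul_of_nonneg_right hKρ hw0.le
    linarith [abs_le.1 hK]
  set D := (edist (N.toFun u) (N.toFun v)).toReal with hD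
  have hD1 : D ≤ ‖w‖ - N.jet.curv w u / (6 * ‖w‖) + δ * ρ ^ 2 * ‖w‖ :=
    ENNReal.toReal_le_of_le_ofReal (add_nonneg hX (by positivity)) (hup u v hu hv)
  have hD2 : D ≤ 2 * ‖w‖ :=
    ENNReal.toReal_le_of_le_ofReal (by positivity) (hcoarse u v hu hv)
  have hw2 : ‖w‖ ≤ 2 * ρ := by
    have := norm_sub_le v u
    linarith
  have hxu : edist x (N.toFun u) ≤ ENNReal.ofReal (2 * ρ) := by
    have := hcoarse 0 u (by rw [norm_zero]; exact hρ.le) hu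
    rw [N.map_zero, sub_zero] at this
    exact this.trans (ENNReal.ofReal_le_ofReal (by linarith))
  -- The distance from `u` to `v` is at most `2 ‖w‖ ≤ 4 ρ`, so a ball of radius `5 ρ` suffices for
  -- the Lipschitz estimate. It lies within `7 ρ` of `x`, where coordinates have norm at most `14
  -- ρ`.
  have hball : ∀ z ∈ Metric.eball (N.toFun u) (ENNReal.ofReal (5 * ρ)),
      edist x z < ENNReal.ofReal (7 * ρ) := by
    intro z hz
    rw [Metric.mem_eball, edist_comm] at hz
    calc edist x z ≤ edist x (N.toFun u) + edist (N.toFun u) z := edist_triangle _ _ _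
      _ < ENNReal.ofReal (2 * ρ) + ENNReal.ofReal (5 * ρ) :=
        ENNReal.add_lt_add_of_le_of_lt (hxu.trans_lt ENNReal.ofReal_lt_top).ne hxu hz
      _ = ENNReal.ofReal (7 * ρ) := by
        rw [← ENNReal.ofReal_add (by positivity) (by positivity)]
        congr 1
        ring
  set e := ‖w‖⁻¹ • w with he
  have he1 : ‖e‖ = 1 := by simp [he, norm_smul, hw0.ne']
  set k := 1 + 2 * δ' * (14 * ρ) ^ 2 with hk
  have hk0 : 0 ≤ k := by positivity
  -- Lower bound: by `calibration_sub` the calibration in the direction of `w` increases from `u` to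
  -- `v` by exactly the main term of the expansion.
  have hlow := N.le_edist (N.toFun u) (N.toFun v) (ENNReal.ofReal (5 * ρ)) (N.jet.calibration e)
    k hk0 (N.jet.contDiff_calibration e) (fun z hz ↦ ?_) (fun z hz a ↦ ?_) ?_
  · have hve : v = u + ‖w‖ • e := by
      rw [he, smul_smul, mul_inv_cancel₀ hw0.ne', one_smul, hw]
      abel
    rw [N.left_inv u (hu.trans_lt hr), N.left_inv v (hv.trans_lt hr)] at hlow
    have h1 := N.jet.calibration_sub e u he1 ‖w‖
    rw [← hve, he, N.jet.curv_smul_left, ← he] at h1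
    have h2 : ‖w‖ - 1 / 6 * (‖w‖ * (‖w‖⁻¹ ^ 2 * N.jet.curv w u)) =
        ‖w‖ - N.jet.curv w u / (6 * ‖w‖) := by
      field_simp
    rw [h1, h2, abs_of_nonneg hX] at hlow
    have h3 := ENNReal.toReal_mono (ENNReal.mul_ne_top ENNReal.ofReal_ne_top hne) hlow
    rw [ENNReal.toReal_ofReal hX, ENNReal.toReal_mul, ENNReal.toReal_ofReal hk0, ← hD] at h3
    have h4 : k * D = D + δ / 2 * ρ ^ 2 * D := by
      rw [hk, hδ']
      ring
    have h5 : δ / 2 * ρ ^ 2 * D ≤ δ / 2 * ρ ^ 2 * (2 * ‖w‖) := by gcongr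
    rw [abs_le]
    constructor <;> linarith
  · rw [Metric.mem_eball, edist_comm]
    exact (hball z hz).trans_le (ENNReal.ofReal_le_ofReal hR.le)
  · have hz1 := hball z hz
    have hz2 : ‖N.inv z‖ ≤ 14 * ρ := by
      have h1 := N.norm_inv_le (hz1.trans_le (ENNReal.ofReal_le_ofReal hR.le))
      have h2 : (edist x z).toReal ≤ 7 * ρ :=
        ENNReal.toReal_le_of_le_ofReal (by positivity) hz1.le
      linarith
    have hz3 : ‖N.inv z‖ ^ 2 ≤ (14 * ρ) ^ 2 := by gcongr
    have hCn := N.jet.curvBound_nonneg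
    have h := N.jet.abs_fderiv_calibration_le (z := N.inv z) (a := a) he1 hδ'0
      (by nlinarith only [mul_le_mul_of_nonneg_left hz3 hCn, hC])
      (by nlinarith only [mul_le_mul_of_nonneg_left hz3 hδ'0.le, hδρ])
      (by nlinarith only [mul_le_mul_of_nonneg_left hz3 (sq_nonneg N.jet.curvBound), hCδ])
      (hexp _ hz2 a)
    refine h.trans ?_
    rw [hk]
    gcongr
  · refine (hcoarse u v hu hv).trans_lt ?_
    rw [ENNReal.ofReal_lt_ofReal_iff (by positivity)]
    linarith

end NormalChart

/-! ### Construction of a normal chart at an interior point -/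

namespace RiemannianCoord

variable {n : ℕ} {H : Type*} [TopologicalSpace H]
  (I : ModelWithCorners ℝ (EuclideanSpace ℝ (Fin n)) H)
  {M : Type*} [EMetricSpace M] [ChartedSpace H M] [IsManifold I ∞ M]
  [Bundle.RiemannianBundle (fun x : M ↦ TangentSpace I x)]
  [IsContMDiffRiemannianBundle I ∞ (EuclideanSpace ℝ (Fin n)) (fun x : M ↦ TangentSpace I x)]
  [IsRiemannianManifold I M]

local notation "𝔼" => EuclideanSpace ℝ (Fin n)

/-- Normal coordinates exist at interior points. -/
theorem exists_normalChart (x : M) (hx : I.IsInteriorPoint x) : ∃ N : NormalChart x 𝔼,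
    ∑ b : Fin n, ∑ a : Fin n, N.jet.curv (EuclideanSpace.single a 1)
      (EuclideanSpace.single b 1) = scalarCurvature I x := by
  obtain ⟨L, hL, hscal⟩ := exists_frame I x hx
  set J := frameJet I x hx L with hJ
  have hinj : Function.Injective L := by
    rw [injective_iff_map_eq_zero]
    intro a ha
    have h := hL a a
    rw [frameMetric, pullbackForm_apply, ha, map_zero, real_inner_self_eq_norm_sq] at h
    simpa using h.symm
  let Le : 𝔼 ≃L[ℝ] 𝔼 :=
    (LinearEquiv.ofInjectiveEndo (L : 𝔼 →ₗ[ℝ] 𝔼) hinj).toContinuousLinearEquiv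
  have hLe : (Le : 𝔼 →L[ℝ] 𝔼) = L := by
    ext1 a
    exact congrFun (LinearEquiv.coe_ofInjectiveEndo (L : 𝔼 →ₗ[ℝ] 𝔼) hinj) a
  set y₀ := extChartAt I x x with hy₀
  -- Normal coordinates to chart coordinates: the cubic map, then the affine map adapted to the
  -- orthonormal frame. Its differential at `0` is the invertible `L`, so it has a smooth local
  -- inverse.
  let Ψ : 𝔼 → 𝔼 := fun z ↦ y₀ + L (J.normalMap z)
  have hΨ : ContDiff ℝ ∞ Ψ := contDiff_const.add (L.contDiff.comp J.contDiff_normalMap)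
  have hΨ' (z a : 𝔼) : fderiv ℝ Ψ z a = L (fderiv ℝ J.normalMap z a) := by
    have h1 := (J.contDiff_normalMap.differentiable (by simp) z).hasFDerivAt
    have h2 : HasFDerivAt Ψ _ z := (L.hasFDerivAt.comp z h1).const_add y₀
    rw [h2.fderiv]
    rfl
  have hΨd (z : 𝔼) : HasFDerivAt Ψ (fderiv ℝ Ψ z) z :=
    (hΨ.differentiable (by simp) z).hasFDerivAt
  have hΨ0 : HasFDerivAt Ψ (Le : 𝔼 →L[ℝ] 𝔼) 0 := by
    have h : fderiv ℝ Ψ 0 = (Le : 𝔼 →L[ℝ] 𝔼) := by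
      ext1 a
      rw [hΨ', J.fderiv_normalMap_zero, hLe]
      rfl
    rw [← h]
    exact hΨd 0
  have hΨz : Ψ 0 = y₀ := by simp [Ψ]
  let e := hΨ.contDiffAt.toOpenPartialHomeomorph Ψ hΨ0 (by simp)
  have he : (e : 𝔼 → 𝔼) = Ψ := rfl
  have he0 : (0 : 𝔼) ∈ e.source := hΨ.contDiffAt.mem_toOpenPartialHomeomorph_source hΨ0 (by simp)
  have hey : y₀ ∈ e.target := by
    rw [← hΨz]
    exact hΨ.contDiffAt.image_mem_toOpenPartialHomeomorph_target hΨ0 (by simp)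
  have hes : e.symm y₀ = 0 := by
    rw [← hΨz, ← he]
    exact e.left_inv he0
  have hsymm : ContDiffAt ℝ 1 e.symm y₀ := by
    have := hΨ.contDiffAt.to_localInverse hΨ0 (by simp)
    rw [hΨz] at this
    exact this.of_le (by norm_cast)
  have htarget : (extChartAt I x).target ∈ 𝓝 y₀ := by
    have h := extChartAt_target_mem_nhdsWithin (I := I) x
    have hnhds : range I ∈ 𝓝 y₀ := mem_interior_iff_mem_nhds.1 hx
    rwa [nhdsWithin_eq_nhds.2 hnhds] at h
  have hform : ∀ δ > 0, ∀ᶠ z in 𝓝 (0 : 𝔼), ∀ a,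
      |metricForm I x (Ψ z) (fderiv ℝ Ψ z a) (fderiv ℝ Ψ z a)
        - (‖a‖ ^ 2 - 1 / 3 * J.curv a z)| ≤ δ * ‖z‖ ^ 2 * ‖a‖ ^ 2 := by
    intro δ hδ
    filter_upwards [MetricJet.normalMap_expansion (contDiffAt_frameMetric I x hx L)
      (frameMetric_symm I x L) hL hδ] with z hz a
    have := hz a
    rw [frameMetric, pullbackForm_apply] at this
    rw [hΨ']
    exact this
  have hhalf : ∀ᶠ z in 𝓝 (0 : 𝔼), ∀ a,
      1 / 2 * ‖a‖ ^ 2 ≤ metricForm I x (Ψ z) (fderiv ℝ Ψ z a) (fderiv ℝ Ψ z a) := by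
    -- With `δ = 1` the expansion bounds the form below by `(1 - (1 + curvBound)‖z‖²)‖a‖²`, more
    -- than half of `‖a‖²` here.
    have hsmall : ∀ᶠ z in 𝓝 (0 : 𝔼), (1 + J.curvBound) * ‖z‖ ^ 2 < 1 / 2 := by
      have hc : Continuous fun z : 𝔼 ↦ (1 + J.curvBound) * ‖z‖ ^ 2 := by fun_prop
      exact hc.continuousAt.eventually_lt continuousAt_const (by simp)
    filter_upwards [hform 1 one_pos, hsmall] with z hz hz2 a
    have h1 := abs_le.1 (hz a)
    have h2 := abs_le.1 (J.abs_curv_le a z)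
    have h3 := mul_le_mul_of_nonneg_right hz2.le (sq_nonneg ‖a‖)
    have h4 := mul_nonneg (mul_nonneg J.curvBound_nonneg (sq_nonneg ‖z‖)) (sq_nonneg ‖a‖)
    nlinarith only [h1, h2, h3, h4]
  have hsrc : ∀ᶠ z in 𝓝 (0 : 𝔼), z ∈ e.source ∧ Ψ z ∈ (extChartAt I x).target := by
    refine Filter.Eventually.and (e.open_source.mem_nhds he0) ?_
    have : ContinuousAt Ψ 0 := hΨ.continuous.continuousAt
    rw [ContinuousAt, hΨz] at this
    exact this.eventually htarget
  obtain ⟨r, hr, hball⟩ := Metric.eventually_nhds_iff.1 (hhalf.and hsrc)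
  have hball' (z : 𝔼) (hz : ‖z‖ < r) := hball (y := z) (by rwa [dist_zero_right])
  have hgood : ∀ᶠ y in 𝓝 y₀, y ∈ e.target ∧ ContDiffAt ℝ 1 e.symm y ∧ ‖e.symm y‖ < r := by
    refine Filter.Eventually.and (e.open_target.mem_nhds hey) ((hsymm.eventually (by simp)).and ?_)
    have : ContinuousAt (fun y ↦ ‖e.symm y‖) y₀ := hsymm.continuousAt.norm
    exact this.eventually_lt continuousAt_const (by rw [hes, norm_zero]; exact hr)
  have hgoodM : ∀ᶠ p in 𝓝 x, p ∈ (extChartAt I x).source ∧ (extChartAt I x p ∈ e.target ∧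
      ContDiffAt ℝ 1 e.symm (extChartAt I x p) ∧ ‖e.symm (extChartAt I x p)‖ < r) :=
    Filter.Eventually.and (extChartAt_source_mem_nhds x)
      ((continuousAt_extChartAt x).eventually hgood)
  obtain ⟨R', hR', hR'ball⟩ := EMetric.mem_nhds_iff.1 hgoodM
  obtain ⟨R, hR, hRR'⟩ : ∃ R : ℝ, 0 < R ∧ ENNReal.ofReal R ≤ R' := by
    obtain ⟨s, hs0, hs⟩ := ENNReal.lt_iff_exists_nnreal_btwn.1 hR'
    exact ⟨s, by exact_mod_cast hs0, by rw [ENNReal.ofReal_coe_nnreal]; exact hs.le⟩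
  have hM (p : M) (hp : p ∈ Metric.eball x (ENNReal.ofReal R)) :=
    hR'ball (Metric.eball_subset_eball hRR' hp)
  refine ⟨{
    jet := J
    toFun := fun z ↦ (extChartAt I x).symm (Ψ z)
    inv := fun p ↦ e.symm (extChartAt I x p)
    form := fun z a ↦ metricForm I x (Ψ z) (fderiv ℝ Ψ z a) (fderiv ℝ Ψ z a)
    innerRadius := r
    outerRadius := R
    innerRadius_pos := hr
    outerRadius_pos := hR
    map_zero := by
      rw [hΨz]
      exact extChartAt_to_inv x
    norm_inv_lt := fun p hp ↦ (hM p hp).2.2.2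
    right_inv := fun p hp ↦ by
      have h : Ψ (e.symm (extChartAt I x p)) = extChartAt I x p := e.right_inv (hM p hp).2.1
      rw [h]
      exact (extChartAt I x).left_inv (hM p hp).1
    left_inv := fun u hu ↦ by
      rw [(extChartAt I x).right_inv (hball' u hu).2.2]
      exact e.left_inv (hball' u hu).2.1
    expansion := hform
    half_le_form := fun z hz ↦ (hball' z hz).1
    edist_le := fun u v hu hv B hB hform ↦ ?_
    le_edist := fun p q S F B hB hF hS hd hpq ↦ ?_ }, hscal⟩
  · have hc (t : ℝ) : HasDerivAt (fun t : ℝ ↦ Ψ (u + t • (v - u)))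
        (fderiv ℝ Ψ (u + t • (v - u)) (v - u)) t := by
      have hl : HasDerivAt (fun t : ℝ ↦ u + t • (v - u)) (v - u) t := by
        simpa using ((hasDerivAt_id t).smul_const (v - u)).const_add u
      exact (hΨd _).comp_hasDerivAt t hl
    have hcd : ContDiff ℝ 1 fun t : ℝ ↦ Ψ (u + t • (v - u)) := by
      have : ContDiff ℝ 1 fun t : ℝ ↦ u + t • (v - u) := by fun_prop
      exact (hΨ.of_le (by norm_cast)).comp this
    have h := edist_symm_le I x (B := B) hcd.contDiffOn (fun t ht ↦ ?_) fun t ht ↦ ?_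
    · simpa using h
    · have hz := (convex_ball (0 : 𝔼) r).add_smul_sub_mem (mem_ball_zero_iff.2 hu)
        (mem_ball_zero_iff.2 hv) ht
      exact (hball' _ (mem_ball_zero_iff.1 hz)).2.2
    · rw [(hc t).hasDerivWithinAt.derivWithin (uniqueDiffOn_Icc zero_lt_one t ht)]
      exact Real.sqrt_le_iff.2 ⟨hB, hform t ht⟩
  · refine ofReal_abs_sub_le I x p q (f := F ∘ e.symm) hB (fun z hz ↦ (hM z (hS hz)).1)
      (fun z hz ↦ hF.contDiffAt.comp _ (hM z (hS hz)).2.2.1) (fun z hz a ↦ ?_) hpq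
    obtain ⟨-, hz1, hz2, -⟩ := hM z (hS hz)
    set y := extChartAt I x z
    have hd1 := (hz2.differentiableAt (by simp)).hasFDerivAt
    have hF1 := (hF.differentiable (by simp) (e.symm y)).hasFDerivAt
    have h1 : fderiv ℝ (F ∘ e.symm) y a =
        fderiv ℝ F (e.symm y) (fderiv ℝ e.symm y a) := by
      rw [(hF1.comp y hd1).fderiv]
      rfl
    have hy : Ψ (e.symm y) = y := e.right_inv hz1
    -- The differentials of `Ψ` and of its local inverse are inverse to each other, so the gradient
    -- bound on `F` in normal coordinates is the one on `F ∘ e.symm` in the chart.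
    have h2 : fderiv ℝ Ψ (e.symm y) (fderiv ℝ e.symm y a) = a := by
      have h3 : HasFDerivAt (Ψ ∘ e.symm) (ContinuousLinearMap.id ℝ 𝔼) y := by
        refine (hasFDerivAt_id y).congr_of_eventuallyEq ?_
        filter_upwards [e.open_target.mem_nhds hz1] with y' hy'
        exact e.right_inv hy'
      have h4 := ((hΨd (e.symm y)).comp y hd1).unique h3
      exact congrArg (fun T : 𝔼 →L[ℝ] 𝔼 ↦ T a) h4
    have h3 := hd z hz (fderiv ℝ e.symm y a)
    rw [h2, hy] at h3
    rw [h1]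
    exact h3

end RiemannianCoord

/-! ### Regular simplices maximize the sum of distances -/

section Simplex

lemma sum_sum_eq_two_mul_sum_Ioi {m : ℕ} (f : Fin m → Fin m → ℝ) (hf : ∀ i j, f i j = f j i) :
    ∑ i, ∑ j, f i j = ∑ i, f i i + 2 * ∑ i, ∑ j ∈ Finset.Ioi i, f i j := by
  have h := Finset.sum_sum_Ioi_add_eq_sum_sum_off_diag f
  have h1 (i : Fin m) : ∑ j, f i j = f i i + ∑ j ∈ {i}ᶜ, f j i := by
    rw [← Finset.sum_compl_add_sum {i}, Finset.sum_singleton, add_comm]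
    simp only [hf i]
  simp only [h1, Finset.sum_add_distrib, ← h]
  simp only [← Finset.sum_add_distrib, Finset.mul_sum]
  refine Finset.sum_congr rfl fun i _ ↦ ?_
  rw [add_right_inj]
  exact Finset.sum_congr rfl fun j _ ↦ by rw [hf j i]; ring

lemma sum_card_Ioi (n : ℕ) : ∑ i : Fin (n + 1), ∑ _j ∈ Finset.Ioi i, (1 : ℝ) =
    n * (n + 1) / 2 := by
  have h := sum_sum_eq_two_mul_sum_Ioi (m := n + 1) (fun _ _ ↦ 1) fun _ _ ↦ rfl
  simp only [Finset.sum_const, Finset.card_univ, Fintype.card_fin, nsmul_eq_mul, mul_one] at h ⊢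
  push_cast at h
  linarith

variable {V : Type*} [NormedAddCommGroup V] [InnerProductSpace ℝ V] {n : ℕ}

/-- The sum of the pairwise distances of finitely many points. -/
def sumDist (u : Fin (n + 1) → V) : ℝ := ∑ i, ∑ j ∈ Finset.Ioi i, ‖u j - u i‖

lemma sumDist_smul (t : ℝ) (ht : 0 ≤ t) (u : Fin (n + 1) → V) :
    sumDist (t • u) = t * sumDist u := by
  simp only [sumDist, Pi.smul_apply, ← smul_sub, norm_smul, Real.norm_of_nonneg ht, Finset.mul_sum]

lemma continuous_sumDist : Continuous (sumDist : (Fin (n + 1) → V) → ℝ) := by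
  unfold sumDist
  fun_prop

/-- The edge length of the regular simplex with `n + 1` vertices inscribed in the unit sphere. -/
def simplexEdge (n : ℕ) : ℝ := √(2 * (n + 1) / n)

/-- The sum of the edge lengths of the regular simplex with `n + 1` vertices inscribed in the unit
sphere. -/
def simplexSum (n : ℕ) : ℝ := n * (n + 1) / 2 * simplexEdge n

lemma simplexEdge_sq (n : ℕ) : simplexEdge n ^ 2 = 2 * (n + 1) / n :=
  Real.sq_sqrt (by positivity)

lemma simplexEdge_pos (hn : 0 < n) : 0 < simplexEdge n := by
  unfold simplexEdge
  positivity

lemma simplexSum_pos (hn : 0 < n) : 0 < simplexSum n := by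
  have := simplexEdge_pos hn
  unfold simplexSum
  positivity

lemma sum_norm_sub_sq (u : Fin (n + 1) → V) :
    ∑ i, ∑ j ∈ Finset.Ioi i, ‖u j - u i‖ ^ 2 =
      (n + 1) * ∑ i, ‖u i‖ ^ 2 - ‖∑ i, u i‖ ^ 2 := by
  have h := sum_sum_eq_two_mul_sum_Ioi (fun i j ↦ ‖u j - u i‖ ^ 2) fun i j ↦ by
    rw [norm_sub_rev]
  simp only [sub_self, norm_zero, ne_eq, OfNat.ofNat_ne_zero, not_false_eq_true, zero_pow,
    Finset.sum_const_zero, zero_add] at h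
  have h2 : ‖∑ i, u i‖ ^ 2 = ∑ i, ∑ j, ⟪u i, u j⟫ := by
    rw [← real_inner_self_eq_norm_sq, sum_inner]
    simp only [inner_sum]
  have h3 : ∑ i, ∑ j, ‖u j - u i‖ ^ 2 =
      2 * ((n + 1) * ∑ i, ‖u i‖ ^ 2) - 2 * ∑ i, ∑ j, ⟪u i, u j⟫ := by
    have h4 (i j : Fin (n + 1)) : ‖u j - u i‖ ^ 2 = ‖u j‖ ^ 2 - 2 * ⟪u i, u j⟫ + ‖u i‖ ^ 2 := by
      rw [norm_sub_sq_real, real_inner_comm]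
    simp only [h4, Finset.sum_add_distrib, Finset.sum_sub_distrib, Finset.sum_const,
      Finset.card_univ, Fintype.card_fin, nsmul_eq_mul, ← Finset.mul_sum]
    push_cast
    ring
  rw [h2]
  linarith

/-- Expand the squares about the expected edge length and insert `sum_norm_sub_sq`. In the unit ball
every term on the right is nonnegative, so one identity yields both the maximum and all its equality
cases. -/
lemma simplexSum_sub_sumDist (hn : 0 < n) (u : Fin (n + 1) → V) :
    2 * simplexEdge n * (simplexSum n - sumDist u) =
      ∑ i, ∑ j ∈ Finset.Ioi i, (‖u j - u i‖ - simplexEdge n) ^ 2 +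
        ((n + 1) * ∑ i, (1 - ‖u i‖ ^ 2) + ‖∑ i, u i‖ ^ 2) := by
  have h1 := sum_norm_sub_sq u
  have h2 : ∑ i, ∑ j ∈ Finset.Ioi i, (‖u j - u i‖ - simplexEdge n) ^ 2 =
      ∑ i, ∑ j ∈ Finset.Ioi i, ‖u j - u i‖ ^ 2 - 2 * simplexEdge n * sumDist u +
        simplexEdge n ^ 2 * ∑ i : Fin (n + 1), ∑ _j ∈ Finset.Ioi i, (1 : ℝ) := by
    simp only [sumDist, Finset.mul_sum, ← Finset.sum_sub_distrib, ← Finset.sum_add_distrib]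
    exact Finset.sum_congr rfl fun i _ ↦ Finset.sum_congr rfl fun j _ ↦ by ring
  rw [h2, h1, sum_card_Ioi, simplexSum]
  simp only [Finset.sum_sub_distrib, Finset.sum_const, Finset.card_univ, Fintype.card_fin,
    nsmul_eq_mul]
  have h3 := simplexEdge_sq n
  have hn' : (n : ℝ) ≠ 0 := by positivity
  have h4 : n * simplexEdge n ^ 2 = 2 * (n + 1) := by
    rw [h3]
    field_simp
  push_cast
  linear_combination (n + 1) / 2 * h4

/-- The regular simplices maximize the sum of the distances of `n + 1` points of the unit ball. -/
lemma sumDist_le (hn : 0 < n) {u : Fin (n + 1) → V} (hu : ∀ i, ‖u i‖ ≤ 1) :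
    sumDist u ≤ simplexSum n := by
  have h := simplexSum_sub_sumDist hn u
  have h1 : 0 ≤ 2 * simplexEdge n * (simplexSum n - sumDist u) := by
    rw [h]
    have : ∀ i, 0 ≤ 1 - ‖u i‖ ^ 2 := fun i ↦ by
      have := norm_nonneg (u i)
      nlinarith [hu i]
    have := Finset.sum_nonneg fun i (_ : i ∈ Finset.univ) ↦ this i
    positivity
  have h2 := simplexEdge_pos hn
  exact sub_nonneg.1 (nonneg_of_mul_nonneg_right h1 (by positivity))

/-- A family of points whose sum of distances is maximal is a regular simplex. -/
lemma inner_of_sumDist_eq (hn : 0 < n) {u : Fin (n + 1) → V} (hu : ∀ i, ‖u i‖ ≤ 1)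
    (h : sumDist u = simplexSum n) :
    (∀ i, ‖u i‖ = 1) ∧ (∀ i j, i ≠ j → ‖u j - u i‖ = simplexEdge n) ∧
      ∀ i j, i ≠ j → ⟪u i, u j⟫ = -1 / n := by
  have h0 := simplexSum_sub_sumDist hn u
  rw [h, sub_self, mul_zero] at h0
  have h1 : ∀ i, 0 ≤ 1 - ‖u i‖ ^ 2 := fun i ↦ by
    have := norm_nonneg (u i)
    nlinarith [hu i]
  have h2 : 0 ≤ ∑ i, (1 - ‖u i‖ ^ 2) := Finset.sum_nonneg fun i _ ↦ h1 i
  have h3 : 0 ≤ ∑ i, ∑ j ∈ Finset.Ioi i, (‖u j - u i‖ - simplexEdge n) ^ 2 := by positivity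
  have h4 : 0 ≤ ‖∑ i, u i‖ ^ 2 := by positivity
  have h5 : 0 ≤ (n + 1 : ℝ) * ∑ i, (1 - ‖u i‖ ^ 2) := by positivity
  have h6 : ∑ i, (1 - ‖u i‖ ^ 2) = 0 := by
    have : (n + 1 : ℝ) * ∑ i, (1 - ‖u i‖ ^ 2) = 0 := by linarith
    exact (mul_eq_zero.1 this).resolve_left (by positivity)
  have h7 : ∑ i, ∑ j ∈ Finset.Ioi i, (‖u j - u i‖ - simplexEdge n) ^ 2 = 0 := by linarith
  have hnorm : ∀ i, ‖u i‖ = 1 := fun i ↦ by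
    have := (Finset.sum_eq_zero_iff_of_nonneg fun i _ ↦ h1 i).1 h6 i (Finset.mem_univ i)
    have h8 : ‖u i‖ ^ 2 = 1 := by linarith
    exact (pow_eq_one_iff_of_nonneg (norm_nonneg _) two_ne_zero).1 h8
  have hlt : ∀ i j, i < j → ‖u j - u i‖ = simplexEdge n := fun i j hij ↦ by
    have h8 := (Finset.sum_eq_zero_iff_of_nonneg fun i _ ↦
      Finset.sum_nonneg fun j _ ↦ sq_nonneg (‖u j - u i‖ - simplexEdge n)).1 h7 i
        (Finset.mem_univ i)
    have h9 := (Finset.sum_eq_zero_iff_of_nonneg fun j _ ↦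
      sq_nonneg (‖u j - u i‖ - simplexEdge n)).1 h8 j (Finset.mem_Ioi.2 hij)
    exact sub_eq_zero.1 (pow_eq_zero_iff two_ne_zero |>.1 h9)
  have hne : ∀ i j, i ≠ j → ‖u j - u i‖ = simplexEdge n := fun i j hij ↦ by
    rcases lt_or_gt_of_ne hij with h | h
    · exact hlt i j h
    · rw [norm_sub_rev]
      exact hlt j i h
  refine ⟨hnorm, hne, fun i j hij ↦ ?_⟩
  have h8 := norm_sub_sq_real (u j) (u i)
  rw [hne i j hij, hnorm, hnorm, simplexEdge_sq, real_inner_comm] at h8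
  have hn' : (n : ℝ) ≠ 0 := by positivity
  field_simp at h8 ⊢
  linarith

/-- A regular simplex inscribed in the unit sphere. -/
lemma exists_sumDist_eq (hn : 0 < n) : ∃ u : Fin (n + 1) → EuclideanSpace ℝ (Fin n),
    (∀ i, ‖u i‖ ≤ 1) ∧ sumDist u = simplexSum n := by
  have hn' : (n : ℝ) ≠ 0 := by positivity
  let o : EuclideanSpace ℝ (Fin n) := WithLp.toLp 2 fun _ ↦ 1
  let e (i : Fin n) : EuclideanSpace ℝ (Fin n) := EuclideanSpace.single i 1
  set α : ℝ := √((n + 1) / n) with hα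
  set γ : ℝ := √(1 / n) with hγ
  have hα2 : α ^ 2 = (n + 1) / n := Real.sq_sqrt (by positivity)
  have hγ2 : γ ^ 2 = 1 / n := Real.sq_sqrt (by positivity)
  -- Chosen so that the first `n` vertices `α e_i + β o` sum to `γ o`, the negative of the last
  -- vertex; the simplex is then centred at `0`.
  set β : ℝ := (γ - α) / n with hβ
  have hnβ : n * β = γ - α := by rw [hβ]; field_simp
  have hoo : ⟪o, o⟫ = n := by
    rw [PiLp.inner_apply]
    simp [o]
  have heo (i : Fin n) : ⟪e i, o⟫ = 1 := by simp [e, o, EuclideanSpace.inner_single_left]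
  have hee (i j : Fin n) : ⟪e i, e j⟫ = if i = j then 1 else 0 := by
    simp only [e]
    rw [EuclideanSpace.inner_single_left]
    simp
  let v (i : Fin n) : EuclideanSpace ℝ (Fin n) := α • e i + β • o
  have hvv (i j : Fin n) : ⟪v i, v j⟫ = (if i = j then (n + 1 : ℝ) / n else 0) - 1 / n := by
    simp only [v, inner_add_left, inner_add_right, real_inner_smul_left, real_inner_smul_right,
      hoo, heo, hee, real_inner_comm (e _) o]
    have h1 : n * (2 * α * β + n * β ^ 2) = -1 := by
      have : n * (2 * α * β + n * β ^ 2) = γ ^ 2 - α ^ 2 := by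
        linear_combination (2 * α + n * β + (γ - α)) * hnβ
      rw [this, hγ2, hα2]
      field_simp
      ring
    have h2 : 2 * α * β + n * β ^ 2 = -1 / n := by
      field_simp
      linarith
    split_ifs
    · linear_combination h2 + hα2
    · linear_combination h2
  have hvo (i : Fin n) : ⟪v i, -γ • o⟫ = -1 / n := by
    simp only [v, inner_add_left, real_inner_smul_left, real_inner_smul_right, hoo, heo]
    have h1 : γ * (α + n * β) = 1 / n := by rw [hnβ, ← hγ2]; ring
    linear_combination -h1
  have hww : ⟪-γ • o, -γ • o⟫ = (1 : ℝ) := by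
    simp only [real_inner_smul_left, real_inner_smul_right, hoo]
    have : n * γ ^ 2 = 1 := by rw [hγ2]; field_simp
    linear_combination this
  let u : Fin (n + 1) → EuclideanSpace ℝ (Fin n) := Fin.lastCases (-γ • o) v
  have hul : u (Fin.last n) = -γ • o := Fin.lastCases_last
  have huc (i : Fin n) : u i.castSucc = v i := Fin.lastCases_castSucc i
  have huu (i j : Fin (n + 1)) : ⟪u i, u j⟫ = if i = j then (1 : ℝ) else -1 / n := by
    induction i using Fin.lastCases with
    | last =>
      induction j using Fin.lastCases with
      | last => rw [hul, hww, if_pos rfl]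
      | cast j => rw [hul, huc, real_inner_comm, hvo, if_neg (Fin.castSucc_lt_last j).ne']
    | cast i =>
      induction j using Fin.lastCases with
      | last => rw [hul, huc, hvo, if_neg (Fin.castSucc_lt_last i).ne]
      | cast j =>
        rw [huc, huc, hvv]
        simp only [Fin.castSucc_inj]
        split_ifs
        · field_simp
          ring
        · ring
  have hnorm (i : Fin (n + 1)) : ‖u i‖ = 1 := by
    have := huu i i
    rw [if_pos rfl, real_inner_self_eq_norm_sq] at this
    exact (pow_eq_one_iff_of_nonneg (norm_nonneg _) two_ne_zero).1 this
  refine ⟨u, fun i ↦ (hnorm i).le, ?_⟩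
  have hd (i j : Fin (n + 1)) (hij : i < j) : ‖u j - u i‖ = simplexEdge n := by
    rw [simplexEdge, ← Real.sqrt_sq (norm_nonneg (u j - u i)), norm_sub_sq_real, hnorm, hnorm, huu,
      if_neg hij.ne']
    congr 1
    field_simp
    ring
  calc sumDist u = ∑ i : Fin (n + 1), ∑ _j ∈ Finset.Ioi i, 1 * simplexEdge n :=
      Finset.sum_congr rfl fun i _ ↦ Finset.sum_congr rfl fun j hj ↦ by
        rw [hd i j (Finset.mem_Ioi.1 hj), one_mul]
    _ = simplexSum n := by
      simp only [← Finset.sum_mul]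
      rw [sum_card_Ioi, simplexSum]

/-- The vertices of a regular simplex form a tight frame. -/
lemma sum_mul_of_inner (hn : 0 < n) {u : Fin (n + 1) → EuclideanSpace ℝ (Fin n)}
    (h1 : ∀ i, ‖u i‖ = 1) (h2 : ∀ i j, i ≠ j → ⟪u i, u j⟫ = -1 / n) (a b : Fin n) :
    ∑ s, u s a * u s b = if a = b then (n + 1 : ℝ) / n else 0 := by
  have hn' : (n : ℝ) ≠ 0 := by positivity
  set κ : ℝ := (n + 1) / n with hκ
  let S (a b : Fin n) : ℝ := ∑ s, u s a * u s b
  have hin (s t : Fin (n + 1)) : ⟪u s, u t⟫ = ∑ a, u s a * u t a := by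
    rw [PiLp.inner_apply]
    exact Finset.sum_congr rfl fun a _ ↦ by simp [mul_comm]
  have htr : ∑ a, S a a = n + 1 := by
    simp only [S]
    rw [Finset.sum_comm]
    simp only [← hin, real_inner_self_eq_norm_sq, h1]
    simp
  have hsq : ∑ a, ∑ b, S a b ^ 2 = (n + 1) ^ 2 / n := by
    have h3 : ∑ a, ∑ b, S a b ^ 2 = ∑ s, ∑ t, ⟪u s, u t⟫ ^ 2 := by
      simp only [S, hin, sq, Finset.sum_mul_sum]
      calc _ = ∑ a, ∑ s, ∑ b, ∑ t, u s a * u s b * (u t a * u t b) :=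
            Finset.sum_congr rfl fun a _ ↦ Finset.sum_comm
        _ = ∑ s, ∑ a, ∑ b, ∑ t, u s a * u s b * (u t a * u t b) := Finset.sum_comm
        _ = ∑ s, ∑ a, ∑ t, ∑ b, u s a * u s b * (u t a * u t b) :=
            Finset.sum_congr rfl fun s _ ↦ Finset.sum_congr rfl fun a _ ↦ Finset.sum_comm
        _ = ∑ s, ∑ t, ∑ a, ∑ b, u s a * u s b * (u t a * u t b) :=
            Finset.sum_congr rfl fun s _ ↦ Finset.sum_comm
        _ = _ := Finset.sum_congr rfl fun s _ ↦ Finset.sum_congr rfl fun t _ ↦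
            Finset.sum_congr rfl fun a _ ↦ Finset.sum_congr rfl fun b _ ↦ by ring
    have h4 (s t : Fin (n + 1)) : ⟪u s, u t⟫ ^ 2 =
        1 / n ^ 2 + if s = t then 1 - 1 / (n : ℝ) ^ 2 else 0 := by
      split_ifs with h
      · rw [h, real_inner_self_eq_norm_sq, h1]
        ring
      · rw [h2 s t h]
        ring
    rw [h3]
    simp only [h4, Finset.sum_add_distrib, Finset.sum_const, Finset.card_univ, Fintype.card_fin,
      nsmul_eq_mul, Finset.sum_ite_eq, Finset.mem_univ, if_true]
    push_cast
    field_simp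
    ring
  -- The matrix `S` has trace `n + 1` and squared Frobenius norm `(n + 1)²/n`, the equality case of
  -- Cauchy–Schwarz; hence `S - κ · 1` has Frobenius norm zero.
  have hzero : ∑ a, ∑ b, (S a b - if a = b then κ else 0) ^ 2 = 0 := by
    have h5 (a b : Fin n) : (S a b - if a = b then κ else 0) ^ 2 =
        S a b ^ 2 + if a = b then κ ^ 2 - 2 * κ * S a a else 0 := by
      split_ifs with h
      · rw [h]
        ring
      · ring
    simp only [h5, Finset.sum_add_distrib, Finset.sum_ite_eq, Finset.mem_univ, if_true,
      Finset.sum_sub_distrib, hsq, ← Finset.mul_sum, htr, Finset.sum_const, Finset.card_univ,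
      Fintype.card_fin, nsmul_eq_mul]
    rw [hκ]
    field_simp
    ring
  have h6 := (Finset.sum_eq_zero_iff_of_nonneg fun a _ ↦
    Finset.sum_nonneg fun b _ ↦ sq_nonneg (S a b - if a = b then κ else 0)).1 hzero a
      (Finset.mem_univ a)
  have h7 := (Finset.sum_eq_zero_iff_of_nonneg fun b _ ↦
    sq_nonneg (S a b - if a = b then κ else 0)).1 h6 b (Finset.mem_univ b)
  exact sub_eq_zero.1 (pow_eq_zero_iff two_ne_zero |>.1 h7)

end Simplex

/-! ### The perturbed extremal problem -/

namespace MetricJet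

variable {n : ℕ} (J : MetricJet (EuclideanSpace ℝ (Fin n)))

local notation "𝔼" => EuclideanSpace ℝ (Fin n)

/-- The scalar curvature of the jet. -/
def scal : ℝ :=
  ∑ b : Fin n, ∑ a : Fin n, J.curv (EuclideanSpace.single a 1) (EuclideanSpace.single b 1)

/-- The leading correction to the sum of the pairwise distances of finitely many points. -/
def sumCurv (u : Fin (n + 1) → 𝔼) : ℝ :=
  ∑ i, ∑ j ∈ Finset.Ioi i, J.curv (u j - u i) (u i) / (6 * ‖u j - u i‖)

lemma sumCurv_smul {t : ℝ} (ht : 0 < t) (u : Fin (n + 1) → 𝔼) :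
    J.sumCurv (t • u) = t ^ 3 * J.sumCurv u := by
  simp only [sumCurv, Pi.smul_apply, ← smul_sub, norm_smul, Real.norm_of_nonneg ht.le,
    Finset.mul_sum, curv_smul_left, curv_smul_right]
  refine Finset.sum_congr rfl fun i _ ↦ Finset.sum_congr rfl fun j _ ↦ ?_
  rw [show 6 * (t * ‖u j - u i‖) = t * (6 * ‖u j - u i‖) by ring,
    show t ^ 2 * (t ^ 2 * J.curv (u j - u i) (u i)) =
      t * (t ^ 3 * J.curv (u j - u i) (u i)) by ring,
    mul_div_mul_left _ _ ht.ne', mul_div_assoc]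

/-- Continuity of `sumCurv` is shown only at families of distinct points. Elsewhere this bound is
enough, since a family with coincident points is not a maximizer. -/
lemma abs_sumCurv_le {u : Fin (n + 1) → 𝔼} (hu : ∀ i, ‖u i‖ ≤ 1) :
    |J.sumCurv u| ≤ J.curvBound / 6 * sumDist u := by
  rw [sumCurv, sumDist, Finset.mul_sum]
  refine (Finset.abs_sum_le_sum_abs _ _).trans (Finset.sum_le_sum fun i _ ↦ ?_)
  rw [Finset.mul_sum]
  refine (Finset.abs_sum_le_sum_abs _ _).trans (Finset.sum_le_sum fun j _ ↦ ?_)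
  refine (J.abs_curv_div_le _ _).trans ?_
  have h1 : ‖u i‖ ^ 2 ≤ 1 := pow_le_one₀ (norm_nonneg _) (hu i)
  have h2 := mul_le_mul_of_nonneg_left h1 J.curvBound_nonneg
  have h3 := mul_le_mul_of_nonneg_right h2 (norm_nonneg (u j - u i))
  linarith

lemma curv_sub_left (a u : 𝔼) : J.curv (a - u) u = J.curv a u := by
  have h := J.curv_add_smul u a (-1)
  rwa [neg_one_smul, ← sub_eq_add_neg, curv_symm, J.curv_symm u] at h

/-- The sum of the curvature form over a tight frame. -/
lemma sum_sum_curv {ι : Type*} [Fintype ι] {κ : ℝ} {u : ι → 𝔼}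
    (hu : ∀ a b, ∑ s, u s a * u s b = if a = b then κ else 0) :
    ∑ s, ∑ t, J.curv (u s) (u t) = κ ^ 2 * J.scal := by
  have h1 (w : 𝔼) : ∑ s, J.curv (u s) w =
      κ * ∑ a : Fin n, J.curv (EuclideanSpace.single a 1) w := by
    obtain ⟨B, hB⟩ := J.exists_curv_eq w
    have h := sum_frame_eq (fun a b ↦ if a = b then κ else 0) u (fun a b ↦ (hu a b).symm) B
    simp only [hB, ← h, ite_mul, zero_mul, Finset.sum_ite_eq, Finset.mem_univ, if_true,
      Finset.mul_sum]
  rw [Finset.sum_comm]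
  simp only [h1, ← Finset.mul_sum]
  rw [Finset.sum_comm]
  simp only [J.curv_symm (EuclideanSpace.single _ 1) (u _), h1, ← Finset.mul_sum]
  rw [scal, sq, mul_assoc]

/-- All edges have length `L = simplexEdge n`, and `K(u j - u i, u i) = K(u j, u i)`. Hence the sum
is half the full double sum divided by `6 L`, that is `((n + 1)/n)² scal/(12 L)` by the tight frame
property; then `n L² = 2 (n + 1)`. The value is the same for every maximizer. -/
lemma sumCurv_eq (hn : 0 < n) {u : Fin (n + 1) → 𝔼} (hu : ∀ i, ‖u i‖ ≤ 1)
    (h : sumDist u = simplexSum n) :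
    J.sumCurv u = simplexSum n / (12 * n ^ 2) * J.scal := by
  obtain ⟨h1, h2, h3⟩ := inner_of_sumDist_eq hn hu h
  have hsum := J.sum_sum_curv (sum_mul_of_inner hn h1 h3)
  have hL := simplexEdge_pos hn
  have hn' : (n : ℝ) ≠ 0 := by positivity
  have h4 := sum_sum_eq_two_mul_sum_Ioi (fun i j ↦ J.curv (u i) (u j)) fun i j ↦ J.curv_symm _ _
  simp only [curv_self, Finset.sum_const_zero, zero_add] at h4
  have h5 : J.sumCurv u = (∑ i, ∑ j ∈ Finset.Ioi i, J.curv (u i) (u j)) / (6 * simplexEdge n) := by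
    simp only [sumCurv, Finset.sum_div]
    refine Finset.sum_congr rfl fun i _ ↦ Finset.sum_congr rfl fun j hj ↦ ?_
    rw [h2 i j (Finset.mem_Ioi.1 hj).ne, curv_sub_left, curv_symm]
  have h6 : ∑ i, ∑ j ∈ Finset.Ioi i, J.curv (u i) (u j) = ((n + 1) / n) ^ 2 * J.scal / 2 := by
    linarith
  have h7 : n * simplexEdge n ^ 2 = 2 * (n + 1) := by
    rw [simplexEdge_sq]
    field_simp
  rw [h5, h6, simplexSum, div_eq_iff (by positivity)]
  field_simp
  linear_combination (-6 * J.scal) * h7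

lemma continuousAt_sumCurv {u : Fin (n + 1) → 𝔼} (hu : ∀ i j, i ≠ j → u j - u i ≠ 0) :
    ContinuousAt J.sumCurv u := by
  unfold sumCurv
  refine tendsto_finsetSum _ fun i _ ↦ tendsto_finsetSum _ fun j hj ↦ ?_
  have h1 : Continuous fun u : Fin (n + 1) → 𝔼 ↦ J.curv (u j - u i) (u i) :=
    J.continuous_curv.comp (f := fun u : Fin (n + 1) → 𝔼 ↦ (u j - u i, u i)) (by fun_prop)
  have h2 : Continuous fun u : Fin (n + 1) → 𝔼 ↦ 6 * ‖u j - u i‖ := by fun_prop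
  have h3 := norm_pos_iff.2 (hu i j (Finset.mem_Ioi.1 hj).ne)
  exact h1.continuousAt.div h2.continuousAt (by positivity)

/-- Among families of points of the unit ball, regular simplices maximize the perturbed sum of
distances up to higher order terms. -/
lemma eventually_sumDist_sub_le (hn : 0 < n) {η : ℝ} (hη : 0 < η) :
    ∀ᶠ t in 𝓝[>] (0 : ℝ), ∀ u : Fin (n + 1) → 𝔼, (∀ i, ‖u i‖ ≤ 1) →
      sumDist u - t * J.sumCurv u ≤
        simplexSum n - t * (simplexSum n / (12 * n ^ 2) * J.scal - η) := by
  set G := simplexSum n / (12 * n ^ 2) * J.scal with hG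
  have hcomp : IsCompact (Metric.closedBall (0 : Fin (n + 1) → 𝔼) 1) := isCompact_closedBall _ _
  have hmem (u : Fin (n + 1) → 𝔼) : u ∈ Metric.closedBall 0 1 ↔ ∀ i, ‖u i‖ ≤ 1 := by
    rw [mem_closedBall_zero_iff, pi_norm_le_iff_of_nonneg zero_le_one]
  have key : ∀ᶠ t in 𝓝 (0 : ℝ), ∀ u ∈ Metric.closedBall (0 : Fin (n + 1) → 𝔼) 1, 0 < t →
      (∀ i, ‖u i‖ ≤ 1) → sumDist u - t * J.sumCurv u ≤ simplexSum n - t * (G - η) := by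
    -- By compactness it suffices to bound the functional for `(t, u)` near `(0, u₀)`, for each `u₀`
    -- in the ball.
    refine hcomp.eventually_forall_of_forall_eventually fun u₀ hu₀ ↦ ?_
    rw [hmem] at hu₀
    rcases (sumDist_le hn hu₀).lt_or_eq with hlt | heq
    -- At a family that is not maximal, the strict gap in `sumDist` outweighs the bounded
    -- perturbation once `t` is small.
    · set b := J.curvBound / 6 * simplexSum n with hb
      have hb0 : 0 ≤ b := by
        have := J.curvBound_nonneg
        have := (simplexSum_pos hn).le
        positivity
      have h1 : ∀ᶠ p : ℝ × (Fin (n + 1) → 𝔼) in 𝓝 (0, u₀),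
          sumDist p.2 + p.1 * (b + |G|) < simplexSum n := by
        have hc : Continuous fun p : ℝ × (Fin (n + 1) → 𝔼) ↦ sumDist p.2 + p.1 * (b + |G|) := by
          have := (continuous_sumDist (V := 𝔼) (n := n)).comp
            (continuous_snd (X := ℝ) (Y := Fin (n + 1) → 𝔼))
          exact this.add (by fun_prop)
        exact hc.continuousAt.eventually_lt continuousAt_const (by simpa using hlt)
      filter_upwards [h1] with p hp ht hu
      have h2 := J.abs_sumCurv_le hu
      have h3 : |J.sumCurv p.2| ≤ b := h2.trans
        (mul_le_mul_of_nonneg_left (sumDist_le hn hu)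
          (div_nonneg J.curvBound_nonneg (by norm_num)))
      have h4 := mul_le_mul_of_nonneg_left (neg_le_of_abs_le h3) ht.le
      have h5 := mul_le_mul_of_nonneg_left (le_abs_self G) ht.le
      have h6 := mul_pos ht hη
      linarith
    -- At a maximizer `sumCurv` is continuous with value `G`, so nearby it exceeds `G - η`, while
    -- `sumDist` never exceeds its maximum.
    · have h1 : J.sumCurv u₀ = G := J.sumCurv_eq hn hu₀ heq
      obtain ⟨-, h2, -⟩ := inner_of_sumDist_eq hn hu₀ heq
      have h3 : ContinuousAt J.sumCurv u₀ := J.continuousAt_sumCurv fun i j hij ↦ by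
        rw [← norm_pos_iff, h2 i j hij]
        exact simplexEdge_pos hn
      have h4 : ∀ᶠ u in 𝓝 u₀, G - η < J.sumCurv u :=
        h3.eventually (lt_mem_nhds (by rw [h1]; linarith))
      have h5 : ∀ᶠ p : ℝ × (Fin (n + 1) → 𝔼) in 𝓝 (0, u₀), G - η < J.sumCurv p.2 :=
        (continuous_snd.tendsto (0, u₀)).eventually h4
      filter_upwards [h5] with p hp ht hu
      have h6 := mul_le_mul_of_nonneg_left hp.le ht.le
      have h7 := sumDist_le hn hu
      linarith
  filter_upwards [nhdsWithin_le_nhds key, self_mem_nhdsWithin] with t ht ht0 u hu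
  exact ht u ((hmem u).2 hu) ht0 hu

end MetricJet

/-! ### From extents to suprema of sums; the Euclidean ball -/

section Sums

/-- The supremum of the sums of the pairwise distances of `q` points. -/
def supSum (q : ℕ) (X : Type*) [PseudoEMetricSpace X] : ℝ≥0∞ :=
  ⨆ p : Fin q → X, ∑ i, ∑ j ∈ Finset.Ioi i, edist (p i) (p j)

lemma sum_edist_eq_ofReal {q : ℕ} {X : Type*} [PseudoEMetricSpace X] {p : Fin q → X}
    (h : ∀ i j, edist (p i) (p j) ≠ ⊤) :
    ∑ i, ∑ j ∈ Finset.Ioi i, edist (p i) (p j) =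
      ENNReal.ofReal (∑ i, ∑ j ∈ Finset.Ioi i, (edist (p i) (p j)).toReal) := by
  rw [ENNReal.ofReal_sum_of_nonneg fun i _ ↦ Finset.sum_nonneg fun j _ ↦ ENNReal.toReal_nonneg]
  refine Finset.sum_congr rfl fun i _ ↦ ?_
  rw [ENNReal.ofReal_sum_of_nonneg fun j _ ↦ ENNReal.toReal_nonneg]
  exact Finset.sum_congr rfl fun j _ ↦ (ENNReal.ofReal_toReal (h i j)).symm

lemma toReal_extent_div {q : ℕ} (hq : 2 ≤ q) (X Y : Type*) [PseudoEMetricSpace X]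
    [PseudoEMetricSpace Y] :
    (extent q X).toReal / (extent q Y).toReal = (supSum q X).toReal / (supSum q Y).toReal := by
  have hc : (0 : ℝ) < q.choose 2 := by exact_mod_cast Nat.choose_pos hq
  rw [extent, extent, ENNReal.toReal_mul, ENNReal.toReal_mul, ENNReal.toReal_inv,
    ENNReal.toReal_natCast, mul_div_mul_left _ _ (inv_ne_zero hc.ne')]
  rfl

lemma toReal_supSum_euclidean {n : ℕ} (hn : 0 < n) {ε : ℝ} (hε : 0 < ε) :
    (supSum (n + 1) (Metric.closedEBall (0 : EuclideanSpace ℝ (Fin n))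
      (ENNReal.ofReal ε))).toReal = ε * simplexSum n := by
  have hsum (p : Fin (n + 1) → EuclideanSpace ℝ (Fin n)) :
      ∑ i, ∑ j ∈ Finset.Ioi i, edist (p i) (p j) = ENNReal.ofReal (sumDist p) := by
    rw [sum_edist_eq_ofReal fun i j ↦ edist_ne_top _ _]
    congr 1
    refine Finset.sum_congr rfl fun i _ ↦ Finset.sum_congr rfl fun j _ ↦ ?_
    rw [edist_dist, ENNReal.toReal_ofReal dist_nonneg, dist_comm, dist_eq_norm]
  have hmem (y : EuclideanSpace ℝ (Fin n)) :
      y ∈ Metric.closedEBall 0 (ENNReal.ofReal ε) ↔ ‖y‖ ≤ ε := by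
    rw [Metric.mem_closedEBall, edist_dist, ENNReal.ofReal_le_ofReal_iff hε.le, dist_zero_right]
  have hpos := (mul_pos hε (simplexSum_pos hn)).le
  have heq : supSum (n + 1) (Metric.closedEBall (0 : EuclideanSpace ℝ (Fin n))
      (ENNReal.ofReal ε)) = ENNReal.ofReal (ε * simplexSum n) := by
    refine le_antisymm (iSup_le fun p ↦ ?_) ?_
    · change ∑ i, ∑ j ∈ Finset.Ioi i, edist (p i : EuclideanSpace ℝ (Fin n)) (p j) ≤ _
      rw [hsum fun i ↦ (p i : EuclideanSpace ℝ (Fin n))]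
      refine ENNReal.ofReal_le_ofReal ?_
      set v : Fin (n + 1) → EuclideanSpace ℝ (Fin n) := fun i ↦ p i
      have hv : v = ε • (ε⁻¹ • v) := by rw [smul_smul, mul_inv_cancel₀ hε.ne', one_smul]
      rw [hv, sumDist_smul ε hε.le]
      refine mul_le_mul_of_nonneg_left (sumDist_le hn fun i ↦ ?_) hε.le
      rw [Pi.smul_apply, norm_smul, norm_inv, Real.norm_of_nonneg hε.le,
        inv_mul_le_iff₀ hε, mul_one]
      exact (hmem _).1 (p i).2
    · obtain ⟨u, hu, hu2⟩ := exists_sumDist_eq hn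
      refine le_iSup_of_le (fun i ↦ ⟨ε • u i, (hmem _).2 ?_⟩) ?_
      · rw [norm_smul, Real.norm_of_nonneg hε.le]
        exact mul_le_of_le_one_right hε.le (hu i)
      · change _ ≤ ∑ i, ∑ j ∈ Finset.Ioi i, edist (ε • u i) (ε • u j)
        rw [hsum fun i ↦ ε • u i, ← hu2, ← sumDist_smul ε hε.le]
        rfl
  rw [heq, ENNReal.toReal_ofReal hpos]

end Sums

/-- Bookkeeping for configurations of size `1 + 8 δ s` with relative distance error `4 δ s`. Put `d
= δ s ≤ 1/8`: then `(1 + 8 d)³ - 1 ≤ 24 d + 24 d + 8 d = 56 d`, `(1 + 8 d)³ ≤ 8` and `(1 + 8 d)(1 +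
4 d) ≤ 1 + 16 d`. -/
lemma cubic_upper_bound {Λ G η δ s : ℝ} (hΛ : 0 ≤ Λ) (hη : 0 ≤ η) (hδ : 0 ≤ δ) (hs : 0 ≤ s)
    (hs1 : s ≤ 1) (hδs : 8 * δ * s ≤ 1) :
    (1 + 8 * δ * s) * (Λ - (1 + 8 * δ * s) ^ 2 * s * (G - η) + 4 * δ * s * Λ) ≤
      Λ - s * G + (16 * δ * Λ + 56 * δ * |G| + 8 * η) * s := by
  set d := δ * s with hd
  have hd0 : 0 ≤ d := mul_nonneg hδ hs
  have hd8 : 8 * d ≤ 1 := by rw [hd]; linarith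
  have hdδ : d ≤ δ := by rw [hd]; nlinarith
  have e1 : 8 * δ * s = 8 * d := by rw [hd]; ring
  have e2 : 4 * δ * s = 4 * d := by rw [hd]; ring
  rw [e1, e2]
  have h1 : (1 + 8 * d) ^ 3 - 1 ≤ 56 * d := by
    nlinarith [mul_nonneg hd0 hd0, mul_nonneg hd0 (mul_nonneg hd0 hd0)]
  have h2 : 0 ≤ (1 + 8 * d) ^ 3 - 1 := by
    nlinarith [mul_nonneg hd0 hd0, mul_nonneg hd0 (mul_nonneg hd0 hd0)]
  have h3 : -(((1 + 8 * d) ^ 3 - 1) * (s * G)) ≤ 56 * d * (s * |G|) := by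
    have h4 : -(s * G) ≤ s * |G| := by nlinarith [neg_abs_le G]
    have h5 : 0 ≤ s * |G| := by positivity
    calc -(((1 + 8 * d) ^ 3 - 1) * (s * G)) = ((1 + 8 * d) ^ 3 - 1) * (-(s * G)) := by ring
      _ ≤ ((1 + 8 * d) ^ 3 - 1) * (s * |G|) := mul_le_mul_of_nonneg_left h4 h2
      _ ≤ _ := mul_le_mul_of_nonneg_right h1 h5
  have h6 : 56 * d * (s * |G|) ≤ 56 * δ * (s * |G|) := by gcongr
  have h7 : (1 + 8 * d) ^ 3 * (s * η) ≤ 8 * (s * η) :=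
    mul_le_mul_of_nonneg_right (by linarith) (mul_nonneg hs hη)
  have h8 : (1 + 8 * d) * (1 + 4 * d) * Λ ≤ (1 + 16 * d) * Λ :=
    mul_le_mul_of_nonneg_right (by nlinarith) hΛ
  have h9 : 16 * d * Λ = 16 * δ * Λ * s := by rw [hd]; ring
  linarith

/-- The counterpart for a simplex shrunk by `1 - 4 δ s`; the constants are those of the upper bound,
larger than necessary here. -/
lemma cubic_lower_bound {Λ G δ s : ℝ} (hΛ : 0 ≤ Λ) (hδ : 0 ≤ δ) (hs : 0 ≤ s)
    (hs1 : s ≤ 1) (hδs : 8 * δ * s ≤ 1) :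
    Λ - s * G - (16 * δ * Λ + 56 * δ * |G|) * s ≤
      (1 - 4 * δ * s) * (Λ - (1 - 4 * δ * s) ^ 2 * s * G - 4 * δ * s * Λ) := by
  set d := δ * s with hd
  have hd0 : 0 ≤ d := mul_nonneg hδ hs
  have hd8 : 8 * d ≤ 1 := by rw [hd]; linarith
  have hdδ : d ≤ δ := by rw [hd]; nlinarith
  have e2 : 4 * δ * s = 4 * d := by rw [hd]; ring
  rw [e2]
  have h1 : 1 - (1 - 4 * d) ^ 3 ≤ 56 * d := by
    nlinarith [mul_nonneg hd0 hd0, mul_nonneg hd0 (mul_nonneg hd0 hd0)]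
  have h2 : 0 ≤ 1 - (1 - 4 * d) ^ 3 := by
    have : (1 - 4 * d) ^ 3 ≤ 1 := pow_le_one₀ (by linarith) (by linarith)
    linarith
  have h3 : -((1 - (1 - 4 * d) ^ 3) * (s * G)) ≤ 56 * d * (s * |G|) := by
    have h4 : -(s * G) ≤ s * |G| := by nlinarith [neg_abs_le G]
    have h5 : 0 ≤ s * |G| := by positivity
    calc -((1 - (1 - 4 * d) ^ 3) * (s * G)) = (1 - (1 - 4 * d) ^ 3) * (-(s * G)) := by ring
      _ ≤ (1 - (1 - 4 * d) ^ 3) * (s * |G|) := mul_le_mul_of_nonneg_left h4 h2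
      _ ≤ _ := mul_le_mul_of_nonneg_right h1 h5
  have h6 : 56 * d * (s * |G|) ≤ 56 * δ * (s * |G|) := by gcongr
  have h8 : (1 - 16 * d) * Λ ≤ (1 - 4 * d) * (1 - 4 * d) * Λ :=
    mul_le_mul_of_nonneg_right (by nlinarith) hΛ
  have h9 : 16 * d * Λ = 16 * δ * Λ * s := by rw [hd]; ring
  linarith

/-! ### Expansion of the maximal sum in a small ball -/

namespace NormalChart

variable {M : Type*} [PseudoEMetricSpace M] {x : M} {n : ℕ}

local notation "𝔼" => EuclideanSpace ℝ (Fin n)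

variable (N : NormalChart x (EuclideanSpace ℝ (Fin n)))

/-- The sum of the pairwise distances of finitely many points close to the centre. -/
lemma sum_edist_sub_le {c : ℝ} {z : Fin (n + 1) → 𝔼}
    (hd : ∀ i j, edist (N.toFun (z i)) (N.toFun (z j)) ≠ ⊤ ∧
      |(edist (N.toFun (z i)) (N.toFun (z j))).toReal -
        (‖z j - z i‖ - N.jet.curv (z j - z i) (z i) / (6 * ‖z j - z i‖))| ≤ c * ‖z j - z i‖) :
    |∑ i, ∑ j ∈ Finset.Ioi i, (edist (N.toFun (z i)) (N.toFun (z j))).toReal -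
      (sumDist z - N.jet.sumCurv z)| ≤ c * sumDist z := by
  rw [sumDist, MetricJet.sumCurv, Finset.mul_sum, ← Finset.sum_sub_distrib,
    ← Finset.sum_sub_distrib]
  refine (Finset.abs_sum_le_sum_abs _ _).trans (Finset.sum_le_sum fun i _ ↦ ?_)
  rw [Finset.mul_sum, ← Finset.sum_sub_distrib, ← Finset.sum_sub_distrib]
  exact (Finset.abs_sum_le_sum_abs _ _).trans (Finset.sum_le_sum fun j _ ↦ (hd i j).2)

/-- The distance to the centre. -/
lemma abs_edist_self_sub_le {c : ℝ} {z : 𝔼}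
    (hd : |(edist (N.toFun 0) (N.toFun z)).toReal -
        (‖z - 0‖ - N.jet.curv (z - 0) 0 / (6 * ‖z - 0‖))| ≤ c * ‖z - 0‖) :
    |(edist x (N.toFun z)).toReal - ‖z‖| ≤ c * ‖z‖ := by
  have h0 : N.jet.curv z 0 = 0 := by
    have := N.jet.curv_smul_right 0 z 0
    simpa using this
  rwa [sub_zero, h0, zero_div, sub_zero, N.map_zero] at hd

/-- The third order expansion of the maximal sum of distances of `n + 1` points of a small ball. -/
theorem abs_supSum_sub_le (hn : 0 < n) {η : ℝ} (hη : 0 < η) : ∀ᶠ ε in 𝓝[>] (0 : ℝ),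
    |(supSum (n + 1) (Metric.closedEBall x (ENNReal.ofReal ε))).toReal -
      ε * (simplexSum n - ε ^ 2 * (simplexSum n / (12 * n ^ 2) * N.jet.scal))| ≤
        η * ε ^ 3 := by
  set Λ := simplexSum n with hΛ
  have hΛ0 : 0 < Λ := simplexSum_pos hn
  set G := Λ / (12 * n ^ 2) * N.jet.scal with hG
  -- Makes the `δ` errors of the cubic bounds at most `η/2`; the tolerance `η/16`, multiplied by `8`
  -- in `cubic_upper_bound`, accounts for the other half.
  set δ := η / (2 * (16 * Λ + 56 * |G| + 1)) with hδ
  have hδ0 : 0 < δ := by positivity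
  have hδη : 16 * δ * Λ + 56 * δ * |G| + 8 * (η / 16) ≤ η := by
    have : δ * (2 * (16 * Λ + 56 * |G| + 1)) = η := div_mul_cancel₀ _ (by positivity)
    linarith
  obtain ⟨t₀, ht₀, ht⟩ := mem_nhdsGT_iff_exists_Ioo_subset.1
    (N.jet.eventually_sumDist_sub_le hn (η := η / 16) (by positivity))
  have ht₀ : 0 < t₀ := ht₀
  -- Points of the `ε`-ball have coordinates of norm at most `2 ε`, so the distance expansion is
  -- used with `ρ = 2 ε`; its relative error is `4 δ ε²`.
  have htwo : Tendsto (fun ε : ℝ ↦ 2 * ε) (𝓝[>] 0) (𝓝[>] 0) := by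
    refine tendsto_nhdsWithin_iff.2 ⟨?_, ?_⟩
    · have : Continuous fun ε : ℝ ↦ 2 * ε := by fun_prop
      have := (this.tendsto 0).mono_left (nhdsWithin_le_nhds (s := Ioi 0))
      simpa using this
    · filter_upwards [self_mem_nhdsWithin] with ε hε
      exact mul_pos two_pos (mem_Ioi.1 hε)
  filter_upwards [htwo.eventually (N.abs_edist_sub_le hδ0), eventually_mul_lt 1 N.outerRadius_pos,
    eventually_mul_sq_le (8 * δ) one_pos, eventually_mul_sq_le 1 one_pos,
    eventually_mul_sq_le 8 ht₀, eventually_mul_sq_le G hΛ0, self_mem_nhdsWithin]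
    with ε hdist hR hδε hε1 hεt hεG hε
  have hε : 0 < ε := hε
  rw [one_mul] at hR hε1
  set s := ε ^ 2 with hs
  have hs0 : 0 < s := by positivity
  have hδs : 0 < δ * s := by positivity
  have hc : δ * (2 * ε) ^ 2 = 4 * δ * s := by rw [hs]; ring
  simp only [hc] at hdist
  have hzero : ‖(0 : 𝔼)‖ ≤ 2 * ε := by rw [norm_zero]; positivity
  have hup : supSum (n + 1) (Metric.closedEBall x (ENNReal.ofReal ε)) ≤
      ENNReal.ofReal (ε * (Λ - s * G + η * s)) := by
    refine iSup_le fun p ↦ ?_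
    have hpx (i : Fin (n + 1)) : edist x (p i) ≤ ENNReal.ofReal ε := by
      rw [edist_comm]
      exact (p i).2
    have hpR (i : Fin (n + 1)) : edist x (p i) < ENNReal.ofReal N.outerRadius :=
      (hpx i).trans_lt ((ENNReal.ofReal_lt_ofReal_iff N.outerRadius_pos).2 hR)
    have hpε (i : Fin (n + 1)) : (edist x (p i)).toReal ≤ ε :=
      ENNReal.toReal_le_of_le_ofReal hε.le (hpx i)
    set z : Fin (n + 1) → 𝔼 := fun i ↦ N.inv (p i) with hz
    have hφ (i : Fin (n + 1)) : N.toFun (z i) = p i :=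
      N.right_inv _ (by rw [Metric.mem_eball, edist_comm]; exact hpR i)
    have hz2 (i : Fin (n + 1)) : ‖z i‖ ≤ 2 * ε := by
      have := N.norm_inv_le (hpR i)
      linarith [hpε i]
    -- The distance to the centre gives `(1 - 4 δ s)‖z i‖ ≤ ε`, and `1/(1 - 4 δ s) ≤ 1 + 8 δ s` as
    -- long as `8 δ s ≤ 1`.
    set k := 1 + 8 * δ * s with hk
    have hk0 : 0 < k := by positivity
    have hk2 : k ≤ 2 := by linarith
    have hz1 (i : Fin (n + 1)) : ‖z i‖ ≤ k * ε := by
      have h1 := N.abs_edist_self_sub_le (hdist 0 (z i) hzero (hz2 i)).2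
      rw [hφ] at h1
      have h2 : (1 - 4 * δ * s) * ‖z i‖ ≤ ε := by linarith [abs_le.1 h1, hpε i]
      have h3 : 1 ≤ k * (1 - 4 * δ * s) := by rw [hk]; nlinarith
      calc ‖z i‖ = 1 * ‖z i‖ := (one_mul _).symm
        _ ≤ k * (1 - 4 * δ * s) * ‖z i‖ := mul_le_mul_of_nonneg_right h3 (norm_nonneg _)
        _ = k * ((1 - 4 * δ * s) * ‖z i‖) := by ring
        _ ≤ k * ε := mul_le_mul_of_nonneg_left h2 hk0.le
    have hkε : 0 < k * ε := mul_pos hk0 hε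
    set v := (k * ε)⁻¹ • z with hv
    have hzv : z = (k * ε) • v := by rw [hv, smul_smul, mul_inv_cancel₀ hkε.ne', one_smul]
    have hv1 (i : Fin (n + 1)) : ‖v i‖ ≤ 1 := by
      rw [hv, Pi.smul_apply, norm_smul, norm_inv, Real.norm_of_nonneg hkε.le,
        inv_mul_le_iff₀ hkε, mul_one]
      exact hz1 i
    have hsum := N.sum_edist_sub_le (c := 4 * δ * s) (z := z) fun i j ↦
      hdist (z i) (z j) (hz2 i) (hz2 j)
    have htop (i j : Fin (n + 1)) : edist (p i) (p j) ≠ ⊤ := by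
      have := (hdist (z i) (z j) (hz2 i) (hz2 j)).1
      rw [hφ, hφ] at this
      exact this
    rw [sum_edist_eq_ofReal htop]
    refine ENNReal.ofReal_le_ofReal ?_
    have heq : ∑ i, ∑ j ∈ Finset.Ioi i, (edist (p i) (p j)).toReal =
        ∑ i, ∑ j ∈ Finset.Ioi i, (edist (N.toFun (z i)) (N.toFun (z j))).toReal := by
      simp only [hφ]
      rfl
    rw [heq]
    have h1 := (abs_le.1 hsum).2
    rw [hzv, sumDist_smul _ hkε.le, N.jet.sumCurv_smul hkε, ← hzv] at h1
    have hkt : (k * ε) ^ 2 ∈ Ioo 0 t₀ := by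
      refine ⟨by positivity, ?_⟩
      have : k ^ 2 ≤ 4 := by nlinarith
      rw [mul_pow, ← hs]
      nlinarith
    have h2 := ht hkt v hv1
    have h3 := sumDist_le hn hv1
    have h4 := cubic_upper_bound (G := G) (η := η / 16) hΛ0.le (by positivity) hδ0.le hs0.le hε1 hδε
    rw [← hk] at h4
    have h5 : (k * ε) ^ 2 = k ^ 2 * s := by rw [hs]; ring
    have h6 : (k * ε) ^ 3 = k * ε * (k ^ 2 * s) := by rw [hs]; ring
    rw [h5] at h2
    rw [h6] at h1
    have h7 := mul_le_mul_of_nonneg_left h3 (by positivity : 0 ≤ 4 * δ * s)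
    have h8 := mul_le_mul_of_nonneg_left (add_le_add h2 h7) hkε.le
    have h9 := mul_le_mul_of_nonneg_left h4 hε.le
    have h10 := mul_le_mul_of_nonneg_left (mul_le_mul_of_nonneg_right hδη hs0.le) hε.le
    calc _ ≤ k * ε * (sumDist v - k ^ 2 * s * N.jet.sumCurv v + 4 * δ * s * sumDist v) := by
          linarith
      _ ≤ k * ε * (Λ - k ^ 2 * s * (G - η / 16) + 4 * δ * s * Λ) := h8
      _ = ε * (k * (Λ - k ^ 2 * s * (G - η / 16) + 4 * δ * s * Λ)) := by ring
      _ ≤ _ := h9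
      _ ≤ _ := by linarith
  have hlow : ENNReal.ofReal (ε * (Λ - s * G - η * s)) ≤
      supSum (n + 1) (Metric.closedEBall x (ENNReal.ofReal ε)) := by
    obtain ⟨u, hu, hu2⟩ := exists_sumDist_eq hn
    have hu3 := N.jet.sumCurv_eq hn hu hu2
    -- A regular simplex of radius `k ε` stays in the metric ball, because `(1 + 4 δ s)(1 - 4 δ s) ≤
    -- 1`.
    set k := 1 - 4 * δ * s with hk
    have hk0 : 0 < k := by linarith
    have hk1 : k ≤ 1 := by linarith
    have hkε : 0 < k * ε := mul_pos hk0 hε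
    set z : Fin (n + 1) → 𝔼 := (k * ε) • u with hz
    have hz1 (i : Fin (n + 1)) : ‖z i‖ ≤ k * ε := by
      rw [hz, Pi.smul_apply, norm_smul, Real.norm_of_nonneg hkε.le]
      exact mul_le_of_le_one_right hkε.le (hu i)
    have hz2 (i : Fin (n + 1)) : ‖z i‖ ≤ 2 * ε := (hz1 i).trans (by nlinarith)
    have hmem (i : Fin (n + 1)) :
        N.toFun (z i) ∈ Metric.closedEBall x (ENNReal.ofReal ε) := by
      obtain ⟨h0, h1⟩ := hdist 0 (z i) hzero (hz2 i)
      have h1 := N.abs_edist_self_sub_le h1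
      rw [N.map_zero] at h0
      rw [Metric.mem_closedEBall, edist_comm]
      refine (ENNReal.le_ofReal_iff_toReal_le h0 hε.le).2 ?_
      have h2 : (edist x (N.toFun (z i))).toReal ≤ (1 + 4 * δ * s) * ‖z i‖ := by
        linarith [abs_le.1 h1]
      have h3 : (1 + 4 * δ * s) * k ≤ 1 := by rw [hk]; nlinarith
      calc _ ≤ (1 + 4 * δ * s) * (k * ε) :=
            h2.trans (mul_le_mul_of_nonneg_left (hz1 i) (by positivity))
        _ = (1 + 4 * δ * s) * k * ε := by ring
        _ ≤ 1 * ε := mul_le_mul_of_nonneg_right h3 hε.le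
        _ = ε := one_mul ε
    have hsum := N.sum_edist_sub_le (c := 4 * δ * s) (z := z) fun i j ↦
      hdist (z i) (z j) (hz2 i) (hz2 j)
    refine le_iSup_of_le (fun i ↦ ⟨N.toFun (z i), hmem i⟩) ?_
    change _ ≤ ∑ i, ∑ j ∈ Finset.Ioi i, edist (N.toFun (z i)) (N.toFun (z j))
    rw [sum_edist_eq_ofReal (p := fun i ↦ N.toFun (z i)) fun i j ↦
      (hdist (z i) (z j) (hz2 i) (hz2 j)).1]
    refine ENNReal.ofReal_le_ofReal ?_
    have h1 := (abs_le.1 hsum).1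
    have hsd : sumDist z = k * ε * Λ := by rw [hz, sumDist_smul _ hkε.le, hu2]
    have hsc : N.jet.sumCurv z = k * ε * (k ^ 2 * s) * G := by
      rw [hz, N.jet.sumCurv_smul hkε, hu3, hs]
      ring
    rw [hsd, hsc] at h1
    have h4 := cubic_lower_bound (G := G) hΛ0.le hδ0.le hs0.le hε1 hδε
    rw [← hk] at h4
    have h9 := mul_le_mul_of_nonneg_left h4 hε.le
    have h10 := mul_le_mul_of_nonneg_left (mul_le_mul_of_nonneg_right hδη hs0.le) hε.le
    have h11 : 0 ≤ ε * (8 * (η / 16) * s) := by positivity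
    calc ε * (Λ - s * G - η * s)
        ≤ ε * (Λ - s * G - (16 * δ * Λ + 56 * δ * |G|) * s) := by linarith
      _ ≤ ε * (k * (Λ - k ^ 2 * s * G - 4 * δ * s * Λ)) := h9
      _ = k * ε * Λ - k * ε * (k ^ 2 * s) * G - 4 * δ * s * (k * ε * Λ) := by ring
      _ ≤ _ := by linarith
  have hne : supSum (n + 1) (Metric.closedEBall x (ENNReal.ofReal ε)) ≠ ⊤ :=
    (hup.trans_lt ENNReal.ofReal_lt_top).ne
  have h1 := (ENNReal.ofReal_le_iff_le_toReal hne).1 hlow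
  -- Excludes truncation by `ENNReal.ofReal` in the upper bound; it is the purpose of the smallness
  -- condition `hεG`.
  have hpos : 0 ≤ ε * (Λ - s * G + η * s) := by
    have h2 : 0 ≤ Λ - s * G := by linarith
    positivity
  have h2 := ENNReal.toReal_le_of_le_ofReal hpos hup
  have h3 : η * ε ^ 3 = ε * (η * s) := by rw [hs]; ring
  rw [h3, abs_le]
  constructor <;> linarith

end NormalChart

end

theorem corollary1p2 {n : ℕ} {H : Type*} [TopologicalSpace H]
    (I : ModelWithCorners ℝ (EuclideanSpace ℝ (Fin n)) H)
    {M : Type*} [EMetricSpace M] [ChartedSpace H M] [IsManifold I ∞ M]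
    [Bundle.RiemannianBundle (fun x : M ↦ TangentSpace I x)]
    [IsContMDiffRiemannianBundle I ∞ (EuclideanSpace ℝ (Fin n)) (fun x : M ↦ TangentSpace I x)]
    [IsRiemannianManifold I M]
    (x : M) (hx : I.IsInteriorPoint x) :
    Filter.Tendsto
      (fun ε : ℝ ↦ 12 * (n : ℝ) ^ 2 / ε ^ 2 *
        (1 - (extent (n + 1) (Metric.closedEBall x (ENNReal.ofReal ε))).toReal /
          (extent (n + 1) (Metric.closedEBall (0 : EuclideanSpace ℝ (Fin n))
            (ENNReal.ofReal ε))).toReal))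
      (nhdsWithin 0 (Set.Ioi 0)) (nhds (scalarCurvature I x)) := by
  -- In dimension `0` the factor `n²` and the empty trace both vanish.
  rcases Nat.eq_zero_or_pos n with rfl | hn
  · have h0 : scalarCurvature I x = 0 := by simp [scalarCurvature]
    rw [h0]
    refine tendsto_const_nhds.congr fun ε ↦ ?_
    simp
  obtain ⟨N, hN⟩ := RiemannianCoord.exists_normalChart I x hx
  have hΛ := simplexSum_pos hn
  have hn' : (0 : ℝ) < n := by exact_mod_cast hn
  rw [Metric.tendsto_nhds]
  intro η hη
  -- The error in the maximal sum is multiplied by `12 n²/(Λ ε³)`; this tolerance turns it into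
  -- `η/2`.
  have hη' : 0 < η / 2 * simplexSum n / (12 * n ^ 2) := by positivity
  filter_upwards [N.abs_supSum_sub_le hn hη', self_mem_nhdsWithin] with ε hε hpos
  have hpos : 0 < ε := hpos
  rw [toReal_extent_div (by omega), toReal_supSum_euclidean hn hpos]
  set S := (supSum (n + 1) (Metric.closedEBall x (ENNReal.ofReal ε))).toReal
  rw [Real.dist_eq, ← hN]
  change |_ - N.jet.scal| < η
  have key : 12 * (n : ℝ) ^ 2 / ε ^ 2 * (1 - S / (ε * simplexSum n)) - N.jet.scal =
      -(12 * n ^ 2 / (simplexSum n * ε ^ 3)) *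
        (S - ε * (simplexSum n - ε ^ 2 * (simplexSum n / (12 * n ^ 2) * N.jet.scal))) := by
    field_simp
    ring
  rw [key, abs_mul, abs_neg, abs_of_pos (by positivity)]
  calc _ ≤ 12 * n ^ 2 / (simplexSum n * ε ^ 3) *
        (η / 2 * simplexSum n / (12 * n ^ 2) * ε ^ 3) :=
      mul_le_mul_of_nonneg_left hε (by positivity)
    _ = η / 2 := by field_simp
    _ < η := by linarith
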